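/- Let $G$ be a complex Lie group whose Lie algebra $\mathfrak g$ is semisimple. Let $\mathfrak g_0\subset\mathfrak g$ be a real form, with complex conjugation $\sigma$, and let $\theta$ be a Cartan involution of $\mathfrak g$ (regarded as a real Lie algebra), i.e. the conjugation of $\mathfrak g$ over a compact real form $\mathfrak g_u$, with $\sigma\theta=\theta\sigma$. Put $\mathfrak k_0=\mathfrak g_u\cap\mathfrak g_0$ and $\mathfrak s_0=\{\xi\in\mathfrak g_0:\theta\xi=-\xi\}$, so that $\mathfrak g_0=\mathfrak k_0\oplus\mathfrak s_0$. Let $G_0$, $K_0$ and $K$ be the connected Lie subgroups of $G$ with Lie algebras $\mathfrak g_0$, $\mathfrak k_0$ and $\mathfrak k_0\otimes\mathbb C=\mathfrak k_0+i\mathfrak k_0$. Let $M=G_0/K_0$ be the associated Riemannian symmetric space, $x_0=1K\in G/K$, and identify the tangent bundle $TM$ with $G_0\times_{K_0}\mathfrak s_0$, the quotient of $G_0\times\mathfrak s_0$ by $(g,\xi)\sim(gk,\mathrm{Ad}(k)^{-1}\xi)$, $k\in K_0$. Let $\mathfrak a_0$ be a maximal abelian subspace of $\mathfrak s_0$. A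 restricted root is a nonzero $\alpha\in\mathfrak a_0^*$ for which there is $0\neq X\in\mathfrak g_0$ with $[\xi,X]=\alpha(\xi)X$ for all $\xi\in\mathfrak a_0$. Let $$V=\{\xi\in\mathfrak a_0 : |\alpha(\xi)|<\tfrac{\pi}{2}\text{ for all restricted roots }\alpha\},\qquad \mathcal U=G_0\cdot\exp(iV)\cdot x_0\subset G/K .$$ Then the universal domain $\mathcal U$ is contractible. More precisely: 1. The polar coordinate map $\Pi:TM\to G/K$, $\Pi([g,\xi])=g\exp(i\xi)\cdot x_0$, is well defined and continuous, and restricts to a homeomorphism of $\mathcal V=\{[g,\xi]: g\in G_0,\ \xi\in V\}\subset TM$ onto $\mathcal U$. 2. The zero section of $TM$ lies in $\mathcal V$. The fibrewise scalings $\varphi_t([g,\xi])=[g,t\xi]$, $0\le t\le 1$, map $\mathcal V$ into itself, depend continuously on $(t,v)\in[0,1]\times\mathcal V$, and form a strong deformation retraction of $\mathcal V$ onto the zero section ($\varphi_1=\mathrm{id}$, $\varphi_0$ maps $\mathcal V$ into the zero section, and every $\varphi_t$ fixes the zero section pointwise). 3. The map $gK_0\mapsto[g,0]$ is a homeomorphism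 of $M$ onto the zero section, and $M$ is contractible. -/

import Mathlib

open scoped Manifold ContDiff

noncomputable section

namespace UniversalDomain

/-! ### Complex semisimple Lie algebras: real forms, Cartan involutions, restricted roots -/

section Algebra

variable {𝔤 : Type*} [LieRing 𝔤] [LieAlgebra ℂ 𝔤]

/-- `τ` is the complex conjugation of `𝔤` over a real form: a conjugate-linear involutive
automorphism of the Lie algebra. The real form is the fixed point set of `τ`. -/
structure IsConjugation (τ : 𝔤 →ₛₗ[starRingEnd ℂ] 𝔤) : Prop where
  involutive : ∀ X, τ (τ X) = X
  map_lie : ∀ X Y, τ ⁅X, Y⁆ = ⁅τ X, τ Y⁆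

/-- `θ` is a Cartan involution of the complex semisimple Lie algebra `𝔤` (regarded as a real Lie
algebra, whose Killing form is twice the real part of the complex one): it is the conjugation over
a compact real form, i.e. the form `-Re B(X, θ Y)` is positive definite. -/
structure IsCartanInvolution (θ : 𝔤 →ₛₗ[starRingEnd ℂ] 𝔤) : Prop extends IsConjugation θ where
  neg_re_killing : ∀ X, X ≠ 0 → (killingForm ℂ 𝔤 X (θ X)).re < 0

/-- The real form `𝔤₀` of `𝔤` determined by the conjugation `σ`. -/
def realForm (σ : 𝔤 →ₛₗ[starRingEnd ℂ] 𝔤) : Submodule ℝ 𝔤 where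
  carrier := {X | σ X = X}
  add_mem' {X Y} hX hY := by
    change σ X = X at hX
    change σ Y = Y at hY
    change σ (X + Y) = X + Y
    rw [map_add, hX, hY]
  zero_mem' := map_zero σ
  smul_mem' r X hX := by
    change σ X = X at hX
    change σ (r • X) = r • X
    rw [← Complex.coe_smul, map_smulₛₗ, hX, Complex.conj_ofReal]

/-- `𝔨₀ = 𝔤ᵤ ∩ 𝔤₀`, where `𝔤ᵤ` is the compact real form of `𝔤` fixed by `θ`. -/
def compactPart (σ θ : 𝔤 →ₛₗ[starRingEnd ℂ] 𝔤) : Submodule ℝ 𝔤 := realForm θ ⊓ realForm σ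

/-- `𝔰₀`, the `(-1)`-eigenspace of `θ` in `𝔤₀`, so that `𝔤₀ = 𝔨₀ ⊕ 𝔰₀`. -/
def noncompactPart (σ θ : 𝔤 →ₛₗ[starRingEnd ℂ] 𝔤) : Submodule ℝ 𝔤 := realForm (-θ) ⊓ realForm σ

/-- `𝔞₀` is a maximal abelian subspace of `𝔰₀`. -/
def IsMaximalAbelian (σ θ : 𝔤 →ₛₗ[starRingEnd ℂ] 𝔤) (𝔞₀ : Submodule ℝ 𝔤) : Prop :=
  Maximal (fun 𝔟 : Submodule ℝ 𝔤 =>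
    𝔟 ≤ noncompactPart σ θ ∧ ∀ X ∈ 𝔟, ∀ Y ∈ 𝔟, ⁅X, Y⁆ = 0) 𝔞₀

/-- `α` is a restricted root: a nonzero joint eigenvalue of `ad 𝔞₀` acting on `𝔤₀`. -/
def IsRestrictedRoot (σ : 𝔤 →ₛₗ[starRingEnd ℂ] 𝔤) (𝔞₀ : Submodule ℝ 𝔤)
    (α : Module.Dual ℝ 𝔞₀) : Prop :=
  α ≠ 0 ∧ ∃ X ∈ realForm σ, X ≠ 0 ∧ ∀ ξ : 𝔞₀, ⁅(ξ : 𝔤), X⁆ = α ξ • X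

/-- The polyhedron `V = {ξ ∈ 𝔞₀ : |α(ξ)| < π / 2 for all restricted roots α}`. -/
def polyhedron (σ : 𝔤 →ₛₗ[starRingEnd ℂ] 𝔤) (𝔞₀ : Submodule ℝ 𝔤) : Set 𝔤 :=
  {X | ∃ ξ : 𝔞₀, (ξ : 𝔤) = X ∧
    ∀ α : Module.Dual ℝ 𝔞₀, IsRestrictedRoot σ 𝔞₀ α → |α ξ| < Real.pi / 2}

end Algebra

/-! ### The groups -/

section Group

variable {E : Type*} [NormedAddCommGroup E] [NormedSpace ℂ E]
  {G : Type*} [TopologicalSpace G] [ChartedSpace E G] [Group G]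

/-- `γ : ℂ → G` is the holomorphic one-parameter subgroup with initial velocity `X`. A homomorphism
that is complex differentiable at `0` is holomorphic everywhere. -/
structure IsOneParameter (γ : ℂ → G) (X : GroupLieAlgebra 𝓘(ℂ, E) G) : Prop where
  map_add : ∀ s t, γ (s + t) = γ s * γ t
  hasMFDerivAt : HasMFDerivAt 𝓘(ℂ, ℂ) 𝓘(ℂ, E) γ 0
    ((ContinuousLinearMap.toSpanSingleton ℂ X : ℂ →L[ℂ] GroupLieAlgebra 𝓘(ℂ, E) G))

open Classical in
/-- The exponential map of the complex Lie group `G`: `exp X = γ 1` for the one-parameter subgroup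
`γ` with initial velocity `X` (in a complex Lie group it exists and is unique for every `X`). -/
def lieExp (X : GroupLieAlgebra 𝓘(ℂ, E) G) : G :=
  if h : ∃ γ : ℂ → G, IsOneParameter γ X then h.choose 1 else 1

/-- The adjoint representation: `Ad g` is the derivative at `1` of `h ↦ g * h * g⁻¹`. -/
def lieAd (g : G) : GroupLieAlgebra 𝓘(ℂ, E) G → GroupLieAlgebra 𝓘(ℂ, E) G :=
  fun X => mfderiv 𝓘(ℂ, E) 𝓘(ℂ, E) (fun h : G => g * h * g⁻¹) 1 X

/-- The subgroup of `G` generated by `exp W`. If `W` is a real Lie subalgebra of the Lie algebra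
of `G`, this is the connected (analytic) subgroup of `G` with Lie algebra `W`. -/
def analyticSubgroup (W : Set (GroupLieAlgebra 𝓘(ℂ, E) G)) : Subgroup G :=
  Subgroup.closure (lieExp '' W)

variable [CompleteSpace E] [LieGroup 𝓘(ℂ, E) ω G]
  (σ θ : GroupLieAlgebra 𝓘(ℂ, E) G →ₛₗ[starRingEnd ℂ] GroupLieAlgebra 𝓘(ℂ, E) G)

/-- `G₀`, the connected real form of `G` with Lie algebra `𝔤₀`. -/
abbrev G₀ : Subgroup G := analyticSubgroup (realForm σ : Set (GroupLieAlgebra 𝓘(ℂ, E) G))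

/-- `K₀`, the connected subgroup of `G₀` with Lie algebra `𝔨₀`. -/
abbrev K₀ : Subgroup G := analyticSubgroup (compactPart σ θ : Set (GroupLieAlgebra 𝓘(ℂ, E) G))

/-- `K`, the complexification of `K₀`: the connected subgroup of `G` whose Lie algebra is the
complex span of `𝔨₀`. -/
abbrev K : Subgroup G :=
  analyticSubgroup (Submodule.span ℂ (compactPart σ θ : Set (GroupLieAlgebra 𝓘(ℂ, E) G)) :
    Set (GroupLieAlgebra 𝓘(ℂ, E) G))

/-! ### The symmetric space, its tangent bundle, and the universal domain -/

/-- The Riemannian symmetric space `M = G₀ / K₀`, with the quotient topology. -/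
abbrev SymmetricSpace : Type _ := G₀ σ ⧸ (K₀ σ θ).subgroupOf (G₀ σ)

/-- `(g, ξ) ∼ (g', ξ')` on `G₀ × 𝔰₀` iff `(g', ξ') = (g k, Ad(k)⁻¹ ξ)` for some `k ∈ K₀`. -/
def tangentRel (v w : G₀ σ × noncompactPart σ θ) : Prop :=
  ∃ k ∈ K₀ σ θ, (w.1 : G) = v.1 * k ∧
    (v.2 : GroupLieAlgebra 𝓘(ℂ, E) G) = lieAd k (w.2 : GroupLieAlgebra 𝓘(ℂ, E) G)

/-- The tangent bundle of `M` as the homogeneous bundle `TM = G₀ ×_{K₀} 𝔰₀`, with the quotient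
topology. -/
abbrev TangentM : Type _ := Quot (tangentRel σ θ)

variable {σ θ} in
/-- The class `[g, ξ] ∈ TM`. -/
def tangentMk (g : G₀ σ) (ξ : noncompactPart σ θ) : TangentM σ θ := Quot.mk _ (g, ξ)

/-- The zero section of `TM`. -/
def zeroSection : Set (TangentM σ θ) := {v | ∃ g : G₀ σ, v = tangentMk g 0}

variable (𝔞₀ : Submodule ℝ (GroupLieAlgebra 𝓘(ℂ, E) G))

/-- The subset `{[g, ξ] : g ∈ G₀, ξ ∈ V}` of `TM`. -/
def tube : Set (TangentM σ θ) :=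
  {v | ∃ (g : G₀ σ) (ξ : noncompactPart σ θ),
    (ξ : GroupLieAlgebra 𝓘(ℂ, E) G) ∈ polyhedron σ 𝔞₀ ∧ v = tangentMk g ξ}

/-- The point `g exp(i ξ) x₀` of `G / K`, where `x₀ = 1 K` is the base point. -/
def polarPoint (g : G) (ξ : GroupLieAlgebra 𝓘(ℂ, E) G) : G ⧸ K σ θ :=
  QuotientGroup.mk (g * lieExp (Complex.I • ξ))

/-- The universal domain `U = G₀ exp(i V) x₀ ⊆ G / K`. -/
def universalDomain : Set (G ⧸ K σ θ) :=
  {x | ∃ g ∈ G₀ σ, ∃ ξ ∈ polyhedron σ 𝔞₀, x = polarPoint σ θ g ξ}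

end Group

/-- `φ` is a strong deformation retraction of `X` onto `A`: it starts (at time `1`) at the identity,
ends (at time `0`) in `A`, and fixes `A` pointwise at all times. -/
structure IsStrongDeformationRetraction {X : Type*} [TopologicalSpace X] (A : Set X)
    (φ : unitInterval × X → X) : Prop where
  continuous : Continuous φ
  map_one : ∀ x, φ (1, x) = x
  map_zero_mem : ∀ x, φ (0, x) ∈ A
  map_of_mem : ∀ t, ∀ a ∈ A, φ (t, a) = a

end UniversalDomain

end

/-! Everything is read off from the adjoint representation. With the inner product `-B(Y, θ X)` the
Lie algebra is a Hilbert space on which `𝔰₀` acts by self-adjoint operators and `K₀` by unitary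
ones. Polar decomposition of `Ad g` gives the Cartan decomposition `G₀ = exp(𝔰₀) K₀` with continuous
factors (`CartanData.polar`, `CartanData.mem_compactGroup`). Writing `g = exp(η) k`, the map `[g, ξ]
↦ (η, Ad(k) ξ)` identifies `TM` with `𝔰₀ × 𝔰₀` (`IsCartanModel.exists_tangent_homeomorph`). In these
coordinates the tube is star-shaped about the origin and fibre scaling multiplies the second
coordinate, so the contractibility statements and the retraction follow once polar coordinates are
understood.

The substance is that polar coordinates map the tube homeomorphically onto the universal domain. Let
`τ = σ θ`, a complex linear involution commuting with `Ad K`. The map `g K ↦ Ad(g) τ Ad(g)⁻¹ τ` is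
continuous on `G / K`, and composed with polar coordinates it becomes `F(η, ζ) = e^{ad η} e^{2i ad
ζ} e^{ad η}`. If `F` is injective with continuous inverse on the tube, then the polar map is
injective and inducing there, hence a homeomorphism onto its image; neither openness of the domain
nor closedness of `K` enters.

On the tube `‖ad ζ‖ < π/2`, because the nonzero eigenvalues of `ad ξ`, `ξ ∈ 𝔞₀`, are values of
restricted roots (`IsCartanModel.norm_lt`). Suppose `F(η_i, ζ_i) → F(η₀, ζ₀)`. Multiplying by
`e^{-ad η₀}` on both sides and polar-decomposing `e^{-ad η₀} e^{ad η_i}` reduces to `η₀ = 0`, that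
is to `p u p → u₀` with `p` positive and `u`, `u₀` unitary. Then `(p u p)(p u p)* = p (u p u*)² p →
1`, and operator monotonicity of the square root and of the logarithm gives `p (u p u*) → 1` and
`log p + u (log p) u* → 0`. Hence `u → u₀` and `u η + η → 0`. Since `-1` is not in the spectrum of
`u₀`, `η → 0`, and the principal argument of `u` recovers `ζ` (`tendsto_zero_of_tendsto_polar`,
`tendsto_of_tendsto_polar`).

The link with `G` is that `Ad` is locally a homeomorphism onto the automorphism group of the Lie
algebra: its derivative is `ad`, and every derivation is inner. Its local inverse yields the
exponential map of `G` and its properties (`IsCartanModel.isExpMap_lieExp`). -/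

namespace UniversalDomain

open NormedSpace Filter Topology

/-! ### Exponentials in complex Banach algebras. -/

section ExpBasics

variable {A : Type*} [NormedRing A] [NormedAlgebra ℂ A] [CompleteSpace A]

theorem exp_add_of_commute_complex {x y : A} (h : Commute x y) :
    exp (x + y) = exp x * exp y := by
  let _ : NormedAlgebra ℚ A := NormedAlgebra.restrictScalars ℚ ℂ A
  exact exp_add_of_commute h

theorem exp_mul_exp_neg (x : A) : exp x * exp (-x) = 1 := by
  rw [← exp_add_of_commute_complex (Commute.neg_right (Commute.refl x))]
  simp

theorem exp_neg_mul_exp (x : A) : exp (-x) * exp x = 1 := by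
  simpa using exp_mul_exp_neg (-x)

theorem exp_mul_self (x : A) : exp x * exp x = exp (x + x) :=
  (exp_add_of_commute_complex (Commute.refl x)).symm

theorem continuous_exp_complex : Continuous (exp : A → A) := by
  let _ : NormedAlgebra ℚ A := NormedAlgebra.restrictScalars ℚ ℂ A
  exact exp_continuous

theorem exp_conj_of_inverse {a b : A} (hab : a * b = 1) (hba : b * a = 1) (x : A) :
    exp (a * x * b) = a * exp x * b := by
  let _ : NormedAlgebra ℚ A := NormedAlgebra.restrictScalars ℚ ℂ A
  exact exp_units_conj ⟨a, b, hab, hba⟩ x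

/-- A one-parameter family of operators that is differentiable at `0` is an exponential. -/
theorem eq_exp_of_map_add {f : ℂ → A} (hadd : ∀ s t, f (s + t) = f s * f t) (h0 : f 0 = 1)
    {a : A} (ha : HasDerivAt f a 0) (t : ℂ) : f t = exp (t • a) := by
  have hf : ∀ t, HasDerivAt f (f t * a) t := by
    intro t
    have h1 : HasDerivAt (fun s => f (s - t)) a t := by
      have := HasDerivAt.comp_sub_const (f := f) (f' := a) t t (by simpa using ha)
      exact this
    have h2 := h1.const_mul (f t)
    refine h2.congr_of_eventuallyEq (Eventually.of_forall fun s => ?_)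
    simp only
    rw [← hadd]
    congr 1
    ring
  have hg : ∀ t, HasDerivAt (fun s : ℂ => exp (s • (-a))) (-a * exp (t • (-a))) t :=
    fun t => hasDerivAt_exp_smul_const' (-a) t
  have hconst : ∀ t, HasDerivAt (fun s => f s * exp (s • (-a))) 0 t := by
    intro t
    have := (hf t).mul (hg t)
    refine this.congr_deriv ?_
    noncomm_ring
  have h3 := is_const_of_deriv_eq_zero (fun t => (hconst t).differentiableAt)
    (fun t => (hconst t).deriv) t 0
  simp only [h0, zero_smul, exp_zero, mul_one] at h3
  calc f t = f t * (exp (t • (-a)) * exp (t • a)) := by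
        rw [smul_neg, exp_neg_mul_exp, mul_one]
    _ = exp (t • a) := by rw [← mul_assoc, h3, one_mul]

end ExpBasics

/-! ### Order estimates for exponentials in a C*-algebra. -/

section CStar

variable {A : Type*} [CStarAlgebra A] [PartialOrder A] [StarOrderedRing A]

theorem norm_le_of_mem_Icc_algebraMap {a : A} (ha : IsSelfAdjoint a) {δ : ℝ} (hδ : 0 ≤ δ)
    (h1 : -algebraMap ℝ A δ ≤ a) (h2 : a ≤ algebraMap ℝ A δ) : ‖a‖ ≤ δ := by
  rcases subsingleton_or_nontrivial A with hA | hA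
  · rw [Subsingleton.elim a 0, norm_zero]
    exact hδ
  have key : ∀ x ∈ spectrum ℝ a, |x| ≤ δ := by
    intro x hx
    rw [abs_le]
    constructor
    · rw [← map_neg] at h1
      exact (algebraMap_le_iff_le_spectrum (a := a) (r := -δ)).mp h1 x hx
    · exact (le_algebraMap_iff_spectrum_le (a := a)).mp h2 x hx
  rw [← cfc_id ℝ a]
  exact norm_cfc_le hδ fun x hx => by simpa using key x hx

theorem isStrictlyPositive_exp {S : A} (hS : IsSelfAdjoint S) : IsStrictlyPositive (exp S) := by
  refine IsUnit.isStrictlyPositive ?_ hS.exp_nonneg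
  exact ⟨⟨exp S, exp (-S), exp_mul_exp_neg S, exp_neg_mul_exp S⟩, rfl⟩

omit [PartialOrder A] [StarOrderedRing A] in
theorem isSelfAdjoint_real_smul {S : A} (hS : IsSelfAdjoint S) (t : ℝ) :
    IsSelfAdjoint (t • S) := by
  rw [isSelfAdjoint_iff, star_smul, hS.star_eq]; simp

section TwoPositives

variable {S R : A} (hS : IsSelfAdjoint S) (hR : IsSelfAdjoint R) {δ : ℝ} (hδ0 : 0 ≤ δ)
  (hδ1 : δ < 1) (h : ‖exp S * exp (R + R) * exp S - 1‖ ≤ δ)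

include hS hR h in
-- Conjugation by the self-adjoint `exp (-S)` preserves the order, so the norm bound, read as a
-- two-sided order bound, isolates `exp (2R)` between multiples of `exp (-2S)`. Operator monotone
-- functions can then be applied.
theorem exp_bounds_of_norm_le :
    (1 - δ) • exp (-S + -S) ≤ exp (R + R) ∧ exp (R + R) ≤ (1 + δ) • exp (-S + -S) := by
  have hsa : IsSelfAdjoint (exp S * exp (R + R) * exp S - 1) := by
    have h1 : IsSelfAdjoint (exp S * exp (R + R) * exp S) := by
      have := (hR.add hR).exp.conjugate (exp S)
      rwa [hS.exp.star_eq] at this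
    exact h1.sub (IsSelfAdjoint.one A)
  have hle : exp S * exp (R + R) * exp S - 1 ≤ algebraMap ℝ A δ :=
    hsa.le_algebraMap_norm_self.trans (algebraMap_mono A h)
  have hge : -algebraMap ℝ A δ ≤ exp S * exp (R + R) * exp S - 1 :=
    (neg_le_neg (algebraMap_mono A h)).trans hsa.neg_algebraMap_norm_le_self
  have hnS : IsSelfAdjoint (exp (-S)) := hS.neg.exp
  have hc : exp (-S) * (exp S * exp (R + R) * exp S) * exp (-S) = exp (R + R) := by
    calc _ = (exp (-S) * exp S) * exp (R + R) * (exp S * exp (-S)) := by noncomm_ring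
      _ = _ := by rw [exp_neg_mul_exp, exp_mul_exp_neg, one_mul, mul_one]
  constructor
  · have := hnS.conjugate_le_conjugate (a := (1 - δ) • (1 : A))
      (b := exp S * exp (R + R) * exp S) (by
        rw [sub_smul, one_smul, ← Algebra.algebraMap_eq_smul_one]
        have := add_le_add_left hge 1
        simpa [sub_eq_neg_add, add_comm] using this)
    rwa [hc, mul_smul_comm, mul_one, smul_mul_assoc, exp_mul_self] at this
  · have := hnS.conjugate_le_conjugate (b := (1 + δ) • (1 : A))
      (a := exp S * exp (R + R) * exp S) (by
        rw [add_smul, one_smul, ← Algebra.algebraMap_eq_smul_one]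
        have := add_le_add_left hle 1
        simpa [add_comm] using this)
    rwa [hc, mul_smul_comm, mul_one, smul_mul_assoc, exp_mul_self] at this

include hS hR hδ0 hδ1 h in
/-- Operator monotonicity of the logarithm: if `exp S * exp R ^ 2 * exp S` is close to `1`, then
`R` is close to `-S`. -/
theorem norm_add_le_of_norm_exp_le : ‖R + S‖ ≤ -Real.log (1 - δ) / 2 := by
  obtain ⟨h1, h2⟩ := exp_bounds_of_norm_le hS hR h
  have hp : IsStrictlyPositive (exp (-S + -S)) := isStrictlyPositive_exp (hS.neg.add hS.neg)
  have hd1 : 0 < 1 - δ := by linarith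
  have hd2 : 0 < 1 + δ := by linarith
  -- Since `(1 + δ)(1 - δ) ≤ 1`, the lower bound's constant also controls the upper one.
  have hlog : Real.log (1 + δ) ≤ -Real.log (1 - δ) := by
    rw [← Real.log_inv]
    apply Real.log_le_log hd2
    rw [le_inv_comm₀ hd2 hd1, ← one_div, le_div_iff₀ hd2]
    nlinarith
  have hlogn : 0 ≤ -Real.log (1 - δ) := (Real.log_nonneg (by linarith)).trans hlog
  have k1 := CFC.log_le_log h1 (IsStrictlyPositive.smul hd1 hp)
  have k2 := CFC.log_le_log h2 (isStrictlyPositive_exp (hR.add hR))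
  rw [CFC.log_smul' _ hd1 hp, CFC.log_exp _ (hS.neg.add hS.neg), CFC.log_exp _ (hR.add hR)] at k1
  rw [CFC.log_smul' _ hd2 hp, CFC.log_exp _ (hS.neg.add hS.neg), CFC.log_exp _ (hR.add hR)] at k2
  have hsa : IsSelfAdjoint ((2 : ℝ) • (R + S)) := isSelfAdjoint_real_smul (hR.add hS) 2
  have key : ‖(2 : ℝ) • (R + S)‖ ≤ -Real.log (1 - δ) := by
    refine norm_le_of_mem_Icc_algebraMap hsa hlogn ?_ ?_
    · rw [map_neg, neg_neg, two_smul]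
      calc _ = algebraMap ℝ A (Real.log (1 - δ)) + (-S + -S) + (S + S) := by abel
        _ ≤ R + R + (S + S) := by gcongr
        _ = _ := by abel
    · rw [two_smul]
      calc R + S + (R + S) = R + R + (S + S) := by abel
        _ ≤ algebraMap ℝ A (Real.log (1 + δ)) + (-S + -S) + (S + S) := by gcongr
        _ = algebraMap ℝ A (Real.log (1 + δ)) := by abel
        _ ≤ _ := algebraMap_mono A hlog
  rw [norm_smul] at key
  norm_num at key
  linarith

theorem sqrt_smul_exp {T : A} (hT : IsSelfAdjoint T) {c : ℝ} (hc : 0 ≤ c) :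
    CFC.sqrt (c • exp (T + T)) = Real.sqrt c • exp T := by
  refine CFC.sqrt_unique ?_ (smul_nonneg (Real.sqrt_nonneg c) hT.exp_nonneg)
  rw [smul_mul_smul_comm, Real.mul_self_sqrt hc, exp_mul_self]

include hS hR hδ0 hδ1 h in
/-- Operator monotonicity of the square root: if `exp S * exp R ^ 2 * exp S` is close to `1`, then
so is `exp (S / 2) * exp R * exp (S / 2)`. -/
theorem norm_half_conj_sub_one_le {T : A} (hT : IsSelfAdjoint T) (hTS : T + T = S) :
    ‖exp T * exp R * exp T - 1‖ ≤ δ := by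
  obtain ⟨h1, h2⟩ := exp_bounds_of_norm_le hS hR h
  have k1 := CFC.sqrt_le_sqrt _ _ h1
  have k2 := CFC.sqrt_le_sqrt _ _ h2
  have e1 : CFC.sqrt (exp (R + R)) = exp R := by simpa using sqrt_smul_exp hR zero_le_one
  rw [sqrt_smul_exp hS.neg (by linarith), e1] at k1
  rw [sqrt_smul_exp hS.neg (by linarith), e1] at k2
  -- After the square root the comparison is with `exp (-S)`, which conjugation by `exp T`, `T = S /
  -- 2`, turns into `1`.
  have hc : exp T * exp (-S) * exp T = 1 := by
    have : exp (-S) = exp (-T) * exp (-T) := by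
      rw [exp_mul_self, ← hTS, neg_add]
    rw [this]
    calc _ = (exp T * exp (-T)) * (exp (-T) * exp T) := by noncomm_ring
      _ = _ := by rw [exp_mul_exp_neg, exp_neg_mul_exp, one_mul]
  have l1 := hT.exp.conjugate_le_conjugate k1
  have l2 := hT.exp.conjugate_le_conjugate k2
  rw [mul_smul_comm, smul_mul_assoc, hc] at l1 l2
  have s1 : 1 - δ ≤ Real.sqrt (1 - δ) := by
    apply Real.le_sqrt_of_sq_le
    nlinarith
  have s2 : Real.sqrt (1 + δ) ≤ 1 + δ := by
    rw [Real.sqrt_le_left (by linarith)]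
    nlinarith
  have hsa : IsSelfAdjoint (exp T * exp R * exp T - 1) := by
    have h1 : IsSelfAdjoint (exp T * exp R * exp T) := by
      have := hR.exp.conjugate (exp T)
      rwa [hT.exp.star_eq] at this
    exact h1.sub (IsSelfAdjoint.one A)
  rw [← Algebra.algebraMap_eq_smul_one] at l1 l2
  refine norm_le_of_mem_Icc_algebraMap hsa hδ0 ?_ ?_
  · rw [le_sub_iff_add_le]
    refine le_trans ?_ l1
    have := algebraMap_mono A s1
    rwa [map_sub, map_one, sub_eq_neg_add] at this
  · rw [sub_le_iff_le_add]
    refine le_trans l2 ?_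
    have := algebraMap_mono A s2
    rwa [map_add, map_one, add_comm (1 : A)] at this

end TwoPositives

end CStar

/-! ### Asymptotically unitary products of positive and unitary operators. -/

section Hilbert

variable {H : Type*} [NormedAddCommGroup H] [InnerProductSpace ℂ H] [FiniteDimensional ℂ H]

/-- The operator norm is controlled by the Hilbert-Schmidt norm. -/
theorem norm_le_sqrt_trace (X : H →L[ℂ] H) :
    ‖X‖ ≤ Module.finrank ℂ H *
      Real.sqrt (LinearMap.trace ℂ H ((X * star X : H →L[ℂ] H) : H →ₗ[ℂ] H)).re := by
  set b := stdOrthonormalBasis ℂ H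
  set t := (LinearMap.trace ℂ H ((X * star X : H →L[ℂ] H) : H →ₗ[ℂ] H)).re with ht
  have htr : t = ∑ i, ‖star X (b i)‖ ^ 2 := by
    rw [ht, LinearMap.trace_eq_sum_inner _ b, Complex.re_sum]
    refine Finset.sum_congr rfl fun i _ => ?_
    have : inner ℂ (b i) ((X * star X) (b i)) = inner ℂ (star X (b i)) (star X (b i)) := by
      rw [ContinuousLinearMap.star_eq_adjoint, ContinuousLinearMap.adjoint_inner_left]
      rfl
    rw [ContinuousLinearMap.coe_coe, this, inner_self_eq_norm_sq_to_K]
    norm_cast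
  have hb : ∀ i, ‖star X (b i)‖ ≤ Real.sqrt t := by
    intro i
    apply Real.le_sqrt_of_sq_le
    rw [htr]
    exact Finset.single_le_sum (f := fun i => ‖star X (b i)‖ ^ 2)
      (fun i _ => by positivity) (Finset.mem_univ i)
  rw [← norm_star]
  refine ContinuousLinearMap.opNorm_le_bound _ (by positivity) fun x => ?_
  calc ‖star X x‖ = ‖∑ i, inner ℂ (b i) x • star X (b i)‖ := by
        conv_lhs => rw [← b.sum_repr' x]
        rw [map_sum]
        simp only [map_smul]
    _ ≤ ∑ i, ‖inner ℂ (b i) x • star X (b i)‖ := norm_sum_le _ _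
    _ ≤ ∑ _i : Fin (Module.finrank ℂ H), ‖x‖ * Real.sqrt t := by
        refine Finset.sum_le_sum fun i _ => ?_
        rw [norm_smul]
        have := norm_inner_le_norm (𝕜 := ℂ) (b i) x
        rw [b.orthonormal.norm_eq_one, one_mul] at this
        gcongr
        exact hb i
    _ = _ := by
        rw [Finset.sum_const, Finset.card_univ, Fintype.card_fin, nsmul_eq_mul]
        ring

/-- The trace as a continuous functional on operators. -/
noncomputable def traceL : (H →L[ℂ] H) →L[ℂ] ℂ :=
  LinearMap.toContinuousLinearMap
    (LinearMap.trace ℂ H ∘ₗ (ContinuousLinearMap.coeLM ℂ : (H →L[ℂ] H) →ₗ[ℂ] (H →ₗ[ℂ] H)))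

theorem traceL_apply (X : H →L[ℂ] H) : traceL X = LinearMap.trace ℂ H (X : H →ₗ[ℂ] H) := rfl

theorem traceL_mul_comm (X Y : H →L[ℂ] H) : traceL (X * Y) = traceL (Y * X) :=
  LinearMap.trace_mul_comm ℂ (X : H →ₗ[ℂ] H) (Y : H →ₗ[ℂ] H)

theorem traceL_star (X : H →L[ℂ] H) : traceL (star X) = (starRingEnd ℂ) (traceL X) := by
  rw [traceL_apply, traceL_apply, LinearMap.trace_eq_sum_inner _ (stdOrthonormalBasis ℂ H),
    LinearMap.trace_eq_sum_inner _ (stdOrthonormalBasis ℂ H), map_sum]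
  refine Finset.sum_congr rfl fun i _ => ?_
  rw [inner_conj_symm, ContinuousLinearMap.coe_coe, ContinuousLinearMap.coe_coe,
    ContinuousLinearMap.star_eq_adjoint, ContinuousLinearMap.adjoint_inner_right]

section Limits

variable {ι : Type*} {l : Filter ι} {S u : ι → H →L[ℂ] H} {u₀ : H →L[ℂ] H}

/-- A product of two positive operators that is asymptotically unitary tends to `1`. -/
theorem tendsto_exp_mul_exp {R : ι → H →L[ℂ] H} (hS : ∀ i, IsSelfAdjoint (S i))
    (hR : ∀ i, IsSelfAdjoint (R i))
    (h : Tendsto (fun i => exp (S i) * exp (R i + R i) * exp (S i)) l (𝓝 1)) :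
    Tendsto (fun i => exp (S i) * exp (R i)) l (𝓝 1) ∧ Tendsto (fun i => R i + S i) l (𝓝 0) := by
  have hδ : Tendsto (fun i => ‖exp (S i) * exp (R i + R i) * exp (S i) - 1‖) l (𝓝 0) := by
    simpa using (h.sub_const 1).norm
  have hlt : ∀ᶠ i in l, ‖exp (S i) * exp (R i + R i) * exp (S i) - 1‖ < 1 :=
    hδ.eventually (gt_mem_nhds zero_lt_one)
  constructor
  · set T : ι → H →L[ℂ] H := fun i => (1 / 2 : ℝ) • S i with hT
    have hTS : ∀ i, T i + T i = S i := fun i => by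
      simp only [hT]
      rw [← add_smul]
      norm_num
    have hTsa : ∀ i, IsSelfAdjoint (T i) := fun i => isSelfAdjoint_real_smul (hS i) _
    have hv : Tendsto (fun i => exp (T i) * exp (R i) * exp (T i)) l (𝓝 1) := by
      rw [tendsto_iff_norm_sub_tendsto_zero]
      refine squeeze_zero' (Eventually.of_forall fun i => norm_nonneg _) ?_ hδ
      filter_upwards [hlt] with i hi
      exact norm_half_conj_sub_one_le (hS i) (hR i) (norm_nonneg _) hi le_rfl (hTsa i) (hTS i)
    -- The product `exp S * exp R` need not be self-adjoint, but by cyclicity it has the trace of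
    -- `exp T * exp R * exp T`, `T = S / 2`, which tends to `1`.
    have htr : Tendsto (fun i => traceL (exp (S i) * exp (R i))) l (𝓝 (traceL (1 : H →L[ℂ] H))) := by
      have := (traceL.continuous.tendsto (1 : H →L[ℂ] H)).comp hv
      refine this.congr fun i => ?_
      simp only [Function.comp]
      rw [traceL_mul_comm, ← mul_assoc, exp_mul_self, hTS]
    set w := fun i => exp (S i) * exp (R i) with hw
    have hww : ∀ i, w i * star (w i) = exp (S i) * exp (R i + R i) * exp (S i) := fun i => by
      simp only [hw, star_mul, (hS i).exp.star_eq, (hR i).exp.star_eq]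
      rw [← exp_mul_self]
      noncomm_ring
    -- The squared Hilbert-Schmidt norm of `w - 1` expands as `tr (w w*) - tr w - conj (tr w) + tr
    -- 1`, and each of the four traces tends to the dimension.
    have hlim : Tendsto (fun i => traceL ((w i - 1) * star (w i - 1))) l (𝓝 0) := by
      have e1 : ∀ i, traceL ((w i - 1) * star (w i - 1)) =
          traceL (exp (S i) * exp (R i + R i) * exp (S i)) - traceL (w i) -
            (starRingEnd ℂ) (traceL (w i)) + traceL (1 : H →L[ℂ] H) := fun i => by
        rw [← hww, ← traceL_star, ← map_sub, ← map_sub, ← map_add]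
        congr 1
        rw [star_sub, star_one]
        noncomm_ring
      simp only [e1]
      have h1 := (traceL.continuous.tendsto (1 : H →L[ℂ] H)).comp h
      have h2 := (Complex.continuous_conj.tendsto _).comp htr
      have h3 := ((h1.sub htr).sub h2).add_const (traceL (1 : H →L[ℂ] H))
      convert! h3 using 2
      rw [← traceL_star, star_one]
      ring
    rw [tendsto_iff_norm_sub_tendsto_zero]
    refine squeeze_zero (fun i => norm_nonneg _) (fun i => norm_le_sqrt_trace _) ?_
    have h4 := (Real.continuous_sqrt.tendsto _).comp ((Complex.continuous_re.tendsto _).comp hlim)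
    have h5 := h4.const_mul (Module.finrank ℂ H : ℝ)
    simp only [Function.comp_def, Complex.zero_re, Real.sqrt_zero, mul_zero] at h5
    exact h5
  · rw [tendsto_zero_iff_norm_tendsto_zero]
    have h1 : Tendsto (fun i => -Real.log (1 -
        ‖exp (S i) * exp (R i + R i) * exp (S i) - 1‖) / 2) l (𝓝 0) := by
      have h2 : ContinuousAt (fun x : ℝ => -Real.log (1 - x) / 2) 0 := by
        have : (1 : ℝ) - 0 ≠ 0 := by norm_num
        fun_prop (disch := assumption)
      have h3 := h2.tendsto.comp hδ
      simpa [Function.comp_def] using h3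
    refine squeeze_zero' (Eventually.of_forall fun i => norm_nonneg _) ?_ h1
    filter_upwards [hlt] with i hi
    exact norm_add_le_of_norm_exp_le (hS i) (hR i) (norm_nonneg _) hi le_rfl

theorem exp_unitary_conj {v : H →L[ℂ] H} (hv : v ∈ unitary (H →L[ℂ] H)) (X : H →L[ℂ] H) :
    exp (v * X * star v) = v * exp X * star v :=
  exp_conj_of_inverse (Unitary.mul_star_self_of_mem hv) (Unitary.star_mul_self_of_mem hv) X

/-- If `p u p`, with `p` positive and `u` unitary, tends to a unitary operator `u₀`, then `u` tends
to `u₀`, and the logarithm of `p` is asymptotically anti-invariant under `u`. -/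
theorem tendsto_of_tendsto_exp_unitary_exp (hS : ∀ i, IsSelfAdjoint (S i))
    (hu : ∀ i, u i ∈ unitary (H →L[ℂ] H)) (hu₀ : u₀ ∈ unitary (H →L[ℂ] H))
    (h : Tendsto (fun i => exp (S i) * u i * exp (S i)) l (𝓝 u₀)) :
    Tendsto u l (𝓝 u₀) ∧ Tendsto (fun i => u i * S i * star (u i) + S i) l (𝓝 0) := by
  have hR : ∀ i, IsSelfAdjoint (u i * S i * star (u i)) := fun i => (hS i).conjugate _
  have hstar : Tendsto (fun i => star (exp (S i) * u i * exp (S i))) l (𝓝 (star u₀)) :=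
    (continuous_star.tendsto _).comp h
  -- With `p = exp S` and `R = u S u*`, this is `(p u p)(p u p)* = p (u p² u*) p`, whose limit is
  -- `u₀ u₀* = 1`.
  have h1 : Tendsto (fun i => exp (S i) * exp (u i * S i * star (u i) + u i * S i * star (u i)) *
      exp (S i)) l (𝓝 1) := by
    have h2 := h.mul hstar
    rw [Unitary.mul_star_self_of_mem hu₀] at h2
    refine h2.congr fun i => ?_
    rw [← add_mul, ← mul_add, exp_unitary_conj (hu i), ← exp_mul_self]
    simp only [star_mul, (hS i).exp.star_eq]
    noncomm_ring
  obtain ⟨h2, h3⟩ := tendsto_exp_mul_exp hS hR h1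
  refine ⟨?_, h3⟩
  -- Moving `u` to the right turns the last `exp S` into `exp R`, so `p u p` differs from `u` by a
  -- factor already known to tend to `1`.
  have h4 : ∀ i, exp (S i) * u i * exp (S i) - u i =
      (exp (S i) * exp (u i * S i * star (u i)) - 1) * u i := fun i => by
    rw [exp_unitary_conj (hu i), sub_mul, one_mul]
    congr 1
    have := Unitary.star_mul_self_of_mem (hu i)
    calc _ = exp (S i) * (u i * exp (S i) * (star (u i) * u i)) := by
          rw [this, mul_one, mul_assoc]
      _ = _ := by noncomm_ring
  have h5 : Tendsto (fun i => exp (S i) * u i * exp (S i) - u i) l (𝓝 0) := by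
    simp only [h4]
    rw [tendsto_zero_iff_norm_tendsto_zero]
    have h6 : Tendsto (fun i => ‖exp (S i) * exp (u i * S i * star (u i)) - 1‖) l (𝓝 0) := by
      simpa using (h2.sub_const 1).norm
    refine squeeze_zero (fun i => norm_nonneg _) (fun i => ?_) h6
    rw [CStarRing.norm_mul_mem_unitary _ (hu i)]
  have h7 := h.sub h5
  simpa using h7

end Limits

end Hilbert

/-! ### Passing identities through exponentials: conjugations and eigenvectors. -/

section Antilinear

variable {H : Type*} [NormedAddCommGroup H] [InnerProductSpace ℂ H] [FiniteDimensional ℂ H]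

theorem continuous_antilinear (τ : H →ₛₗ[starRingEnd ℂ] H) : Continuous τ := by
  let τ' : H →ₗ[ℝ] H :=
    { toFun := τ
      map_add' := map_add τ
      map_smul' := fun r x => by
        rw [← Complex.coe_smul, map_smulₛₗ, Complex.conj_ofReal, Complex.coe_smul]
        rfl }
  exact τ'.continuous_of_finiteDimensional

/-- The coefficients `1 / n!` of the exponential series are real, so conjugate-linearity of `τ` does
no harm termwise. -/
theorem antilinear_exp (τ : H →ₛₗ[starRingEnd ℂ] H) {a a' : H →L[ℂ] H}
    (h : ∀ X, τ (a X) = a' (τ X)) (X : H) : τ (exp a X) = exp a' (τ X) := by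
  have hpow : ∀ n : ℕ, ∀ X, τ ((a ^ n) X) = (a' ^ n) (τ X) := by
    intro n
    induction n with
    | zero => intro X; simp
    | succ n ih =>
      intro X
      rw [pow_succ, pow_succ, mul_apply_eq_comp, mul_apply_eq_comp, ih, h]
  have h1 : ∀ (b : H →L[ℂ] H) (Y : H),
      HasSum (fun n : ℕ => ((n.factorial : ℂ)⁻¹) • (b ^ n) Y) (exp b Y) := fun b Y =>
    (exp_series_hasSum_exp' (𝕂 := ℂ) b).mapL (ContinuousLinearMap.apply ℂ H Y)
  have h2 := (h1 a X).map τ.toAddMonoidHom (continuous_antilinear τ)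
  have h3 := h1 a' (τ X)
  refine HasSum.unique (f := fun n : ℕ => ((n.factorial : ℂ)⁻¹) • (a' ^ n) (τ X)) ?_ h3
  convert! h2 using 2 with n
  simp only [Function.comp]
  change _ = τ _
  rw [map_smulₛₗ, hpow]
  simp

end Antilinear

section Eigen

variable {H : Type*} [NormedAddCommGroup H] [InnerProductSpace ℂ H] [FiniteDimensional ℂ H]

theorem exp_apply_of_apply_eq_smul {a : H →L[ℂ] H} {x : H} {μ : ℂ} (h : a x = μ • x) :
    exp a x = Complex.exp μ • x := by
  have hpow : ∀ n : ℕ, (a ^ n) x = μ ^ n • x := by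
    intro n
    induction n with
    | zero => simp
    | succ n ih =>
      rw [pow_succ, mul_apply_eq_comp, h, map_smul, ih, smul_smul, pow_succ, mul_comm]
  have h1 : HasSum (fun n : ℕ => ((n.factorial : ℂ)⁻¹) • (a ^ n) x) (exp a x) :=
    (exp_series_hasSum_exp' (𝕂 := ℂ) a).mapL (ContinuousLinearMap.apply ℂ H x)
  have h2 : HasSum (fun n : ℕ => ((n.factorial : ℂ)⁻¹ • μ ^ n) • x) (Complex.exp μ • x) := by
    rw [Complex.exp_eq_exp_ℂ]
    exact (exp_series_hasSum_exp' (𝕂 := ℂ) μ).smul_const x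
  refine HasSum.unique h1 (h2.congr_fun ?_)
  intro n
  rw [hpow, smul_smul, smul_eq_mul]

/-- An orthonormal basis of eigenvectors of a self-adjoint operator. -/
theorem exists_eigenbasis {S : H →L[ℂ] H} (hS : IsSelfAdjoint S) :
    ∃ (b : OrthonormalBasis (Fin (Module.finrank ℂ H)) ℂ H)
      (μ : Fin (Module.finrank ℂ H) → ℝ), ∀ i, S (b i) = (μ i : ℂ) • b i := by
  have hsym : (S : H →ₗ[ℂ] H).IsSymmetric :=
    (ContinuousLinearMap.isSelfAdjoint_iff_isSymmetric).mp hS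
  exact ⟨hsym.eigenvectorBasis rfl, hsym.eigenvalues rfl,
    fun i => hsym.apply_eigenvectorBasis rfl i⟩

/-- The eigenvalues of `S` are real and the real exponential is injective, so `exp S` and `S` have
the same eigenspaces. This is how algebraic identities for `exp S` descend to `S`. -/
theorem apply_eq_smul_of_exp_apply {S : H →L[ℂ] H} (hS : IsSelfAdjoint S) {x : H} {r : ℝ}
    (h : exp S x = (Real.exp r : ℂ) • x) : S x = (r : ℂ) • x := by
  obtain ⟨b, μ, hb⟩ := exists_eigenbasis hS
  have e1 : ∀ i, exp S (b i) = (Real.exp (μ i) : ℂ) • b i := fun i => by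
    rw [exp_apply_of_apply_eq_smul (hb i), Complex.ofReal_exp]
  have coord : ∀ (T : H →L[ℂ] H) (ν : Fin (Module.finrank ℂ H) → ℝ),
      (∀ i, T (b i) = (ν i : ℂ) • b i) → ∀ y i, b.repr (T y) i = (ν i : ℂ) * b.repr y i := by
    intro T ν hT y i
    conv_lhs => rw [← b.sum_repr y]
    simp [hT, -Complex.coe_smul, Pi.single_apply, mul_comm]
  apply b.repr.injective
  ext i
  have h2 := congrArg (fun z => b.repr z i) h
  simp only [coord _ _ e1, map_smul, PiLp.smul_apply, smul_eq_mul] at h2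
  rw [coord _ _ hb, map_smul, PiLp.smul_apply, smul_eq_mul]
  by_cases hx : b.repr x i = 0
  · rw [hx, mul_zero, mul_zero]
  · have h3 := mul_right_cancel₀ hx h2
    rw [Complex.ofReal_inj, Real.exp_eq_exp] at h3
    rw [h3]

/-- If `S b = μ b` then `exp S` scales `τ b` by `e^μ`, `μ` being real; hence `S` scales `τ b` by
`μ`. Eigenvectors of `S` form a basis. -/
theorem antilinear_comm_of_exp {S : H →L[ℂ] H} (hS : IsSelfAdjoint S)
    (τ : H →ₛₗ[starRingEnd ℂ] H) (h : ∀ X, exp S (τ X) = τ (exp S X)) (X : H) :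
    S (τ X) = τ (S X) := by
  obtain ⟨b, μ, hb⟩ := exists_eigenbasis hS
  have h1 : (S : H →ₗ[ℂ] H).comp τ = τ.comp (S : H →ₗ[ℂ] H) := by
    refine b.toBasis.ext fun i => ?_
    simp only [OrthonormalBasis.coe_toBasis, LinearMap.comp_apply, ContinuousLinearMap.coe_coe]
    rw [hb, map_smulₛₗ, Complex.conj_ofReal]
    apply apply_eq_smul_of_exp_apply hS
    rw [h, exp_apply_of_apply_eq_smul (hb i), map_smulₛₗ, ← Complex.ofReal_exp,
      Complex.conj_ofReal]
  exact LinearMap.congr_fun h1 X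

end Eigen

/-! ### The Lie algebra as a Hilbert space; automorphisms and their logarithms. -/

section Cartan

variable {H : Type*} [NormedAddCommGroup H] [InnerProductSpace ℂ H] [FiniteDimensional ℂ H]

/-- `a` is an endomorphism of the bracket `(X, Y) ↦ L X Y`. -/
def IsBracketHom (L : H →ₗ[ℂ] (H →L[ℂ] H)) (a : H →L[ℂ] H) : Prop :=
  ∀ X Y, a (L X Y) = L (a X) (a Y)

/-- A semisimple complex Lie algebra on a Hilbert space `H`, given by its adjoint representation
`L`, with a real form (conjugation `σ`) and a compatible Cartan involution `θ`; the inner product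
is the one induced by the Killing form and `θ`. -/
structure CartanData (L : H →ₗ[ℂ] (H →L[ℂ] H)) (σ θ : H →ₛₗ[starRingEnd ℂ] H) : Prop where
  skew : ∀ X Y, L X Y = -L Y X
  lie : ∀ X Y, L (L X Y) = L X * L Y - L Y * L X
  injective : Function.Injective L
  inner_derivation : ∀ D : H →L[ℂ] H, (∀ X Y, D (L X Y) = L (D X) Y + L X (D Y)) → ∃ X, L X = D
  σ_invol : ∀ X, σ (σ X) = X
  θ_invol : ∀ X, θ (θ X) = X
  σ_θ : ∀ X, σ (θ X) = θ (σ X)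
  σ_lie : ∀ X Y, σ (L X Y) = L (σ X) (σ Y)
  θ_lie : ∀ X Y, θ (L X Y) = L (θ X) (θ Y)
  star_L : ∀ X, star (L X) = -L (θ X)
  star_aut : ∀ a b, a * b = 1 → b * a = 1 → IsBracketHom L a → ∀ X, star a X = θ (b (θ X))

/-- A continuous linear left inverse of an injective linear map. -/
theorem exists_continuous_leftInverse {L : H →ₗ[ℂ] (H →L[ℂ] H)} (hL : Function.Injective L) :
    ∃ Λ : (H →L[ℂ] H) →L[ℂ] H, ∀ X, Λ (L X) = X := by
  obtain ⟨Λ, hΛ⟩ := L.exists_leftInverse_of_injective (LinearMap.ker_eq_bot.mpr hL)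
  exact ⟨LinearMap.toContinuousLinearMap Λ, fun X => LinearMap.congr_fun hΛ X⟩

section BracketHom

variable {L : H →ₗ[ℂ] (H →L[ℂ] H)} {a b : H →L[ℂ] H}

theorem IsBracketHom.mul (ha : IsBracketHom L a) (hb : IsBracketHom L b) :
    IsBracketHom L (a * b) := fun X Y => by
  simp only [mul_apply_eq_comp]
  rw [hb, ha]

theorem IsBracketHom.inv (ha : IsBracketHom L a) (hab : a * b = 1) (hba : b * a = 1) :
    IsBracketHom L b := fun X Y => by
  have h1 : ∀ Z, a (b Z) = Z := fun Z => by
    rw [← mul_apply_eq_comp, hab, one_apply_eq_self]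
  have h2 : ∀ Z, b (a Z) = Z := fun Z => by
    rw [← mul_apply_eq_comp, hba, one_apply_eq_self]
  rw [← h2 (L (b X) (b Y)), ha, h1, h1]

theorem IsBracketHom.mul_L (ha : IsBracketHom L a) (X : H) : a * L X = L (a X) * a := by
  ext Y
  simp only [mul_apply_eq_comp]
  exact ha X Y

theorem IsBracketHom.conj_L (ha : IsBracketHom L a) (hab : a * b = 1) (X : H) :
    a * L X * b = L (a X) := by
  rw [ha.mul_L, mul_assoc, hab, mul_one]

end BracketHom

variable {L : H →ₗ[ℂ] (H →L[ℂ] H)} {σ θ : H →ₛₗ[starRingEnd ℂ] H}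

/-- With `D = L X`, the function `t ↦ exp (-tD) * L (exp (tD) Y) * exp (tD)` has zero derivative
because `L` respects brackets; its values at `1` and `0` are compared. -/
theorem CartanData.exp_isBracketHom (C : CartanData L σ θ) (X : H) :
    IsBracketHom L (exp (L X)) := by
  set D := L X with hD
  intro Y Z
  let φ : (H →L[ℂ] H) →L[ℂ] (H →L[ℂ] H) :=
    (LinearMap.toContinuousLinearMap L).comp (ContinuousLinearMap.apply ℂ H Y)
  have hφ : ∀ a, φ a = L (a Y) := fun a => rfl
  have hφD : ∀ a, φ (D * a) = D * φ a - φ a * D := fun a => by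
    rw [hφ, hφ, mul_apply_eq_comp, hD, C.lie]
  have h1 : ∀ t : ℂ, HasDerivAt (fun t : ℂ => exp (t • D)) (D * exp (t • D)) t :=
    fun t => hasDerivAt_exp_smul_const' D t
  have h2 : ∀ t : ℂ, HasDerivAt (fun t : ℂ => exp (t • (-D))) (exp (t • (-D)) * (-D)) t :=
    fun t => hasDerivAt_exp_smul_const (-D) t
  have h3 : ∀ t : ℂ, HasDerivAt
      (fun t : ℂ => exp (t • (-D)) * φ (exp (t • D)) * exp (t • D)) 0 t := by
    intro t
    have h4 : HasDerivAt (fun t : ℂ => φ (exp (t • D))) (φ (D * exp (t • D))) t :=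
      φ.hasFDerivAt.comp_hasDerivAt t (h1 t)
    refine (((h2 t).mul h4).mul (h1 t)).congr_deriv ?_
    rw [hφD]
    simp only [Pi.mul_apply]
    noncomm_ring
  have h5 := is_const_of_deriv_eq_zero (fun t => (h3 t).differentiableAt)
    (fun t => (h3 t).deriv) 1 0
  simp only [one_smul, zero_smul, exp_zero, one_mul, mul_one] at h5
  have h6 : exp D * L Y = L (exp D Y) * exp D := by
    have h7 : φ 1 = L Y := rfl
    rw [← h7, ← h5]
    calc _ = (exp D * exp (-D)) * φ (exp D) * exp D := by noncomm_ring
      _ = _ := by rw [exp_mul_exp_neg, one_mul, hφ]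
  exact congrArg (fun T : H →L[ℂ] H => T Z) h6

theorem CartanData.σ_exp (C : CartanData L σ θ) {X : H} (hX : σ X = X) (Y : H) :
    exp (L X) (σ Y) = σ (exp (L X) Y) :=
  (antilinear_exp σ (fun Z => by rw [C.σ_lie, hX]) Y).symm

theorem CartanData.θ_exp (C : CartanData L σ θ) {X : H} (hX : θ X = X) (Y : H) :
    exp (L X) (θ Y) = θ (exp (L X) Y) :=
  (antilinear_exp θ (fun Z => by rw [C.θ_lie, hX]) Y).symm

theorem CartanData.isSelfAdjoint (C : CartanData L σ θ) {X : H} (hX : θ X = -X) :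
    IsSelfAdjoint (L X) := by
  rw [isSelfAdjoint_iff, C.star_L, hX, map_neg, neg_neg]

/-- For eigenvectors of `S` with eigenvalues `μ i` and `μ j`, the automorphism `exp S` scales their
bracket by `e^(μ i + μ j)`, so `S` scales it by `μ i + μ j`. This is the Leibniz rule on an
eigenbasis, and bilinearity extends it. -/
theorem CartanData.derivation_of_exp (C : CartanData L σ θ) {S : H →L[ℂ] H}
    (hS : IsSelfAdjoint S) (h : IsBracketHom L (exp S)) (X Y : H) :
    S (L X Y) = L (S X) Y + L X (S Y) := by
  obtain ⟨b, μ, hb⟩ := exists_eigenbasis hS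
  have hbb : ∀ i j, S (L (b i) (b j)) = L (S (b i)) (b j) + L (b i) (S (b j)) := by
    intro i j
    rw [hb, hb, map_smul, map_smul, smul_apply, ← add_smul,
      ← Complex.ofReal_add]
    apply apply_eq_smul_of_exp_apply hS
    rw [h, exp_apply_of_apply_eq_smul (hb i), exp_apply_of_apply_eq_smul (hb j), map_smul,
      map_smul, smul_apply, smul_smul, Complex.ofReal_exp,
      Complex.ofReal_add, add_comm (μ i : ℂ), Complex.exp_add]
  have hb2 : ∀ i Y, S (L (b i) Y) = L (S (b i)) Y + L (b i) (S Y) := by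
    intro i Y
    have : S * L (b i) = L (S (b i)) + L (b i) * S := by
      apply ContinuousLinearMap.coe_injective
      refine b.toBasis.ext fun j => ?_
      simpa using hbb i j
    exact congrArg (fun T : H →L[ℂ] H => T Y) this
  have h3 : (S : H →ₗ[ℂ] H) ∘ₗ ((ContinuousLinearMap.apply ℂ H Y : _ →ₗ[ℂ] H) ∘ₗ L) =
      (ContinuousLinearMap.apply ℂ H Y : _ →ₗ[ℂ] H) ∘ₗ L ∘ₗ (S : H →ₗ[ℂ] H) +
        (ContinuousLinearMap.apply ℂ H (S Y) : _ →ₗ[ℂ] H) ∘ₗ L := by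
    refine b.toBasis.ext fun i => ?_
    simpa using hb2 i Y
  exact LinearMap.congr_fun h3 X

/-- Logarithms of positive automorphisms are inner derivations. -/
theorem CartanData.exists_L_eq (C : CartanData L σ θ) {S : H →L[ℂ] H}
    (hS : IsSelfAdjoint S) (h : IsBracketHom L (exp S)) : ∃ X, L X = S ∧ θ X = -X := by
  obtain ⟨X, hX⟩ := C.inner_derivation S (C.derivation_of_exp hS h)
  refine ⟨X, hX, ?_⟩
  apply C.injective
  rw [map_neg, hX, ← neg_eq_iff_eq_neg, ← C.star_L, hX, hS.star_eq]

/-- The self-adjoint `L X` commutes with `σ` because its exponential does; then `L (σ X) = σ ∘ L X ∘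
σ = L X`. -/
theorem CartanData.σ_eq_of_exp (C : CartanData L σ θ) {X : H} (hX : θ X = -X)
    (h : ∀ Y, exp (L X) (σ Y) = σ (exp (L X) Y)) : σ X = X := by
  have h1 := antilinear_comm_of_exp (C.isSelfAdjoint hX) σ h
  apply C.injective
  ext Y
  have h2 := h1 (σ Y)
  rw [C.σ_lie, C.σ_invol] at h2
  exact h2.symm

end Cartan

/-! ### Polar decomposition of automorphisms. -/

section Polar

variable {H : Type*} [NormedAddCommGroup H] [InnerProductSpace ℂ H] [FiniteDimensional ℂ H]
  {L : H →ₗ[ℂ] (H →L[ℂ] H)} {σ θ : H →ₛₗ[starRingEnd ℂ] H}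

/-- The logarithm of the positive part of an operator, pulled back along a left inverse `Λ` of the
adjoint representation. -/
noncomputable def polarLog (Λ : (H →L[ℂ] H) →L[ℂ] H) (a : H →L[ℂ] H) : H :=
  Λ ((1 / 2 : ℝ) • CFC.log (a * star a))

theorem continuousAt_log_mul_star {a : H →L[ℂ] H} (ha : IsUnit a) {ι : Type*} {l : Filter ι}
    {f : ι → H →L[ℂ] H} (hf : ∀ i, IsUnit (f i)) (h : Tendsto f l (𝓝 a)) :
    Tendsto (fun i => CFC.log (f i * star (f i))) l (𝓝 (CFC.log (a * star a))) := by
  have h1 := CFC.continuousOn_log (A := H →L[ℂ] H) (a * star a)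
    ⟨IsSelfAdjoint.mul_star_self a, ha.mul ha.star⟩
  have h2 : Tendsto (fun i => f i * star (f i)) l (𝓝 (a * star a)) :=
    h.mul ((continuous_star.tendsto a).comp h)
  refine h1.tendsto.comp (tendsto_nhdsWithin_iff.mpr ⟨h2, Eventually.of_forall fun i => ?_⟩)
  exact ⟨IsSelfAdjoint.mul_star_self _, (hf i).mul (hf i).star⟩

theorem tendsto_polarLog (Λ : (H →L[ℂ] H) →L[ℂ] H) {a : H →L[ℂ] H} (ha : IsUnit a) {ι : Type*}
    {l : Filter ι} {f : ι → H →L[ℂ] H} (hf : ∀ i, IsUnit (f i)) (h : Tendsto f l (𝓝 a)) :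
    Tendsto (fun i => polarLog Λ (f i)) l (𝓝 (polarLog Λ a)) :=
  (Λ.continuous.tendsto _).comp ((continuousAt_log_mul_star ha hf h).const_smul (1 / 2 : ℝ))

/-- The factor `k` cancels from `a * star a`, leaving `exp (2 L X)`; the `1 / 2` in `polarLog`
undoes the doubling. -/
theorem polarLog_exp_mul {Λ : (H →L[ℂ] H) →L[ℂ] H} (hΛ : ∀ X, Λ (L X) = X)
    (C : CartanData L σ θ) {X : H} (hX : θ X = -X) {k : H →L[ℂ] H} (hk : k * star k = 1) :
    polarLog Λ (exp (L X) * k) = X := by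
  have hS := C.isSelfAdjoint hX
  have h1 : exp (L X) * k * star (exp (L X) * k) = exp (L X + L X) := by
    rw [star_mul, hS.exp.star_eq, ← exp_mul_self]
    calc _ = exp (L X) * (k * star k) * exp (L X) := by noncomm_ring
      _ = _ := by rw [hk, mul_one]
  rw [polarLog, h1, CFC.log_exp _ (hS.add hS), ← two_smul ℝ, smul_smul]
  norm_num [hΛ]

/-- The Cartan decomposition of the group of automorphisms preserving the real form. -/
theorem CartanData.polar (C : CartanData L σ θ) {Λ : (H →L[ℂ] H) →L[ℂ] H}
    (hΛ : ∀ X, Λ (L X) = X) {a b : H →L[ℂ] H} (hab : a * b = 1) (hba : b * a = 1)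
    (ha : IsBracketHom L a) (haσ : ∀ X, a (σ X) = σ (a X)) :
    σ (polarLog Λ a) = polarLog Λ a ∧ θ (polarLog Λ a) = -polarLog Λ a ∧
      exp (-L (polarLog Λ a)) * a ∈ unitary (H →L[ℂ] H) ∧
      IsBracketHom L (exp (-L (polarLog Λ a)) * a) ∧
      (∀ X, (exp (-L (polarLog Λ a)) * a) (σ X) = σ ((exp (-L (polarLog Λ a)) * a) X)) ∧
      (∀ X, (exp (-L (polarLog Λ a)) * a) (θ X) = θ ((exp (-L (polarLog Λ a)) * a) X)) := by
  have hua : IsUnit a := ⟨⟨a, b, hab, hba⟩, rfl⟩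
  have hab' : ∀ X, a (b X) = X := fun X => by
    rw [← mul_apply_eq_comp, hab, one_apply_eq_self]
  have hba' : ∀ X, b (a X) = X := fun X => by
    rw [← mul_apply_eq_comp, hba, one_apply_eq_self]
  have hb := ha.inv hab hba
  have hbσ : ∀ X, b (σ X) = σ (b X) := fun X => by
    rw [← hba' (σ (b X)), haσ, hab']
  have hsa := C.star_aut a b hab hba ha
  have hsaut : IsBracketHom L (star a) := fun X Y => by
    rw [hsa, hsa, hsa, C.θ_lie, hb, C.θ_lie]
  have hsσ : ∀ X, star a (σ X) = σ (star a X) := fun X => by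
    rw [hsa, hsa, ← C.σ_θ, hbσ, ← C.σ_θ]
  set S2 := CFC.log (a * star a) with hS2
  have hS2sa : IsSelfAdjoint S2 := IsSelfAdjoint.log
  have hpos : IsStrictlyPositive (a * star a) :=
    IsUnit.isStrictlyPositive (hua.mul hua.star) (mul_star_self_nonneg a)
  have hexp : exp S2 = a * star a := CFC.exp_log _ hpos
  -- The positive operator `a a*` is again an automorphism because `a* = θ a⁻¹ θ`. Its logarithm is
  -- therefore inner, given by an element of `𝔰₀`, and half of it is the polar logarithm.
  have haut2 : IsBracketHom L (exp S2) := by rw [hexp]; exact ha.mul hsaut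
  obtain ⟨X2, hX2, hθ2⟩ := C.exists_L_eq hS2sa haut2
  have hσ2 : σ X2 = X2 := by
    refine C.σ_eq_of_exp hθ2 fun Y => ?_
    rw [hX2, hexp, mul_apply_eq_comp, mul_apply_eq_comp, hsσ, haσ]
  have hpl : polarLog Λ a = ((1 / 2 : ℝ) : ℂ) • X2 := by
    rw [polarLog, ← hS2, ← hX2, ← Complex.coe_smul, map_smul, hΛ]
  set η := polarLog Λ a with hη
  have hση : σ η = η := by rw [hpl, map_smulₛₗ, Complex.conj_ofReal, hσ2]
  have hθη : θ η = -η := by rw [hpl, map_smulₛₗ, Complex.conj_ofReal, hθ2, smul_neg]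
  have hLL : L η + L η = S2 := by
    rw [hpl, map_smul, hX2, ← add_smul, ← Complex.ofReal_add]
    norm_num
  have hLsa := C.isSelfAdjoint hθη
  have hnη : L (-η) = -L η := map_neg L η
  have hnaut : IsBracketHom L (exp (-L η)) := by
    rw [← hnη]; exact C.exp_isBracketHom _
  have hnσ : ∀ X, exp (-L η) (σ X) = σ (exp (-L η) X) := by
    rw [← hnη]; exact C.σ_exp (by rw [map_neg, hση])
  set k := exp (-L η) * a with hk
  have hkaut : IsBracketHom L k := hnaut.mul ha
  have hkk : k * star k = 1 := by
    rw [hk, star_mul, (hLsa.neg).exp.star_eq]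
    calc _ = exp (-L η) * (a * star a) * exp (-L η) := by noncomm_ring
      _ = (exp (-L η) * exp (L η)) * (exp (L η) * exp (-L η)) := by
        rw [← hexp, ← hLL, ← exp_mul_self]; noncomm_ring
      _ = 1 := by rw [exp_mul_exp_neg, exp_neg_mul_exp, one_mul]
  have hku : IsUnit k := by
    refine IsUnit.mul ⟨⟨exp (-L η), exp (L η), exp_neg_mul_exp _, exp_mul_exp_neg _⟩, rfl⟩ hua
  have hkk' : star k * k = 1 := by
    obtain ⟨v, hv⟩ := hku
    have : star k = ↑v⁻¹ := by
      rw [← one_mul (star k), ← v.inv_mul, mul_assoc, hv, hkk, mul_one]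
    rw [this, ← hv, v.inv_mul]
  refine ⟨hση, hθη, Unitary.mem_iff.mpr ⟨hkk', hkk⟩, hkaut, fun X => ?_, fun X => ?_⟩
  · rw [hk, mul_apply_eq_comp, mul_apply_eq_comp, haσ, hnσ]
  -- For a unitary automorphism the formula `k* = θ k⁻¹ θ` says that `k⁻¹`, hence `k`, commutes with
  -- `θ`.
  · have h1 := C.star_aut k (star k) hkk hkk' hkaut
    have h2 : ∀ X, star k (k X) = X := fun X => by
      rw [← mul_apply_eq_comp, hkk', one_apply_eq_self]
    have h4 : ∀ X, k (star k X) = X := fun X => by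
      rw [← mul_apply_eq_comp, hkk, one_apply_eq_self]
    have h5 := h1 (k X)
    rw [h2] at h5
    conv_lhs => rw [h5, C.θ_invol, h4]

end Polar

/-! ### Continuity of the inverse of `(η, ξ) ↦ e^η e^{2iξ} e^η`. -/

section Inducing

variable {H : Type*} [NormedAddCommGroup H] [InnerProductSpace ℂ H] [FiniteDimensional ℂ H]
  {L : H →ₗ[ℂ] (H →L[ℂ] H)} {σ θ : H →ₛₗ[starRingEnd ℂ] H}

theorem CartanData.exp_I_mem_unitary (C : CartanData L σ θ) {X : H} (hX : θ X = -X) :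
    exp (L ((2 * Complex.I) • X)) ∈ unitary (H →L[ℂ] H) := by
  have h1 : star (L ((2 * Complex.I) • X)) = -L ((2 * Complex.I) • X) := by
    have h2 : (starRingEnd ℂ) 2 = 2 := Complex.conj_ofNat 2
    rw [C.star_L, map_smulₛₗ, hX]
    simp [h2]
  rw [Unitary.mem_iff, star_exp, h1]
  exact ⟨exp_neg_mul_exp _, exp_mul_exp_neg _⟩

/-- `2 L X` as a self-adjoint element. -/
noncomputable def twiceSelfAdjoint (C : CartanData L σ θ) {X : H} (hX : θ X = -X) :
    selfAdjoint (H →L[ℂ] H) :=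
  ⟨(2 : ℝ) • L X, isSelfAdjoint_real_smul (C.isSelfAdjoint hX) 2⟩

theorem expUnitary_twiceSelfAdjoint (C : CartanData L σ θ) {X : H} (hX : θ X = -X) :
    selfAdjoint.expUnitary (twiceSelfAdjoint C hX) =
      ⟨exp (L ((2 * Complex.I) • X)), C.exp_I_mem_unitary hX⟩ := by
  ext1
  rw [selfAdjoint.expUnitary_coe]
  simp only [twiceSelfAdjoint]
  congr 1
  rw [map_smul, ← Complex.coe_smul, smul_smul, mul_comm]
  norm_num

theorem norm_twiceSelfAdjoint_lt (C : CartanData L σ θ) {X : H} (hX : θ X = -X)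
    (h : ‖L X‖ < Real.pi / 2) : ‖twiceSelfAdjoint C hX‖ < Real.pi := by
  change ‖(2 : ℝ) • L X‖ < Real.pi
  rw [norm_smul]
  norm_num
  linarith

/-- Here the bound `π / 2` enters: the squared norm is `2 (1 - cos ‖2 L X‖)`, which is below `4`
because `‖2 L X‖ < π`. Thus `-1` stays out of the spectrum and the principal argument is available.
-/
theorem norm_exp_I_sub_one_lt (C : CartanData L σ θ) {X : H} (hX : θ X = -X)
    (h : ‖L X‖ < Real.pi / 2) : ‖exp (L ((2 * Complex.I) • X)) - 1‖ < 2 := by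
  have h1 := norm_twiceSelfAdjoint_lt C hX h
  have h2 := selfAdjoint.norm_sq_expUnitary_sub_one h1.le
  rw [expUnitary_twiceSelfAdjoint] at h2
  have h3 : -1 < Real.cos ‖twiceSelfAdjoint C hX‖ := by
    rw [← Real.cos_pi]
    exact Real.cos_lt_cos_of_nonneg_of_le_pi (norm_nonneg _) le_rfl h1
  have h4 : ‖exp (L ((2 * Complex.I) • X)) - 1‖ ^ 2 < 2 ^ 2 := by
    simp only at h2
    rw [h2]
    linarith
  exact lt_of_pow_lt_pow_left₀ 2 (by norm_num) h4

variable {ι : Type*} {l : Filter ι} {η ξ : ι → H} {η₀ ξ₀ : H}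

/-- The principal argument is continuous on unitaries at distance less than `2` from `1`, and there
it recovers `2 L X` from `exp (2i L X)`. -/
theorem tendsto_of_tendsto_exp_I (C : CartanData L σ θ) (hξ : ∀ i, θ (ξ i) = -ξ i)
    (hξn : ∀ i, ‖L (ξ i)‖ < Real.pi / 2) (hξ₀ : θ ξ₀ = -ξ₀) (hξ₀n : ‖L ξ₀‖ < Real.pi / 2)
    (h : Tendsto (fun i => exp (L ((2 * Complex.I) • ξ i))) l
      (𝓝 (exp (L ((2 * Complex.I) • ξ₀))))) : Tendsto ξ l (𝓝 ξ₀) := by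
  obtain ⟨Λ, hΛ⟩ := exists_continuous_leftInverse C.injective
  have h1 : Tendsto (fun i => (⟨exp (L ((2 * Complex.I) • ξ i)), C.exp_I_mem_unitary (hξ i)⟩ :
      unitary (H →L[ℂ] H))) l (𝓝 ⟨_, C.exp_I_mem_unitary hξ₀⟩) :=
    tendsto_subtype_rng.mpr h
  have hmem : (⟨_, C.exp_I_mem_unitary hξ₀⟩ : unitary (H →L[ℂ] H)) ∈ Metric.ball 1 2 := by
    rw [Metric.mem_ball, Subtype.dist_eq, dist_eq_norm]
    exact norm_exp_I_sub_one_lt C hξ₀ hξ₀n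
  have h2 := (Unitary.continuousOn_argSelfAdjoint.continuousAt
    (Metric.isOpen_ball.mem_nhds hmem)).tendsto.comp h1
  have h3 : ∀ {X : H} (hX : θ X = -X) (_ : ‖L X‖ < Real.pi / 2),
      Λ ((1 / 2 : ℝ) • ((Unitary.argSelfAdjoint ⟨_, C.exp_I_mem_unitary hX⟩ :
        selfAdjoint (H →L[ℂ] H)) : H →L[ℂ] H)) = X := by
    intro X hX hn
    rw [← expUnitary_twiceSelfAdjoint C hX, argSelfAdjoint_expUnitary (norm_twiceSelfAdjoint_lt C hX hn)]
    simp only [twiceSelfAdjoint, smul_smul]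
    norm_num [hΛ]
  have h4 := (Λ.continuous.tendsto _).comp
    (((continuous_subtype_val.tendsto _).comp h2).const_smul (1 / 2 : ℝ))
  rw [h3 hξ₀ hξ₀n] at h4
  exact h4.congr fun i => h3 (hξ i) (hξn i)

/-- This is the case `η₀ = 0`. The operator limits give `u → u₀` and `u η + η → 0`, and `u₀ + 1` is
invertible because `-1` is not in the spectrum of `u₀`. -/
theorem tendsto_zero_of_tendsto_polar (C : CartanData L σ θ) (hη : ∀ i, θ (η i) = -η i)
    (hξ : ∀ i, θ (ξ i) = -ξ i) (hξn : ∀ i, ‖L (ξ i)‖ < Real.pi / 2) (hξ₀ : θ ξ₀ = -ξ₀)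
    (hξ₀n : ‖L ξ₀‖ < Real.pi / 2)
    (h : Tendsto (fun i => exp (L (η i)) * exp (L ((2 * Complex.I) • ξ i)) * exp (L (η i))) l
      (𝓝 (exp (L ((2 * Complex.I) • ξ₀))))) : Tendsto η l (𝓝 0) ∧ Tendsto ξ l (𝓝 ξ₀) := by
  obtain ⟨Λ, hΛ⟩ := exists_continuous_leftInverse C.injective
  set u := fun i => exp (L ((2 * Complex.I) • ξ i)) with hu
  set u₀ := exp (L ((2 * Complex.I) • ξ₀)) with hu₀
  have hum : ∀ i, u i ∈ unitary (H →L[ℂ] H) := fun i => C.exp_I_mem_unitary (hξ i)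
  have hu₀m := C.exp_I_mem_unitary hξ₀
  obtain ⟨h1, h2⟩ := tendsto_of_tendsto_exp_unitary_exp
    (fun i => C.isSelfAdjoint (hη i)) hum hu₀m h
  refine ⟨?_, tendsto_of_tendsto_exp_I C hξ hξn hξ₀ hξ₀n h1⟩
  have h3 : Tendsto (fun i => u i (η i) + η i) l (𝓝 0) := by
    have h4 := (Λ.continuous.tendsto _).comp h2
    rw [map_zero] at h4
    refine h4.congr fun i => ?_
    simp only [Function.comp]
    rw [(C.exp_isBracketHom _).conj_L (Unitary.mul_star_self_of_mem (hum i)), ← map_add, hΛ]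
  obtain ⟨c, hc⟩ : ∃ c : H →L[ℂ] H, c * (u₀ + 1) = 1 := by
    have h4 := (Unitary.norm_sub_one_lt_two_iff hu₀m).mp (norm_exp_I_sub_one_lt C hξ₀ hξ₀n)
    rw [spectrum.notMem_iff] at h4
    have h5 : IsUnit (u₀ + 1) := by
      rw [← IsUnit.neg_iff]
      convert! h4 using 1
      rw [map_neg, map_one]
      abel
    obtain ⟨v, hv⟩ := h5
    exact ⟨↑v⁻¹, by rw [← hv, v.inv_mul]⟩
  -- No bound on `η` is known in advance; the last term is absorbed into the left side once its
  -- coefficient is below `1 / 2`, whence the factor `2` in `h7`.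
  have hbound : ∀ i, ‖η i‖ ≤ ‖c‖ * ‖u i (η i) + η i‖ + ‖c‖ * ‖u i - u₀‖ * ‖η i‖ := by
    intro i
    have e1 : η i = c (u i (η i) + η i) - c ((u i - u₀) (η i)) := by
      have e2 : c ((u₀ + 1) (η i)) = η i := by
        rw [← mul_apply_eq_comp, hc, one_apply_eq_self]
      rw [← map_sub]
      conv_lhs => rw [← e2]
      congr 1
      simp only [add_apply, sub_apply, one_apply_eq_self]
      abel
    conv_lhs => rw [e1]
    refine (norm_sub_le _ _).trans (add_le_add (c.le_opNorm _) ?_)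
    refine (c.le_opNorm _).trans ?_
    rw [mul_assoc]
    exact mul_le_mul_of_nonneg_left ((u i - u₀).le_opNorm _) (norm_nonneg _)
  have h6 : Tendsto (fun i => ‖c‖ * ‖u i - u₀‖) l (𝓝 0) := by
    have h1' : Tendsto u l (𝓝 u₀) := h1
    have := ((h1'.sub_const u₀).norm).const_mul ‖c‖
    simpa only [sub_self, norm_zero, mul_zero] using this
  have h7 : Tendsto (fun i => 2 * (‖c‖ * ‖u i (η i) + η i‖)) l (𝓝 0) := by
    have := (h3.norm.const_mul ‖c‖).const_mul 2
    simpa using this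
  rw [tendsto_zero_iff_norm_tendsto_zero]
  refine squeeze_zero' (Eventually.of_forall fun i => norm_nonneg _) ?_ h7
  filter_upwards [h6.eventually (gt_mem_nhds (by norm_num : (0 : ℝ) < 1 / 2))] with i hi
  have := hbound i
  nlinarith [norm_nonneg (η i)]

set_option maxHeartbeats 1000000 in
/-- Polar coordinates on the universal domain have a continuous inverse. -/
theorem tendsto_of_tendsto_polar (C : CartanData L σ θ)
    (hησ : ∀ i, σ (η i) = η i) (hη : ∀ i, θ (η i) = -η i)
    (hξ : ∀ i, θ (ξ i) = -ξ i) (hξn : ∀ i, ‖L (ξ i)‖ < Real.pi / 2)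
    (hη₀σ : σ η₀ = η₀) (hη₀ : θ η₀ = -η₀) (hξ₀ : θ ξ₀ = -ξ₀) (hξ₀n : ‖L ξ₀‖ < Real.pi / 2)
    (h : Tendsto (fun i => exp (L (η i)) * exp (L ((2 * Complex.I) • ξ i)) * exp (L (η i))) l
      (𝓝 (exp (L η₀) * exp (L ((2 * Complex.I) • ξ₀)) * exp (L η₀)))) :
    Tendsto η l (𝓝 η₀) ∧ Tendsto ξ l (𝓝 ξ₀) := by
  obtain ⟨Λ, hΛ⟩ := exists_continuous_leftInverse C.injective
  have hinv : ∀ X Y : H, exp (-L X) * exp (L Y) * (exp (-L Y) * exp (L X)) = 1 := fun X Y => by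
    calc _ = exp (-L X) * (exp (L Y) * exp (-L Y)) * exp (L X) := by noncomm_ring
      _ = 1 := by rw [exp_mul_exp_neg, mul_one, exp_neg_mul_exp]
  -- Left translation by `exp (-L η₀)` moves the limit to `η₀ = 0`. The product `a` is no longer
  -- positive, so it is polar-decomposed as `exp (L η') * k`, and `k` is pushed onto `ξ`.
  set a := fun i => exp (-L η₀) * exp (L (η i)) with ha
  set b := fun i => exp (-L (η i)) * exp (L η₀) with hb
  have hab : ∀ i, a i * b i = 1 := fun i => hinv η₀ (η i)
  have hba : ∀ i, b i * a i = 1 := fun i => hinv (η i) η₀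
  have hn₀ : L (-η₀) = -L η₀ := map_neg L η₀
  have haut : ∀ i, IsBracketHom L (a i) := fun i => by
    simp only [ha, ← hn₀]
    exact (C.exp_isBracketHom _).mul (C.exp_isBracketHom _)
  have haσ : ∀ i X, a i (σ X) = σ (a i X) := fun i X => by
    simp only [ha, ← hn₀]
    rw [mul_apply_eq_comp, mul_apply_eq_comp, C.σ_exp (hησ i), C.σ_exp (by rw [map_neg, hη₀σ])]
  have hpol := fun i => C.polar hΛ (hab i) (hba i) (haut i) (haσ i)
  set η' := fun i => polarLog Λ (a i) with hη'
  set k := fun i => exp (-L (η' i)) * a i with hk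
  have hkm : ∀ i, k i ∈ unitary (H →L[ℂ] H) := fun i => (hpol i).2.2.1
  have hka : ∀ i, exp (L (η' i)) * k i = a i := fun i => by
    simp only [hk]
    rw [← mul_assoc, exp_mul_exp_neg, one_mul]
  set ξ' := fun i => k i (ξ i) with hξ'
  have hLξ' : ∀ i (c : ℂ), L (c • ξ' i) = k i * L (c • ξ i) * star (k i) := fun i c => by
    have h2 : c • ξ' i = k i (c • ξ i) := ((k i).map_smul c (ξ i)).symm
    rw [h2]
    exact ((hpol i).2.2.2.1.conj_L (Unitary.mul_star_self_of_mem (hkm i)) (c • ξ i)).symm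
  have hsa : ∀ i, star (a i) = exp (L (η i)) * exp (-L η₀) := fun i => by
    simp only [ha, star_mul, (C.isSelfAdjoint hη₀).neg.exp.star_eq,
      (C.isSelfAdjoint (hη i)).exp.star_eq]
  have hη's : ∀ i, star (exp (L (η' i))) = exp (L (η' i)) := fun i =>
    (C.isSelfAdjoint (hpol i).2.1).exp.star_eq
  have hF : ∀ i, exp (L (η' i)) * exp (L ((2 * Complex.I) • ξ' i)) * exp (L (η' i)) =
      exp (-L η₀) * (exp (L (η i)) * exp (L ((2 * Complex.I) • ξ i)) * exp (L (η i))) *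
        exp (-L η₀) := fun i => by
    have h2 : star (k i) * exp (L (η' i)) = star (a i) :=
      calc _ = star (k i) * star (exp (L (η' i))) := by rw [hη's]
        _ = star (exp (L (η' i)) * k i) := (star_mul _ _).symm
        _ = star (a i) := by rw [hka]
    rw [hLξ', exp_unitary_conj (hkm i)]
    calc _ = (exp (L (η' i)) * k i) * exp (L ((2 * Complex.I) • ξ i)) *
          (star (k i) * exp (L (η' i))) := by noncomm_ring
      _ = _ := by
        rw [h2, hka, hsa]
        simp only [ha]
        noncomm_ring
  have hlim : Tendsto (fun i => exp (L (η' i)) * exp (L ((2 * Complex.I) • ξ' i)) *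
      exp (L (η' i))) l (𝓝 (exp (L ((2 * Complex.I) • ξ₀)))) := by
    simp only [hF]
    have h2 := (h.const_mul (exp (-L η₀))).mul_const (exp (-L η₀))
    convert! h2 using 2
    calc _ = (exp (-L η₀) * exp (L η₀)) * exp (L ((2 * Complex.I) • ξ₀)) *
          (exp (L η₀) * exp (-L η₀)) := by
          rw [exp_neg_mul_exp, exp_mul_exp_neg, one_mul, mul_one]
      _ = _ := by noncomm_ring
  have hξ'θ : ∀ i, θ (ξ' i) = -ξ' i := fun i => by
    simp only [hξ']
    rw [← (hpol i).2.2.2.2.2, hξ, map_neg]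
  have hξ'n : ∀ i, ‖L (ξ' i)‖ < Real.pi / 2 := fun i => by
    have := hLξ' i 1
    rw [one_smul, one_smul] at this
    rw [this, CStarRing.norm_mul_mem_unitary _ (Unitary.star_mem (hkm i)),
      CStarRing.norm_mem_unitary_mul _ (hkm i)]
    exact hξn i
  obtain ⟨h1, h2⟩ := tendsto_zero_of_tendsto_polar C (fun i => (hpol i).2.1) hξ'θ hξ'n hξ₀ hξ₀n hlim
  have hLcont : Continuous L := L.continuous_of_finiteDimensional
  have hexp1 : Tendsto (fun i => exp (L (η' i))) l (𝓝 1) := by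
    have := ((continuous_exp_complex.comp hLcont).tendsto (0 : H)).comp h1
    simp only [Function.comp_def, map_zero, exp_zero] at this
    exact this
  have hexp2 : Tendsto (fun i => exp (-L (η' i))) l (𝓝 1) := by
    have := ((continuous_exp_complex.comp hLcont.neg).tendsto (0 : H)).comp h1
    simp only [Function.comp_def, Pi.neg_apply, map_zero, neg_zero, exp_zero] at this
    exact this
  -- From `exp (L η) = exp (L η₀) * exp (L η') * k` the unitary `k` cancels, so `η' → 0` determines
  -- the limit of `η` through the logarithm.
  have hsq : ∀ i, exp (L (η i)) * star (exp (L (η i))) =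
      exp (L η₀) * (exp (L (η' i)) * exp (L (η' i))) * exp (L η₀) := fun i => by
    have e1 : exp (L (η i)) = exp (L η₀) * a i := by
      simp only [ha]
      rw [← mul_assoc, exp_mul_exp_neg, one_mul]
    rw [e1, star_mul, (C.isSelfAdjoint hη₀).exp.star_eq, ← hka, star_mul, hη's]
    calc _ = exp (L η₀) * (exp (L (η' i)) * (k i * star (k i)) * exp (L (η' i))) *
          exp (L η₀) := by noncomm_ring
      _ = _ := by rw [Unitary.mul_star_self_of_mem (hkm i), mul_one]
  have hη₀lim : Tendsto η l (𝓝 η₀) := by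
    have e1 : Tendsto (fun i => exp (L η₀) * (exp (L (η' i)) * exp (L (η' i))) * exp (L η₀)) l
        (𝓝 (exp (L η₀) * star (exp (L η₀)))) := by
      have := ((hexp1.mul hexp1).const_mul (exp (L η₀))).mul_const (exp (L η₀))
      rw [(C.isSelfAdjoint hη₀).exp.star_eq]
      simpa using this
    have e2 : IsUnit (exp (L η₀)) :=
      ⟨⟨_, exp (-L η₀), exp_mul_exp_neg _, exp_neg_mul_exp _⟩, rfl⟩
    have e3 := CFC.continuousOn_log (A := H →L[ℂ] H) (exp (L η₀) * star (exp (L η₀)))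
      ⟨IsSelfAdjoint.mul_star_self _, e2.mul e2.star⟩
    have e4 : Tendsto (fun i => CFC.log (exp (L (η i)) * star (exp (L (η i))))) l
        (𝓝 (CFC.log (exp (L η₀) * star (exp (L η₀))))) := by
      refine e3.tendsto.comp (tendsto_nhdsWithin_iff.mpr ⟨?_, Eventually.of_forall fun i => ?_⟩)
      · simpa only [hsq] using e1
      · have e5 : IsUnit (exp (L (η i))) :=
          ⟨⟨_, exp (-L (η i)), exp_mul_exp_neg _, exp_neg_mul_exp _⟩, rfl⟩
        exact ⟨IsSelfAdjoint.mul_star_self _, e5.mul e5.star⟩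
    have e5 := (Λ.continuous.tendsto _).comp (e4.const_smul (1 / 2 : ℝ))
    have e6 : ∀ {X : H}, θ X = -X →
        Λ ((1 / 2 : ℝ) • CFC.log (exp (L X) * star (exp (L X)))) = X := fun {X} hX => by
      have := polarLog_exp_mul hΛ C hX (k := 1) (by simp)
      rw [mul_one] at this
      exact this
    rw [e6 hη₀] at e5
    exact e5.congr fun i => e6 (hη i)
  refine ⟨hη₀lim, ?_⟩
  -- Now `k = exp (-L η') * exp (-L η₀) * exp (L η)` tends to `1`, so `ξ = k* ξ'` has the same limit
  -- as `ξ'`.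
  have hk1 : Tendsto k l (𝓝 1) := by
    have e1 := ((continuous_exp_complex.comp hLcont).tendsto η₀).comp hη₀lim
    have e2 := hexp2.mul (e1.const_mul (exp (-L η₀)))
    simpa only [Function.comp, exp_neg_mul_exp, one_mul] using e2
  have hks : Tendsto (fun i => star (k i)) l (𝓝 1) := by
    have := (continuous_star.tendsto (1 : H →L[ℂ] H)).comp hk1
    rwa [star_one] at this
  have e3 : Tendsto (fun i => star (k i) (ξ' i)) l (𝓝 ((1 : H →L[ℂ] H) ξ₀)) :=
    ((isBoundedBilinearMap_apply (𝕜 := ℂ) (E := H) (F := H)).continuous.tendsto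
      ((1 : H →L[ℂ] H), ξ₀)).comp (hks.prodMk_nhds h2)
  rw [one_apply_eq_self] at e3
  refine e3.congr fun i => ?_
  simp only [hξ']
  rw [← mul_apply_eq_comp, Unitary.star_mul_self_of_mem (hkm i), one_apply_eq_self]

end Inducing

/-! ### Local structure of the automorphism group near the identity. -/

section Slice

variable {A : Type*} [NormedRing A] [NormedAlgebra ℂ A] [CompleteSpace A]
  {P : Type*} [NormedAddCommGroup P] [NormedSpace ℂ P] [CompleteSpace P]
  {F : Type*} [NormedAddCommGroup F] [NormedSpace ℂ F] [CompleteSpace F]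

/-- Factorization of elements near `1` along an immersion `Φ` and a transversal `j`. -/
theorem exists_slice_inverse {Φ : P → A} {Φ' : P →L[ℂ] A} {p₀ : P}
    (hΦ : HasStrictFDerivAt Φ Φ' p₀) (h1 : Φ p₀ = 1) (j : F →L[ℂ] A)
    (hinj : ∀ p f, Φ' p + j f = 0 → p = 0 ∧ f = 0) (hsurj : ∀ a, ∃ p f, Φ' p + j f = a) :
    ∃ (g : A → P × F) (D : A →L[ℂ] P × F), g 1 = (p₀, 0) ∧ HasFDerivAt g D 1 ∧
      (∀ p, D (Φ' p) = (p, 0)) ∧ (∀ᶠ p in 𝓝 p₀, g (Φ p) = (p, 0)) ∧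
      (∀ᶠ a in 𝓝 1, Φ (g a).1 * (1 + j (g a).2) = a) ∧ (∀ᶠ a in 𝓝 1, ContinuousAt g a) := by
  let M : P × F → A := fun x => Φ x.1 * (1 + j x.2)
  let M' : P × F →L[ℂ] A :=
    Φ'.comp (ContinuousLinearMap.fst ℂ P F) + j.comp (ContinuousLinearMap.snd ℂ P F)
  have hM'apply : ∀ x : P × F, M' x = Φ' x.1 + j x.2 := fun x => rfl
  -- As `Φ p₀ = 1`, the product rule leaves `Φ' + j`, an isomorphism by `hinj` and `hsurj`; the
  -- inverse function theorem applies to `M`.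
  have hM : HasStrictFDerivAt M M' (p₀, 0) := by
    have e1 : HasStrictFDerivAt (fun x : P × F => Φ x.1)
        (Φ'.comp (ContinuousLinearMap.fst ℂ P F)) (p₀, 0) :=
      HasStrictFDerivAt.comp (p₀, (0 : F)) (g := Φ) (f := Prod.fst) hΦ hasStrictFDerivAt_fst
    have e2 : HasStrictFDerivAt (fun x : P × F => 1 + j x.2)
        (j.comp (ContinuousLinearMap.snd ℂ P F)) (p₀, 0) :=
      (j.comp (ContinuousLinearMap.snd ℂ P F)).hasStrictFDerivAt.const_add 1
    refine (e1.mul' e2).congr_fderiv ?_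
    refine ContinuousLinearMap.ext fun x => ?_
    simp [M', h1]
    abel
  have hker : (M' : P × F →ₗ[ℂ] A).ker = ⊥ := by
    rw [LinearMap.ker_eq_bot']
    intro x hx
    exact Prod.ext (hinj _ _ hx).1 (hinj _ _ hx).2
  have hrange : (M' : P × F →ₗ[ℂ] A).range = ⊤ := by
    rw [LinearMap.range_eq_top]
    intro a
    obtain ⟨p, f, h⟩ := hsurj a
    exact ⟨(p, f), h⟩
  let eM : (P × F) ≃L[ℂ] A := ContinuousLinearEquiv.ofBijective M' hker hrange
  have heM : (eM : P × F →L[ℂ] A) = M' := by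
    refine ContinuousLinearMap.ext fun x => ?_
    rfl
  have hMe : HasStrictFDerivAt M (eM : P × F →L[ℂ] A) (p₀, 0) := by rwa [heM]
  have hM0 : M (p₀, 0) = 1 := by simp [M, h1]
  let g := hMe.localInverse M eM (p₀, 0)
  have hg0 : g 1 = (p₀, 0) := by
    rw [← hM0]
    exact hMe.localInverse_apply_image
  have hgd : HasStrictFDerivAt g (eM.symm : A →L[ℂ] P × F) 1 := by
    have := hMe.to_localInverse
    rwa [hM0] at this
  refine ⟨g, (eM.symm : A →L[ℂ] P × F), hg0, hgd.hasFDerivAt, ?_, ?_, ?_, ?_⟩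
  · intro p
    have : eM (p, 0) = Φ' p := by
      change M' _ = _
      simp [hM'apply]
    change eM.symm (Φ' p) = _
    rw [← this, eM.symm_apply_apply]
  · have h2 : Tendsto (fun p : P => (p, (0 : F))) (𝓝 p₀) (𝓝 (p₀, 0)) :=
      (Continuous.prodMk_left (0 : F)).tendsto p₀
    filter_upwards [h2.eventually hMe.eventually_left_inverse] with p hp
    have h3 : M (p, 0) = Φ p := by simp [M]
    rwa [h3] at hp
  · have := hMe.eventually_right_inverse
    rwa [hM0] at this
  · have h2 : ∀ᶠ a in 𝓝 (1 : A), a ∈ (hMe.toOpenPartialHomeomorph M).target := by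
      refine (hMe.toOpenPartialHomeomorph M).open_target.mem_nhds ?_
      rw [← hM0]
      exact hMe.image_mem_toOpenPartialHomeomorph_target
    filter_upwards [h2] with a ha
    exact (hMe.toOpenPartialHomeomorph M).continuousAt_symm ha

end Slice

section LocalSection

variable {H : Type*} [NormedAddCommGroup H] [InnerProductSpace ℂ H] [FiniteDimensional ℂ H]
  {L : H →ₗ[ℂ] (H →L[ℂ] H)} {σ θ : H →ₛₗ[starRingEnd ℂ] H}

/-- The failure of an operator to be a derivation. -/
def derivationDefect (L : H →ₗ[ℂ] (H →L[ℂ] H)) (f : H →L[ℂ] H) : H →ₗ[ℂ] H →ₗ[ℂ] H :=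
  LinearMap.mk₂ ℂ (fun X Y => f (L X Y) - L (f X) Y - L X (f Y))
    (fun X X' Y => by simp only [map_add, add_apply]; abel)
    (fun c X Y => by simp only [map_smul, smul_apply, smul_sub])
    (fun X Y Y' => by simp only [map_add]; abel)
    (fun c X Y => by simp only [map_smul, smul_sub])

/-- Automorphisms near `1` in a linear complement of the inner derivations are trivial. -/
theorem CartanData.eq_zero_of_isBracketHom_one_add (C : CartanData L σ θ)
    {T : Type*} [NormedAddCommGroup T] [NormedSpace ℂ T] [FiniteDimensional ℂ T]
    (j : T →L[ℂ] (H →L[ℂ] H)) (hj : ∀ t X, L X = j t → t = 0) :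
    ∃ ε > 0, ∀ t, ‖t‖ < ε → IsBracketHom L (1 + j t) → t = 0 := by
  set b := stdOrthonormalBasis ℂ H
  let δ : T →ₗ[ℂ] (Fin (Module.finrank ℂ H) × Fin (Module.finrank ℂ H) → H) :=
    { toFun := fun f p => derivationDefect L (j f) (b p.1) (b p.2)
      map_add' := fun f g => by
        ext1 p
        simp only [derivationDefect, LinearMap.mk₂_apply, add_apply, map_add, Pi.add_apply]
        abel
      map_smul' := fun c f => by
        ext1 p
        simp only [derivationDefect, LinearMap.mk₂_apply, smul_apply, map_smul,
          Pi.smul_apply, smul_sub, RingHom.id_apply] }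
  -- A vanishing defect makes `j f` a derivation, hence inner, hence zero by transversality; in
  -- finite dimension the defect then bounds `f` from above.
  have hδ : δ.ker = ⊥ := by
    rw [LinearMap.ker_eq_bot']
    intro f hf
    have h1 : derivationDefect L (j f) = 0 := by
      refine b.toBasis.ext fun i => b.toBasis.ext fun j => ?_
      simpa [δ] using congrFun hf (i, j)
    obtain ⟨X, hX⟩ := C.inner_derivation (j f) fun X Y => by
      have h2 : derivationDefect L (j f) X Y = 0 := by rw [h1]; rfl
      rw [derivationDefect, LinearMap.mk₂_apply, sub_sub] at h2
      exact sub_eq_zero.mp h2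
    exact hj f X hX
  obtain ⟨K, hK, hKδ⟩ := δ.exists_antilipschitzWith hδ
  set Lc : H →L[ℂ] (H →L[ℂ] H) := LinearMap.toContinuousLinearMap L
  set m : ℝ := K * (‖Lc‖ * ‖j‖ ^ 2) + 1
  have hpos : 0 < m := by positivity
  refine ⟨m⁻¹, by positivity, fun f hf haut => ?_⟩
  have h1 : ‖f‖ ≤ K * ‖δ f‖ := ZeroHomClass.bound_of_antilipschitz δ hKδ f
  -- For an automorphism `1 + j f` the defect equals the quadratic term `[j f X, j f Y]`. So `‖f‖`
  -- is at most a constant times `‖f‖ ^ 2`, impossible for small nonzero `f`.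
  have h2 : ‖δ f‖ ≤ ‖Lc‖ * ‖j f‖ ^ 2 := by
    refine (pi_norm_le_iff_of_nonneg (by positivity)).mpr fun p => ?_
    have h3 := haut (b p.1) (b p.2)
    simp only [add_apply, one_apply_eq_self, map_add] at h3
    have h4 : δ f p = Lc (j f (b p.1)) (j f (b p.2)) := by
      change j f (L (b p.1) (b p.2)) - L (j f (b p.1)) (b p.2) - L (b p.1) (j f (b p.2)) =
        L (j f (b p.1)) (j f (b p.2))
      have h5 := sub_eq_zero.mpr h3
      rw [← sub_eq_zero, ← h5]
      abel
    rw [h4]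
    have hb : ∀ i, ‖j f (b i)‖ ≤ ‖j f‖ := fun i => by
      simpa [b.orthonormal.norm_eq_one] using (j f).le_opNorm (b i)
    calc _ ≤ ‖Lc (j f (b p.1))‖ * ‖j f (b p.2)‖ := (Lc _).le_opNorm _
      _ ≤ (‖Lc‖ * ‖j f (b p.1)‖) * ‖j f (b p.2)‖ := by
        gcongr
        exact Lc.le_opNorm _
      _ ≤ (‖Lc‖ * ‖j f‖) * ‖j f‖ := by
        gcongr <;> exact hb _
      _ = _ := by ring
  by_contra hne
  have hfpos : 0 < ‖f‖ := norm_pos_iff.mpr hne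
  have h3 : ‖f‖ * m < 1 := by
    rwa [lt_inv_comm₀ hfpos hpos, ← one_div, lt_div_iff₀ hfpos, mul_comm] at hf
  have h4 : ‖f‖ ≤ K * (‖Lc‖ * (‖j‖ * ‖f‖) ^ 2) := by
    refine h1.trans (mul_le_mul_of_nonneg_left (h2.trans ?_) K.2)
    gcongr
    exact j.le_opNorm f
  have h5 : (K : ℝ) * (‖Lc‖ * (‖j‖ * ‖f‖) ^ 2) = ‖f‖ * (‖f‖ * (m - 1)) := by
    simp only [m]
    ring
  nlinarith

variable {P : Type*} [NormedAddCommGroup P] [NormedSpace ℂ P] [CompleteSpace P]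

/-- A map into the automorphisms of the Lie algebra whose derivative is an isomorphism onto the
inner derivations is a local homeomorphism onto the automorphism group. -/
theorem CartanData.exists_local_inverse (C : CartanData L σ θ) (e : P ≃L[ℂ] H)
    {Φ : P → H →L[ℂ] H} {p₀ : P}
    (hΦ : HasStrictFDerivAt Φ ((LinearMap.toContinuousLinearMap L).comp (e : P →L[ℂ] H)) p₀)
    (h1 : Φ p₀ = 1) (haut : ∀ᶠ p in 𝓝 p₀, IsBracketHom L (Φ p)) :
    ∃ (Ψ : (H →L[ℂ] H) → P) (D : (H →L[ℂ] H) →L[ℂ] P), Ψ 1 = p₀ ∧ HasFDerivAt Ψ D 1 ∧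
      (∀ X, D (L X) = e.symm X) ∧ (∀ᶠ p in 𝓝 p₀, Ψ (Φ p) = p) ∧
      (∀ᶠ a in 𝓝 1, IsBracketHom L a → Φ (Ψ a) = a) ∧ (∀ᶠ a in 𝓝 1, ContinuousAt Ψ a) := by
  obtain ⟨F, hF⟩ := Submodule.exists_isCompl (LinearMap.range L)
  let bF := Module.finBasis ℂ F
  let j : (Fin (Module.finrank ℂ F) → ℂ) →L[ℂ] (H →L[ℂ] H) :=
    LinearMap.toContinuousLinearMap (F.subtype ∘ₗ bF.equivFun.symm.toLinearMap)
  have hj : ∀ t, j t = (bF.equivFun.symm t : H →L[ℂ] H) := fun t => rfl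
  have hj0 : ∀ t X, L X = j t → t = 0 := fun t X h => by
    have h2 : (bF.equivFun.symm t : H →L[ℂ] H) = 0 := by
      refine Submodule.disjoint_def.mp hF.disjoint _ ⟨X, ?_⟩ (bF.equivFun.symm t).2
      rw [h, hj]
    have h3 : bF.equivFun.symm t = 0 := Subtype.ext h2
    exact bF.equivFun.symm.map_eq_zero_iff.mp h3
  obtain ⟨ε, hε, hεF⟩ := C.eq_zero_of_isBracketHom_one_add j hj0
  obtain ⟨g, D, hg0, hgd, hD, hleft, hright, hcont⟩ := exists_slice_inverse hΦ h1 j (by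
      intro p f hpf
      have hx' : L (e p) + j f = 0 := hpf
      have h2 : f = 0 := by
        refine hj0 f (-e p) ?_
        rw [map_neg]
        exact (eq_neg_of_add_eq_zero_right hx').symm
      rw [h2, map_zero, add_zero] at hx'
      have h3 : e p = 0 := C.injective (by rw [hx', map_zero])
      exact ⟨by simpa using h3, h2⟩) (by
      intro a
      obtain ⟨_, ⟨X, rfl⟩, f, hf, rfl⟩ :=
        Submodule.mem_sup.mp (hF.sup_eq_top ▸ Submodule.mem_top (x := a))
      refine ⟨e.symm X, bF.equivFun ⟨f, hf⟩, ?_⟩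
      rw [hj, LinearEquiv.symm_apply_apply]
      simp)
  have hgc := hgd.continuousAt
  refine ⟨fun a => (g a).1, (ContinuousLinearMap.fst ℂ P _).comp D, by simp only [hg0],
    ?_, ?_, ?_, ?_, ?_⟩
  · exact (ContinuousLinearMap.fst ℂ P _).hasFDerivAt.comp 1 hgd
  · intro X
    have h2 := hD (e.symm X)
    simp only [ContinuousLinearMap.comp_apply, ContinuousLinearEquiv.coe_coe,
      ContinuousLinearEquiv.apply_symm_apply, LinearMap.coe_toContinuousLinearMap'] at h2
    simp [h2]
  · filter_upwards [hleft] with p hp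
    rw [hp]
  · have h3 : Tendsto (fun a => (g a).1) (𝓝 1) (𝓝 p₀) := by
      have := (continuous_fst.tendsto _).comp hgc.tendsto
      rwa [hg0] at this
    have h4 : Tendsto (fun a => (g a).2) (𝓝 1) (𝓝 0) := by
      have := (continuous_snd.tendsto _).comp hgc.tendsto
      rwa [hg0] at this
    have h5 : ∀ᶠ p in 𝓝 p₀, IsUnit (Φ p) := by
      have : ∀ᶠ a in 𝓝 (Φ p₀), IsUnit a := by
        rw [h1]
        exact Units.isOpen.mem_nhds isUnit_one
      exact hΦ.continuousAt.eventually this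
    have h6 : ∀ᶠ a in 𝓝 (1 : H →L[ℂ] H), ‖(g a).2‖ < ε := by
      have := h4.norm
      rw [norm_zero] at this
      exact this.eventually (gt_mem_nhds hε)
    filter_upwards [hright, h3.eventually haut, h3.eventually h5, h6] with a ha ha1 ha2 ha3 ha4
    -- Both `a` and its factor `Φ (g a).1` are automorphisms, so the transversal factor `1 + j (g
    -- a).2` is one near `1`, and therefore trivial.
    have hf : (g a).2 = 0 := by
      refine hεF _ ha3 ?_
      obtain ⟨v, hv⟩ := ha2
      have e1 : ((↑v⁻¹ : H →L[ℂ] H)) * a = 1 + j (g a).2 := by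
        conv_lhs => rw [← ha]
        rw [← hv, ← mul_assoc, v.inv_mul, one_mul]
      rw [← e1]
      refine IsBracketHom.mul ?_ ha4
      exact ha1.inv (by rw [← hv, v.mul_inv]) (by rw [← hv, v.inv_mul])
    conv_rhs => rw [← ha]
    rw [hf, map_zero, add_zero, mul_one]
  · filter_upwards [hcont] with a ha
    exact continuous_fst.continuousAt.comp ha

end LocalSection

/-! ### The exponential map of a group from a local inverse of its adjoint representation. -/

section GroupExp

variable {H : Type*} [NormedAddCommGroup H] [InnerProductSpace ℂ H] [FiniteDimensional ℂ H]
  {L : H →ₗ[ℂ] (H →L[ℂ] H)} {σ θ : H →ₛₗ[starRingEnd ℂ] H}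
  {G : Type*} [Group G] [TopologicalSpace G]

/-- `s` is a local inverse near `1` of the adjoint representation `ρ` of a Lie group, viewed as a
map into the automorphism group of the Lie algebra. -/
structure IsLocalSection (L : H →ₗ[ℂ] (H →L[ℂ] H)) (ρ : G →* (H →L[ℂ] H))
    (s : (H →L[ℂ] H) → G) : Prop where
  map_one : s 1 = 1
  left_inv : ∀ᶠ g in 𝓝 1, s (ρ g) = g
  right_inv : ∀ᶠ a in 𝓝 1, IsBracketHom L a → ρ (s a) = a
  continuousAt : ∀ᶠ a in 𝓝 1, ContinuousAt s a

/-- `E` is an exponential map for the group `G` with adjoint representation `ρ`. -/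
structure IsExpMap (L : H →ₗ[ℂ] (H →L[ℂ] H)) (ρ : G →* (H →L[ℂ] H)) (E : H → G) : Prop where
  continuous : Continuous E
  map_E : ∀ X, ρ (E X) = exp (L X)
  add : ∀ X Y, L X Y = 0 → E (X + Y) = E X * E Y
  conj : ∀ g X, g * E X * g⁻¹ = E (ρ g X)
  eventually : ∀ U ∈ 𝓝 (0 : H), ∀ᶠ g in 𝓝 (1 : G), ∃ X ∈ U, E X = g
  unique : ∀ (γ : ℂ → G) X, (∀ s t, γ (s + t) = γ s * γ t) → ContinuousAt γ 0 →
    (∀ t, ρ (γ t) = exp (t • L X)) → γ 1 = E X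

theorem CartanData.commute_L (C : CartanData L σ θ) {X Y : H} (h : L X Y = 0) :
    Commute (L X) (L Y) := by
  have := C.lie X Y
  rw [h, map_zero] at this
  exact (sub_eq_zero.mp this.symm)

theorem CartanData.L_self (C : CartanData L σ θ) (X : H) : L X X = 0 := by
  have h := C.skew X X
  have h2 : (2 : ℂ) • L X X = 0 := by
    rw [two_smul]
    nth_rewrite 1 [h]
    exact neg_add_cancel _
  simpa using h2

variable [IsTopologicalGroup G] {ρ : G →* (H →L[ℂ] H)} {s : (H →L[ℂ] H) → G}

set_option maxHeartbeats 1000000 in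
-- Near `0` the map is `e X = s (exp (L X))`, additive on small commuting vectors since `ρ` is
-- injective near `1`. In general it is `e (X / n) ^ n` for any `n` with `‖X‖ < n r`, two choices
-- being compared through their product.
theorem exists_isExpMap (C : CartanData L σ θ) (hρ : Continuous ρ)
    (hρL : ∀ g, IsBracketHom L (ρ g)) (hs : IsLocalSection L ρ s) :
    ∃ E : H → G, IsExpMap L ρ E ∧ ∀ᶠ X in 𝓝 0, E X = s (exp (L X)) := by
  have hLcont : Continuous L := L.continuous_of_finiteDimensional
  set e : H → G := fun X => s (exp (L X)) with he
  have hexpc : Continuous fun X => exp (L X) := continuous_exp_complex.comp hLcont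
  have hexp0 : Tendsto (fun X => exp (L X)) (𝓝 0) (𝓝 1) := by
    have := hexpc.tendsto (0 : H)
    rwa [map_zero, exp_zero] at this
  have he0 : e 0 = 1 := by simp only [he, map_zero, exp_zero, hs.map_one]
  have hec : ∀ᶠ X in 𝓝 (0 : H), ContinuousAt e X :=
    (hexp0.eventually hs.continuousAt).mono fun X hX =>
      ContinuousAt.comp (f := fun X => exp (L X)) hX hexpc.continuousAt
  have hρe : ∀ᶠ X in 𝓝 (0 : H), ρ (e X) = exp (L X) :=
    (hexp0.eventually hs.right_inv).mono fun X hX => hX (C.exp_isBracketHom X)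
  have hmul : ∀ᶠ p in 𝓝 ((1 : G), (1 : G)), s (ρ (p.1 * p.2)) = p.1 * p.2 := by
    have : Tendsto (fun p : G × G => p.1 * p.2) (𝓝 (1, 1)) (𝓝 1) := by
      have := (continuous_mul (M := G)).tendsto (1, 1)
      rwa [mul_one] at this
    exact this.eventually hs.left_inv
  -- The left inverse is needed on products `g * h`, so that an identity between images under `ρ`
  -- lifts to `G`.
  obtain ⟨W, hW, hWs⟩ : ∃ W ∈ 𝓝 (1 : G), ∀ g ∈ W, ∀ h ∈ W, s (ρ (g * h)) = g * h := by
    rw [nhds_prod_eq] at hmul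
    obtain ⟨U, hU, V, hV, h⟩ := mem_prod_iff.mp hmul
    exact ⟨U ∩ V, inter_mem hU hV, fun g hg k hk => h (Set.mk_mem_prod hg.1 hk.2)⟩
  have h1W : (1 : G) ∈ W := mem_of_mem_nhds hW
  have hWs1 : ∀ g ∈ W, s (ρ g) = g := fun g hg => by simpa using hWs g hg 1 h1W
  have heW : ∀ᶠ X in 𝓝 (0 : H), e X ∈ W := by
    have h1 : ContinuousAt e 0 := hec.self_of_nhds
    have h2 : W ∈ 𝓝 (e 0) := by rwa [he0]
    exact h1.eventually h2
  obtain ⟨r, hr, hball⟩ := Metric.eventually_nhds_iff.mp ((hec.and hρe).and heW)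
  have hB : ∀ X : H, ‖X‖ < r → ContinuousAt e X ∧ ρ (e X) = exp (L X) ∧ e X ∈ W := fun X hX => by
    have := hball (y := X) (by simpa using hX)
    exact ⟨this.1.1, this.1.2, this.2⟩
  have hadd : ∀ X Y, ‖X‖ < r → ‖Y‖ < r → ‖X + Y‖ < r → L X Y = 0 → e (X + Y) = e X * e Y := by
    intro X Y hX hY hXY h
    have h1 := hWs _ (hB X hX).2.2 _ (hB Y hY).2.2
    rw [← h1, map_mul, (hB X hX).2.1, (hB Y hY).2.1,
      ← exp_add_of_commute_complex (C.commute_L h), ← map_add]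
  have hLsmul : ∀ (a b : ℂ) X, L (a • X) (b • X) = 0 := fun a b X => by
    rw [map_smul, map_smul, smul_apply, C.L_self, smul_zero, smul_zero]
  have hpow : ∀ (n : ℕ) X, ‖(n : ℂ) • X‖ < r → e ((n : ℂ) • X) = e X ^ n := by
    intro n
    induction n with
    | zero => intro X _; simp [he0]
    | succ n ih =>
      intro X hX
      have hn : ‖((n + 1 : ℕ) : ℂ) • X‖ = (n + 1) * ‖X‖ := by
        rw [norm_smul, Complex.norm_natCast]
        push_cast
        ring
      have hn' : ‖(n : ℂ) • X‖ = n * ‖X‖ := by rw [norm_smul, Complex.norm_natCast]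
      have h1 : ‖(n : ℂ) • X‖ < r := by
        rw [hn'] ; rw [hn] at hX
        nlinarith [norm_nonneg X]
      have h2 : ‖X‖ < r := by
        rw [hn] at hX
        nlinarith [norm_nonneg X, (Nat.cast_nonneg n : (0 : ℝ) ≤ n),
          mul_nonneg (Nat.cast_nonneg n : (0 : ℝ) ≤ n) (norm_nonneg X)]
      have h3 : ((n + 1 : ℕ) : ℂ) • X = (n : ℂ) • X + X := by
        push_cast
        rw [add_smul, one_smul]
      rw [h3] at hX ⊢
      rw [hadd _ _ h1 h2 hX (by simpa using hLsmul n 1 X), ih X h1, pow_succ]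
  -- The `+ 1` makes `‖X‖ < N X * r` strict, so `N X` also serves on a neighbourhood of `X`; this
  -- gives continuity.
  set N : H → ℕ := fun X => ⌊‖X‖ / r⌋₊ + 1 with hN
  have hNlt : ∀ X, ‖X‖ < (N X : ℝ) * r := fun X => by
    rw [← div_lt_iff₀ hr]
    simpa [hN] using Nat.lt_floor_add_one (‖X‖ / r)
  set E : H → G := fun X => e (((N X : ℂ)⁻¹) • X) ^ N X with hE
  have hE2 : ∀ X (n m : ℕ), 0 < n → 0 < m → ‖X‖ < n * r →
      e (((n : ℂ)⁻¹) • X) ^ n = e (((n * m : ℕ) : ℂ)⁻¹ • X) ^ (n * m) := by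
    intro X n m hn hm hX
    have hn0 : (n : ℂ) ≠ 0 := by exact_mod_cast hn.ne'
    have hm0 : (m : ℂ) ≠ 0 := by exact_mod_cast hm.ne'
    have h1 : ((n : ℂ)⁻¹) • X = (m : ℂ) • (((n * m : ℕ) : ℂ)⁻¹ • X) := by
      rw [smul_smul]
      congr 1
      push_cast
      field_simp
    have h2 : ‖((n : ℂ)⁻¹) • X‖ < r := by
      rw [norm_smul, norm_inv, Complex.norm_natCast, inv_mul_lt_iff₀ (by exact_mod_cast hn)]
      exact hX
    rw [h1, hpow m _ (by rw [← h1]; exact h2), ← pow_mul, mul_comm]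
  have hNpos : ∀ X, 0 < N X := fun X => Nat.succ_pos _
  have hEn : ∀ X (n : ℕ), 0 < n → ‖X‖ < n * r → E X = e (((n : ℂ)⁻¹) • X) ^ n := by
    intro X n hn hX
    rw [hE2 X n (N X) hn (hNpos X) hX]
    simp only [hE]
    rw [hE2 X (N X) n (hNpos X) hn (hNlt X), mul_comm]
  have hEe : ∀ X, ‖X‖ < r → E X = e X := fun X hX => by
    have := hEn X 1 one_pos (by simpa using hX)
    simpa using this
  have hsmall : ∀ (X : H) (n : ℕ), 0 < n → ‖X‖ < n * r → ‖((n : ℂ)⁻¹) • X‖ < r := by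
    intro X n hn hX
    rw [norm_smul, norm_inv, Complex.norm_natCast, inv_mul_lt_iff₀ (by exact_mod_cast hn)]
    exact hX
  have hEcont : Continuous E := by
    rw [continuous_iff_continuousAt]
    intro X
    have h1 : ∀ᶠ Y in 𝓝 X, ‖Y‖ < N X * r :=
      (continuous_norm.tendsto X).eventually (gt_mem_nhds (hNlt X))
    have h2 : ContinuousAt (fun Y => e (((N X : ℂ)⁻¹) • Y) ^ N X) X := by
      have h3 := (hB _ (hsmall X (N X) (hNpos X) (hNlt X))).1
      have h4 : ContinuousAt (fun Y : H => ((N X : ℂ)⁻¹) • Y) X :=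
        (continuous_const_smul _).continuousAt
      exact (ContinuousAt.comp (f := fun Y : H => ((N X : ℂ)⁻¹) • Y) h3 h4).pow _
    refine h2.congr ?_
    filter_upwards [h1] with Y hY
    exact (hEn Y (N X) (hNpos X) hY).symm
  have hexpn : ∀ (X : H) (n : ℕ), 0 < n → exp (L (((n : ℂ)⁻¹) • X)) ^ n = exp (L X) := by
    intro X n hn
    let _ : NormedAlgebra ℚ (H →L[ℂ] H) := NormedAlgebra.restrictScalars ℚ ℂ _
    rw [← exp_nsmul, ← map_nsmul, ← Nat.cast_smul_eq_nsmul ℂ, smul_smul, mul_inv_cancel₀, one_smul]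
    exact_mod_cast hn.ne'
  have hρE : ∀ X, ρ (E X) = exp (L X) := fun X => by
    simp only [hE]
    rw [map_pow, (hB _ (hsmall X (N X) (hNpos X) (hNlt X))).2.1, hexpn X _ (hNpos X)]
  have hEadd : ∀ X Y, L X Y = 0 → E (X + Y) = E X * E Y := by
    intro X Y h
    obtain ⟨n, hn⟩ := exists_nat_gt ((‖X‖ + ‖Y‖) / r)
    rw [div_lt_iff₀ hr] at hn
    have hn0 : 0 < n := by
      rcases Nat.eq_zero_or_pos n with h0 | h0
      · rw [h0, Nat.cast_zero, zero_mul] at hn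
        have := norm_nonneg X
        have := norm_nonneg Y
        linarith
      · exact h0
    have hX : ‖X‖ < n * r := by have := norm_nonneg Y; linarith
    have hY : ‖Y‖ < n * r := by have := norm_nonneg X; linarith
    have hXY : ‖X + Y‖ < n * r := (norm_add_le _ _).trans_lt hn
    have hL0 : L (((n : ℂ)⁻¹) • X) (((n : ℂ)⁻¹) • Y) = 0 := by
      rw [map_smul, map_smul, smul_apply, h, smul_zero, smul_zero]
    have hL1 : L (((n : ℂ)⁻¹) • Y) (((n : ℂ)⁻¹) • X) = 0 := by
      rw [C.skew, hL0, neg_zero]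
    have hXY' := hsmall _ n hn0 hXY
    rw [hEn X n hn0 hX, hEn Y n hn0 hY, hEn _ n hn0 hXY]
    rw [smul_add] at hXY' ⊢
    have e1 := hadd _ _ (hsmall X n hn0 hX) (hsmall Y n hn0 hY) hXY' hL0
    have e2 := hadd _ _ (hsmall Y n hn0 hY) (hsmall X n hn0 hX) (by rwa [add_comm]) hL1
    rw [e1]
    refine Commute.mul_pow ?_ n
    rw [add_comm, e1] at e2
    exact e2
  have huniq : ∀ (γ : ℂ → G) X, (∀ s t, γ (s + t) = γ s * γ t) → ContinuousAt γ 0 →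
      (∀ t, ρ (γ t) = exp (t • L X)) → γ 1 = E X := by
    intro γ X hγ hγc hγρ
    have hγ0 : γ 0 = 1 := by
      have := hγ 0 0
      rw [add_zero] at this
      exact left_eq_mul.mp this
    have hγn : ∀ (n : ℕ) (t : ℂ), γ (n * t) = γ t ^ n := by
      intro n t
      induction n with
      | zero => simp [hγ0]
      | succ n ih =>
        rw [pow_succ, ← ih, ← hγ]
        congr 1
        push_cast
        ring
    have h1 : Tendsto (fun n : ℕ => ((n : ℂ)⁻¹)) atTop (𝓝 0) :=
      tendsto_inv_atTop_nhds_zero_nat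
    have h2 : ∀ᶠ n : ℕ in atTop, γ ((n : ℂ)⁻¹) ∈ W := by
      have h3 : W ∈ 𝓝 (γ 0) := by rwa [hγ0]
      exact (hγc.tendsto.comp h1).eventually h3
    -- For large `n` the point `γ (1 / n)` lies where `ρ` is injective, so it equals `e (X / n)`;
    -- the `n`-th power gives `γ 1`.
    obtain ⟨n, hn1, hn2, hn3⟩ :=
      (h2.and ((eventually_gt_atTop 0).and (eventually_gt_atTop ⌈‖X‖ / r⌉₊))).exists
    have hX : ‖X‖ < n * r := by
      rw [← div_lt_iff₀ hr]
      exact (Nat.le_ceil _).trans_lt (by exact_mod_cast hn3)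
    have hn0 : (n : ℂ) ≠ 0 := by exact_mod_cast hn2.ne'
    have e1 : γ ((n : ℂ)⁻¹) = e (((n : ℂ)⁻¹) • X) := by
      rw [← hWs1 _ hn1, hγρ, ← map_smul]
    have e2 := hγn n ((n : ℂ)⁻¹)
    rw [mul_inv_cancel₀ hn0] at e2
    rw [e2, e1, hEn X n hn2 hX]
  refine ⟨E, ⟨hEcont, hρE, hEadd, ?_, ?_, huniq⟩, ?_⟩
  · intro g X
    have hginv : ρ g * ρ g⁻¹ = 1 := by rw [← map_mul, mul_inv_cancel, map_one]
    have hginv' : ρ g⁻¹ * ρ g = 1 := by rw [← map_mul, inv_mul_cancel, map_one]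
    have h0 : E 0 = 1 := by rw [hEe 0 (by simpa using hr), he0]
    -- Equivariance comes from uniqueness: the conjugated one-parameter group has generator `ρ g X`.
    have h1 := huniq (fun t => g * E (t • X) * g⁻¹) (ρ g X) (fun t u => by
      have h2 : E ((t + u) • X) = E (t • X) * E (u • X) := by
        rw [add_smul, hEadd _ _ (hLsmul t u X)]
      simp only [h2]
      group) (by
      have : Continuous fun t : ℂ => g * E (t • X) * g⁻¹ := by fun_prop
      exact this.continuousAt) (fun t => by
      rw [map_mul, map_mul, hρE, ← exp_conj_of_inverse hginv hginv', (hρL g).conj_L hginv,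
        map_smul, map_smul])
    simpa using h1
  · intro U hU
    have hΦ : HasStrictFDerivAt (fun X => exp (L X))
        ((LinearMap.toContinuousLinearMap L).comp
          ((ContinuousLinearEquiv.refl ℂ H : H ≃L[ℂ] H) : H →L[ℂ] H)) 0 := by
      have h1 : HasStrictFDerivAt (exp : (H →L[ℂ] H) → _) (1 : (H →L[ℂ] H) →L[ℂ] _)
          (LinearMap.toContinuousLinearMap L (0 : H)) := by
        rw [map_zero]
        exact hasStrictFDerivAt_exp_zero
      exact (h1.comp (0 : H) (LinearMap.toContinuousLinearMap L).hasStrictFDerivAt)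
    obtain ⟨Ψ, D, hΨ1, -, -, -, hΨr, hΨc⟩ := C.exists_local_inverse _ hΦ (by simp)
      (Eventually.of_forall fun X => C.exp_isBracketHom X)
    have hρ1 : Tendsto ρ (𝓝 1) (𝓝 1) := by
      have := hρ.tendsto 1
      rwa [map_one] at this
    have h2 : Tendsto (fun g => Ψ (ρ g)) (𝓝 1) (𝓝 0) := by
      have := hΨc.self_of_nhds.tendsto
      rw [hΨ1] at this
      exact this.comp hρ1
    filter_upwards [h2.eventually hU, h2.eventually (Metric.ball_mem_nhds 0 hr),
      hρ1.eventually hΨr, hs.left_inv] with g hg1 hg2 hg3 hg4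
    refine ⟨Ψ (ρ g), hg1, ?_⟩
    rw [hEe _ (by simpa using hg2)]
    simp only [he]
    rw [hg3 (hρL g), hg4]
  · filter_upwards [Metric.ball_mem_nhds (0 : H) hr] with X hX
    exact hEe X (by simpa using hX)

end GroupExp

/-! ### The differential of the adjoint representation in a local group. -/

section LocalGroup

variable {E : Type*} [NormedAddCommGroup E] [NormedSpace ℂ E]

theorem eventually_fderiv_partial_right {f : E × E → E} {x y : E} (hf : ContDiffAt ℂ ω f (x, y)) :
    ∀ᶠ z in 𝓝 x, fderiv ℂ (fun w => f (z, w)) y =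
      (fderiv ℂ f (z, y)).comp (ContinuousLinearMap.inr ℂ E E) := by
  have h1 : ∀ᶠ p in 𝓝 (x, y), ContDiffAt ℂ ω f p := hf.eventually (by simp)
  have h2 : Tendsto (fun z : E => (z, y)) (𝓝 x) (𝓝 (x, y)) :=
    (Continuous.prodMk_left y).tendsto x
  filter_upwards [h2.eventually h1] with z hz
  exact ((hz.differentiableAt (by simp)).hasFDerivAt.comp y
    (hasFDerivAt_prodMk_right z y)).fderiv

/-- In a local group with multiplication `m` and conjugation `c`, the derivative of the adjoint
representation is the bracket of left invariant vector fields. -/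
theorem hasStrictFDerivAt_conj_of_local_group {m c : E × E → E} {e : E}
    (hm : ContDiffAt ℂ ω m (e, e)) (hc : ContDiffAt ℂ ω c (e, e))
    (hme : ∀ᶠ x in 𝓝 e, m (x, e) = x) (hce : ∀ᶠ x in 𝓝 e, c (x, e) = e)
    (hec : ∀ᶠ y in 𝓝 e, c (e, y) = y) (hcm : ∀ᶠ p in 𝓝 (e, e), m (c p, p.1) = m p) :
    ∃ D : E →L[ℂ] E →L[ℂ] E,
      HasStrictFDerivAt (fun x => fderiv ℂ (fun y => c (x, y)) e) D e ∧
      ∀ u v, D u v = fderiv ℂ (fun x => fderiv ℂ (fun y => m (x, y)) e v) e u -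
        fderiv ℂ (fun x => fderiv ℂ (fun y => m (x, y)) e u) e v := by
  set F : E → E →L[ℂ] E := fun x => fderiv ℂ (fun y => c (x, y)) e with hF
  have hdiag : ContinuousAt (fun z : E => (z, e)) e := (Continuous.prodMk_left e).continuousAt
  have hFs : ContDiffAt ℂ ω F e := by
    have h1 : ContDiffAt ℂ ω (fun z : E =>
        (fderiv ℂ c (z, e)).comp (ContinuousLinearMap.inr ℂ E E)) e := by
      have h2 : ContDiffAt ℂ ω (fderiv ℂ c) (e, e) := hc.fderiv_right (by simp)
      have h3 : ContDiffAt ℂ ω (fun z : E => (z, e)) e := by fun_prop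
      exact (ContDiffAt.comp (g := fderiv ℂ c) (f := fun z : E => (z, e)) e h2 h3).clm_comp
        contDiffAt_const
    exact h1.congr_of_eventuallyEq (eventually_fderiv_partial_right hc)
  have hFe : F e = ContinuousLinearMap.id ℂ E := by
    have : (fun y => c (e, y)) =ᶠ[𝓝 e] id := hec
    rw [hF]; simp only [this.fderiv_eq, fderiv_id]
  set S := fderiv ℂ (fderiv ℂ m) (e, e) with hS
  have hm2 : HasFDerivAt (fderiv ℂ m) S (e, e) :=
    ((hm.fderiv_right (m := ω) (by simp)).differentiableAt (by simp)).hasFDerivAt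
  have hb : ∀ w, HasFDerivAt (fun x => fderiv ℂ m (x, e) w)
      ((ContinuousLinearMap.apply ℂ E w).comp (S.comp (ContinuousLinearMap.inl ℂ E E))) e := by
    intro w
    exact (ContinuousLinearMap.apply ℂ E w).hasFDerivAt.comp e
      (HasFDerivAt.comp (f := fun z : E => (z, e)) e hm2 (hasFDerivAt_prodMk_left e e))
  have ha : ∀ w, HasFDerivAt (fun x => fderiv ℂ m (e, x) w)
      ((ContinuousLinearMap.apply ℂ E w).comp (S.comp (ContinuousLinearMap.inr ℂ E E))) e := by
    intro w
    exact (ContinuousLinearMap.apply ℂ E w).hasFDerivAt.comp e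
      (hm2.comp e (hasFDerivAt_prodMk_right e e))
  have hbm : ∀ v, HasFDerivAt (fun x => fderiv ℂ (fun y => m (x, y)) e v)
      ((ContinuousLinearMap.apply ℂ E ((0 : E), v)).comp
        (S.comp (ContinuousLinearMap.inl ℂ E E))) e := by
    intro v
    refine (hb (0, v)).congr_of_eventuallyEq ?_
    filter_upwards [eventually_fderiv_partial_right hm] with x hx
    rw [hx]; simp
  have hFd : HasFDerivAt F (fderiv ℂ F e) e := (hFs.differentiableAt (by simp)).hasFDerivAt
  refine ⟨fderiv ℂ F e, hFs.hasStrictFDerivAt (by simp), fun u v => ?_⟩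
  rw [(hbm v).fderiv, (hbm u).fderiv]
  -- the relation between the partial derivatives
  have hrel : ∀ᶠ x in 𝓝 e, fderiv ℂ m (e, x) (F x v, 0) = fderiv ℂ m (x, e) (0, v) := by
    have hm1 : ∀ᶠ p in 𝓝 (e, e), DifferentiableAt ℂ m p :=
      (hm.eventually (by simp)).mono fun p hp => hp.differentiableAt (by simp)
    have hc1 : ∀ᶠ p in 𝓝 (e, e), DifferentiableAt ℂ c p :=
      (hc.eventually (by simp)).mono fun p hp => hp.differentiableAt (by simp)
    have hd2 : ContinuousAt (fun z : E => (e, z)) e := (Continuous.prodMk_right e).continuousAt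
    filter_upwards [hdiag.eventually hm1, hd2.eventually hm1, hdiag.eventually hc1,
      hdiag.eventually hcm.eventually_nhds, hce] with x h1 h2 h3 h4 h5
    have h6 : HasFDerivAt (fun y => m (x, y))
        ((fderiv ℂ m (x, e)).comp (ContinuousLinearMap.inr ℂ E E)) e :=
      h1.hasFDerivAt.comp e (hasFDerivAt_prodMk_right x e)
    have h7 : HasFDerivAt (fun y => c (x, y)) (F x) e :=
      (h3.hasFDerivAt.comp e (hasFDerivAt_prodMk_right x e)).differentiableAt.hasFDerivAt
    have h8 : HasFDerivAt (fun y => (c (x, y), x)) ((F x).prod 0) e :=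
      h7.prodMk (hasFDerivAt_const x e)
    have h9 : HasFDerivAt (fun y => m (c (x, y), x)) ((fderiv ℂ m (e, x)).comp ((F x).prod 0)) e := by
      have h2' : HasFDerivAt m (fderiv ℂ m (e, x)) ((fun y => (c (x, y), x)) e) := by
        simp only [h5]; exact h2.hasFDerivAt
      exact h2'.comp e h8
    have h10 : (fun y => m (c (x, y), x)) =ᶠ[𝓝 e] fun y => m (x, y) := by
      have : Tendsto (fun y : E => (x, y)) (𝓝 e) (𝓝 (x, e)) :=
        (Continuous.prodMk_right x).tendsto e
      exact this.eventually h4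
    have h11 := h9.unique (h6.congr_of_eventuallyEq h10)
    simpa using congrArg (fun T : E →L[ℂ] E => T v) h11
  have hl : HasFDerivAt (fun x => fderiv ℂ m (e, x) (F x v, 0))
      ((fderiv ℂ m (e, e)).comp ((ContinuousLinearMap.inl ℂ E E).comp
          ((ContinuousLinearMap.apply ℂ E v).comp (fderiv ℂ F e))) +
        (S.comp (ContinuousLinearMap.inr ℂ E E)).flip (F e v, 0)) e := by
    have h1 : HasFDerivAt (fun x => fderiv ℂ m (e, x)) (S.comp (ContinuousLinearMap.inr ℂ E E)) e :=
      hm2.comp e (hasFDerivAt_prodMk_right e e)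
    have h2 : HasFDerivAt (fun x => ((F x v, 0) : E × E)) ((ContinuousLinearMap.inl ℂ E E).comp
          ((ContinuousLinearMap.apply ℂ E v).comp (fderiv ℂ F e))) e :=
      (ContinuousLinearMap.inl ℂ E E).hasFDerivAt.comp e
        ((ContinuousLinearMap.apply ℂ E v).hasFDerivAt.comp e hFd)
    exact h1.clm_apply h2
  -- In direction `u` this reads `D u v + S (0, u) (v, 0) = S (u, 0) (0, v)`, and symmetry of the
  -- second derivative `S` turns it into the bracket formula.
  have heq := hl.unique ((hb (0, v)).congr_of_eventuallyEq hrel)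
  have h1 := congrArg (fun T : E →L[ℂ] E => T u) heq
  have hme' : ∀ z, fderiv ℂ m (e, e) (z, 0) = z := by
    have h2 : HasFDerivAt (fun x => m (x, e))
        ((fderiv ℂ m (e, e)).comp (ContinuousLinearMap.inl ℂ E E)) e :=
      HasFDerivAt.comp (f := fun z : E => (z, e)) e
        (hm.differentiableAt (by simp)).hasFDerivAt (hasFDerivAt_prodMk_left e e)
    have h3 := h2.unique ((hasFDerivAt_id e).congr_of_eventuallyEq hme)
    intro z
    simpa using congrArg (fun T : E →L[ℂ] E => T z) h3
  have hsymm : S (0, u) (v, 0) = S (v, 0) (0, u) :=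
    (hm.isSymmSndFDerivAt_of_omega) (0, u) (v, 0)
  simp [hme', hFe] at h1
  simp only [ContinuousLinearMap.comp_apply, ContinuousLinearMap.apply_apply,
    ContinuousLinearMap.inl_apply]
  rw [← h1, ← hsymm]
  abel

end LocalGroup

/-! ### The adjoint representation and the Lie bracket in a chart at the identity. -/

section Chart

set_option linter.unusedSectionVars false

variable {E : Type*} [NormedAddCommGroup E] [NormedSpace ℂ E]
  (G : Type*) [TopologicalSpace G] [ChartedSpace E G] [Group G]

/-- Coordinates near the identity of `G`. -/
noncomputable abbrev unitChart : PartialEquiv G E := extChartAt 𝓘(ℂ, E) (1 : G)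

/-- The group multiplication in coordinates near the identity. -/
noncomputable def chartMul (p : E × E) : E :=
  unitChart G ((unitChart G).symm p.1 * (unitChart G).symm p.2)

/-- Conjugation `(x, y) ↦ x y x⁻¹` in coordinates near the identity. -/
noncomputable def chartConj (p : E × E) : E :=
  unitChart G ((unitChart G).symm p.1 * (unitChart G).symm p.2 * ((unitChart G).symm p.1)⁻¹)

variable {G}

theorem unitChart_symm_one : (unitChart (E := E) G).symm (unitChart G 1) = 1 :=
  extChartAt_to_inv (I := 𝓘(ℂ, E)) (1 : G)

/-- The adjoint action of `g`, computed in coordinates near the identity. -/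
noncomputable def adChart (g : G) : E →L[ℂ] E :=
  fderiv ℂ (fun y : E => unitChart G (g * (unitChart G).symm y * g⁻¹)) (unitChart G 1)

variable [LieGroup 𝓘(ℂ, E) ω G]

theorem contMDiffAt_unitChart_symm :
    ContMDiffAt 𝓘(ℂ, E) 𝓘(ℂ, E) ω (unitChart (E := E) G).symm (unitChart G 1) :=
  (contMDiffOn_extChartAt_symm (I := 𝓘(ℂ, E)) (n := ω) (1 : G)).contMDiffAt
    (extChartAt_target_mem_nhds (I := 𝓘(ℂ, E)) (1 : G))

theorem contMDiffAt_unitChart : ContMDiffAt 𝓘(ℂ, E) 𝓘(ℂ, E) ω (unitChart (E := E) G) 1 :=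
  contMDiffAt_extChartAt

theorem contDiffAt_chart_comp {F : Type*} [NormedAddCommGroup F] [NormedSpace ℂ F] {f : F → G}
    {x : F} (hf : ContMDiffAt 𝓘(ℂ, F) 𝓘(ℂ, E) ω f x) (hx : f x = 1) :
    ContDiffAt ℂ ω (fun y => unitChart (E := E) G (f y)) x := by
  rw [← contMDiffAt_iff_contDiffAt]
  have h : ContMDiffAt 𝓘(ℂ, E) 𝓘(ℂ, E) ω (unitChart (E := E) G) (f x) := by
    rw [hx]; exact contMDiffAt_unitChart
  exact h.comp x hf

theorem contMDiffAt_symm_fst : ContMDiffAt 𝓘(ℂ, E × E) 𝓘(ℂ, E) ω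
    (fun p : E × E => (unitChart G).symm p.1) (unitChart G 1, unitChart G 1) :=
  ContMDiffAt.comp (g := (unitChart (E := E) G).symm) (f := Prod.fst)
    (unitChart (E := E) G 1, unitChart (E := E) G 1) contMDiffAt_unitChart_symm
    contDiff_fst.contMDiff.contMDiffAt

theorem contMDiffAt_symm_snd : ContMDiffAt 𝓘(ℂ, E × E) 𝓘(ℂ, E) ω
    (fun p : E × E => (unitChart G).symm p.2) (unitChart G 1, unitChart G 1) :=
  ContMDiffAt.comp (g := (unitChart (E := E) G).symm) (f := Prod.snd)
    (unitChart (E := E) G 1, unitChart (E := E) G 1) contMDiffAt_unitChart_symm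
    contDiff_snd.contMDiff.contMDiffAt

theorem contDiffAt_chartMul :
    ContDiffAt ℂ ω (chartMul (E := E) G) (unitChart G 1, unitChart G 1) :=
  contDiffAt_chart_comp (contMDiffAt_symm_fst.mul contMDiffAt_symm_snd) (by
    simp only [unitChart_symm_one, mul_one])

theorem contDiffAt_chartConj :
    ContDiffAt ℂ ω (chartConj (E := E) G) (unitChart G 1, unitChart G 1) :=
  contDiffAt_chart_comp ((contMDiffAt_symm_fst.mul contMDiffAt_symm_snd).mul
    contMDiffAt_symm_fst.inv) (by
    simp only [unitChart_symm_one, mul_one, inv_one])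

theorem contMDiffAt_conj (g : G) :
    ContMDiffAt 𝓘(ℂ, E) 𝓘(ℂ, E) ω (fun h : G => g * h * g⁻¹) 1 :=
  ((contMDiffAt_const (I := 𝓘(ℂ, E)) (I' := 𝓘(ℂ, E)) (c := g)).mul contMDiffAt_id).mul
    (contMDiffAt_const (I := 𝓘(ℂ, E)) (I' := 𝓘(ℂ, E)) (c := g⁻¹))

theorem contDiffAt_conj (g : G) :
    ContDiffAt ℂ ω (fun y : E => unitChart (E := E) G (g * (unitChart (E := E) G).symm y * g⁻¹))
      (unitChart (E := E) G 1) := by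
  refine contDiffAt_chart_comp (f := fun y : E => g * (unitChart (E := E) G).symm y * g⁻¹) ?_ (by
    simp only [unitChart_symm_one, mul_one, mul_inv_cancel])
  refine ContMDiffAt.comp (g := fun h : G => g * h * g⁻¹) (f := (unitChart (E := E) G).symm)
    (unitChart (E := E) G 1) ?_ contMDiffAt_unitChart_symm
  rw [unitChart_symm_one]
  exact contMDiffAt_conj g

theorem lieAd_eq_adChart (g : G) (X : GroupLieAlgebra 𝓘(ℂ, E) G) :
    lieAd g X = adChart (E := E) g X := by
  have h1 : MDifferentiableAt 𝓘(ℂ, E) 𝓘(ℂ, E) (fun h : G => g * h * g⁻¹) 1 :=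
    (contMDiffAt_conj g).mdifferentiableAt (by simp)
  have h3 : fderivWithin ℂ (writtenInExtChartAt 𝓘(ℂ, E) 𝓘(ℂ, E) (1 : G)
      (fun h : G => g * h * g⁻¹)) (Set.range 𝓘(ℂ, E)) (unitChart (E := E) G 1) =
      adChart (E := E) g := by
    have h2 : g * 1 * g⁻¹ = 1 := by simp
    simp only [writtenInExtChartAt, h2, ModelWithCorners.range_eq_univ, fderivWithin_univ]
    rfl
  have h4 := h1.mfderiv.trans h3
  exact congrArg (fun D : E →L[ℂ] E => D X) h4

theorem eventually_chart_symm_chart :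
    ∀ᶠ g in 𝓝 (1 : G), (unitChart (E := E) G).symm (unitChart G g) = g :=
  Filter.eventually_of_mem (extChartAt_source_mem_nhds (I := 𝓘(ℂ, E)) (1 : G))
    fun _ hg => (unitChart G).left_inv hg

theorem eventually_chart_chart_symm :
    ∀ᶠ x in 𝓝 (unitChart (E := E) G 1), unitChart G ((unitChart (E := E) G).symm x) = x :=
  Filter.eventually_of_mem (extChartAt_target_mem_nhds (I := 𝓘(ℂ, E)) (1 : G))
    fun _ hg => (unitChart G).right_inv hg

theorem continuousAt_unitChart_symm :
    ContinuousAt (unitChart (E := E) G).symm (unitChart G 1) :=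
  contMDiffAt_unitChart_symm.continuousAt

theorem tendsto_unitChart_symm :
    Tendsto (unitChart (E := E) G).symm (𝓝 (unitChart G 1)) (𝓝 1) := by
  have := continuousAt_unitChart_symm (E := E) (G := G)
  rwa [ContinuousAt, unitChart_symm_one] at this

theorem hasFDerivAt_adChart (g : G) :
    HasFDerivAt (fun y : E => unitChart G (g * (unitChart G).symm y * g⁻¹)) (adChart g)
      (unitChart G 1) :=
  ((contDiffAt_conj g).differentiableAt (by simp)).hasFDerivAt

theorem adChart_one : adChart (E := E) (1 : G) = 1 := by
  refine (hasFDerivAt_adChart (E := E) (1 : G)).unique ?_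
  refine (hasFDerivAt_id (𝕜 := ℂ) (unitChart (E := E) G 1)).congr_of_eventuallyEq ?_
  filter_upwards [eventually_chart_chart_symm (E := E) (G := G)] with x hx
  simp only [one_mul, inv_one, mul_one, hx, id]

theorem adChart_mul (g h : G) : adChart (E := E) (g * h) = adChart g * adChart h := by
  refine (hasFDerivAt_adChart (E := E) (g * h)).unique ?_
  have h1 := hasFDerivAt_adChart (E := E) h
  have h2 := hasFDerivAt_adChart (E := E) g
  have h0 : unitChart (E := E) G (h * (unitChart (E := E) G).symm (unitChart G 1) * h⁻¹) =
      unitChart G 1 := by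
    rw [unitChart_symm_one, mul_one, mul_inv_cancel]
  have htc : Tendsto (fun k : G => h * k * h⁻¹) (𝓝 1) (𝓝 1) := by
    have := (contMDiffAt_conj (E := E) h).continuousAt
    rwa [ContinuousAt, mul_one, mul_inv_cancel] at this
  rw [← h0] at h2
  refine (HasFDerivAt.comp (f := fun y : E => unitChart (E := E) G
    (h * (unitChart (E := E) G).symm y * h⁻¹)) _ h2 h1).congr_of_eventuallyEq ?_
  have h3 := (tendsto_unitChart_symm (E := E) (G := G)).eventually
    (htc.eventually (eventually_chart_symm_chart (E := E) (G := G)))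
  filter_upwards [h3] with x hx
  simp only [Function.comp_apply, hx]
  simp only [mul_inv_rev, mul_assoc]

/-- The left invariant vector field of `v` in coordinates near the identity. -/
theorem mpullback_mulInvariantVectorField_chart (v : GroupLieAlgebra 𝓘(ℂ, E) G) :
    ∀ᶠ x in 𝓝 (unitChart (E := E) G 1),
      VectorField.mpullbackWithin 𝓘(ℂ, E) 𝓘(ℂ, E) (unitChart (E := E) G).symm
        (mulInvariantVectorField v) (Set.range 𝓘(ℂ, E)) x =
      fderiv ℂ (fun y : E => chartMul G (x, y)) (unitChart G 1) (v : E) := by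
  filter_upwards [extChartAt_target_mem_nhds (I := 𝓘(ℂ, E)) (1 : G)] with x hx
  have : IsManifold 𝓘(ℂ, E) 1 G := IsManifold.of_le (n := ω) (by simp)
  have hinv := ContinuousLinearMap.inverse_eq
    (mfderivWithin_extChartAt_symm_comp_mfderiv_extChartAt (I := 𝓘(ℂ, E)) hx)
    (mfderiv_extChartAt_comp_mfderivWithin_extChartAt_symm (I := 𝓘(ℂ, E)) hx)
  set g := (unitChart (E := E) G).symm x with hg
  have hgs : g ∈ (chartAt E (1 : G)).source := by
    rw [← extChartAt_source (I := 𝓘(ℂ, E))]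
    exact (unitChart (E := E) G).map_target hx
  have hd1 : MDifferentiableAt 𝓘(ℂ, E) 𝓘(ℂ, E) (unitChart (E := E) G) g :=
    mdifferentiableAt_extChartAt hgs
  have hd2 : MDifferentiableAt 𝓘(ℂ, E) 𝓘(ℂ, E) (fun h : G => g * h) 1 :=
    (contMDiff_mul_left (n := ω)).contMDiffAt.mdifferentiableAt (by simp)
  have hcomp := mfderiv_comp_of_eq (I' := 𝓘(ℂ, E)) (x := (1 : G)) (g := unitChart (E := E) G)
    hd1 hd2 (mul_one g)
  have hd3 : MDifferentiableAt 𝓘(ℂ, E) 𝓘(ℂ, E) (unitChart (E := E) G ∘ fun h : G => g * h) 1 :=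
    MDifferentiableAt.comp_of_eq (1 : G) hd1 hd2 (mul_one g)
  have h4 : fderivWithin ℂ (writtenInExtChartAt 𝓘(ℂ, E) 𝓘(ℂ, E) (1 : G)
      (unitChart (E := E) G ∘ fun h : G => g * h)) (Set.range 𝓘(ℂ, E)) (unitChart (E := E) G 1) =
      fderiv ℂ (fun y : E => chartMul G (x, y)) (unitChart G 1) := by
    simp only [writtenInExtChartAt, ModelWithCorners.range_eq_univ, fderivWithin_univ]
    rfl
  have h5 := hcomp.symm.trans (hd3.mfderiv.trans h4)
  have h6 : mfderiv 𝓘(ℂ, E) 𝓘(ℂ, E) (unitChart (E := E) G) g =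
      (mfderivWithin 𝓘(ℂ, E) 𝓘(ℂ, E) (unitChart (E := E) G).symm
        (Set.range 𝓘(ℂ, E)) x).inverse := hinv.symm
  have h7 : ∀ k : G, k = g → (mfderiv 𝓘(ℂ, E) 𝓘(ℂ, E) (unitChart (E := E) G) k : E →L[ℂ] E) =
      mfderiv 𝓘(ℂ, E) 𝓘(ℂ, E) (unitChart (E := E) G) g := by
    rintro _ rfl
    rfl
  exact (congrArg (fun D : E →L[ℂ] E => D (mulInvariantVectorField v g)) h6.symm).trans
    ((congrArg (fun D : E →L[ℂ] E => D (mulInvariantVectorField v g))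
      (h7 (g * 1) (mul_one g)).symm).trans (congrArg (fun D : E →L[ℂ] E => D v) h5))

/-- The bracket is that of left invariant vector fields at `1`. The chart has identity derivative
there, and in it the field of `v` is the partial derivative of the multiplication in its second
variable. -/
theorem bracket_eq_fderiv_chartMul (u v : GroupLieAlgebra 𝓘(ℂ, E) G) :
    (⁅u, v⁆ : GroupLieAlgebra 𝓘(ℂ, E) G) =
      fderiv ℂ (fun x => fderiv ℂ (fun y : E => chartMul G (x, y)) (unitChart G 1) (v : E))
        (unitChart G 1) (u : E) -
      fderiv ℂ (fun x => fderiv ℂ (fun y : E => chartMul G (x, y)) (unitChart G 1) (u : E))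
        (unitChart G 1) (v : E) := by
  have : IsManifold 𝓘(ℂ, E) 1 G := IsManifold.of_le (n := ω) (by simp)
  have hm : mfderiv 𝓘(ℂ, E) 𝓘(ℂ, E) (unitChart (E := E) G) (1 : G) =
      ContinuousLinearMap.id ℂ E := mfderiv_extChartAt_self (I := 𝓘(ℂ, E)) (x := (1 : G))
  have hm' : (mfderiv 𝓘(ℂ, E) 𝓘(ℂ, E) (unitChart (E := E) G) (1 : G)).inverse =
      ContinuousLinearMap.id ℂ E :=
    (congrArg (fun D : E →L[ℂ] E => D.inverse) hm).trans
      (ContinuousLinearMap.inverse_id (R := ℂ) (M := E))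
  have hset : (unitChart (E := E) G).symm ⁻¹' Set.univ ∩ Set.range 𝓘(ℂ, E) = Set.univ := by
    simp
  have h1 := Filter.EventuallyEq.lieBracket_vectorField_eq (𝕜 := ℂ) (E := E)
    (mpullback_mulInvariantVectorField_chart u) (mpullback_mulInvariantVectorField_chart v)
  have h2 : (⁅u, v⁆ : GroupLieAlgebra 𝓘(ℂ, E) G) = VectorField.lieBracketWithin ℂ
      (VectorField.mpullbackWithin 𝓘(ℂ, E) 𝓘(ℂ, E) (unitChart (E := E) G).symm
        (mulInvariantVectorField u) (Set.range 𝓘(ℂ, E)))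
      (VectorField.mpullbackWithin 𝓘(ℂ, E) 𝓘(ℂ, E) (unitChart (E := E) G).symm
        (mulInvariantVectorField v) (Set.range 𝓘(ℂ, E)))
      ((unitChart (E := E) G).symm ⁻¹' Set.univ ∩ Set.range 𝓘(ℂ, E)) (unitChart (E := E) G 1) :=
    congrArg (fun D : E →L[ℂ] E => D _) hm'
  rw [hset] at h2
  have huniv : ∀ (V W : E → E) (x : E),
      VectorField.lieBracketWithin ℂ V W Set.univ x = VectorField.lieBracket ℂ V W x := by
    intro V W x
    rw [VectorField.lieBracketWithin_univ]
  refine h2.trans ((huniv _ _ _).trans (h1.trans ?_))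
  have h3 : ∀ w : E, fderiv ℂ (fun y : E => chartMul G (unitChart (E := E) G 1, y))
      (unitChart G 1) w = w := by
    intro w
    have : (fun y : E => chartMul G (unitChart (E := E) G 1, y)) =ᶠ[𝓝 (unitChart G 1)] id := by
      filter_upwards [eventually_chart_chart_symm (E := E) (G := G)] with y hy
      simp only [chartMul, unitChart_symm_one, one_mul, hy, id]
    rw [this.fderiv_eq, fderiv_id]; rfl
  exact congrArg₂ (fun a b : E =>
    fderiv ℂ (fun x => fderiv ℂ (fun y : E => chartMul G (x, y)) (unitChart G 1) (v : E))
        (unitChart G 1) a -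
      fderiv ℂ (fun x => fderiv ℂ (fun y : E => chartMul G (x, y)) (unitChart G 1) (u : E))
        (unitChart G 1) b) (h3 u) (h3 v)

/-- This is `d(Ad) = ad`; the local group relation behind it is `(x y x⁻¹) x = x y`. -/
theorem hasStrictFDerivAt_adChart :
    ∃ D : E →L[ℂ] E →L[ℂ] E, HasStrictFDerivAt (fun x => adChart ((unitChart (E := E) G).symm x)) D
        (unitChart G 1) ∧
      ∀ u v : GroupLieAlgebra 𝓘(ℂ, E) G,
        D (u : E) (v : E) = (⁅u, v⁆ : GroupLieAlgebra 𝓘(ℂ, E) G) := by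
  have := topologicalGroup_of_lieGroup 𝓘(ℂ, E) ω (G := G)
  have h2 : Tendsto (fun p : E × E => ((unitChart (E := E) G).symm p.1,
      (unitChart (E := E) G).symm p.2)) (𝓝 (unitChart G 1, unitChart G 1)) (𝓝 (1, 1)) := by
    rw [nhds_prod_eq, nhds_prod_eq]
    exact tendsto_unitChart_symm.prodMap tendsto_unitChart_symm
  obtain ⟨D, hD, hDb⟩ := hasStrictFDerivAt_conj_of_local_group (m := chartMul (E := E) G)
    (c := chartConj (E := E) G) (e := unitChart G 1) contDiffAt_chartMul contDiffAt_chartConj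
    (by
      filter_upwards [eventually_chart_chart_symm (E := E) (G := G)] with y hy
      simp only [chartMul, unitChart_symm_one, mul_one, hy])
    (by
      refine Filter.Eventually.of_forall fun x => ?_
      simp only [chartConj, unitChart_symm_one, mul_one, mul_inv_cancel])
    (by
      filter_upwards [eventually_chart_chart_symm (E := E) (G := G)] with y hy
      simp only [chartConj, unitChart_symm_one, one_mul, inv_one, mul_one, hy])
    (by
      have hc : ContinuousAt (fun q : G × G => q.1 * q.2 * q.1⁻¹) (1, 1) := by fun_prop
      have h1 := h2.eventually (hc.eventually (p := fun g =>
        (unitChart (E := E) G).symm (unitChart G g) = g)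
        (by simpa using eventually_chart_symm_chart (E := E) (G := G)))
      filter_upwards [h1] with p hp
      simp only [chartMul, chartConj, hp, inv_mul_cancel_right])
  refine ⟨D, hD, fun u v => ?_⟩
  exact (hDb u v).trans (bracket_eq_fderiv_chartMul u v).symm

theorem continuous_adChart : Continuous (adChart (E := E) : G → E →L[ℂ] E) := by
  have := topologicalGroup_of_lieGroup 𝓘(ℂ, E) ω (G := G)
  have h1 : ContinuousAt (adChart (E := E) : G → E →L[ℂ] E) 1 := by
    obtain ⟨D, hD, -⟩ := hasStrictFDerivAt_adChart (E := E) (G := G)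
    have h2 := ContinuousAt.comp (f := unitChart (E := E) G) (x := (1 : G))
      hD.continuousAt (continuousAt_extChartAt (I := 𝓘(ℂ, E)) (1 : G))
    refine h2.congr ?_
    filter_upwards [eventually_chart_symm_chart (E := E) (G := G)] with g hg
    simp only [Function.comp_apply, hg]
  refine continuous_iff_continuousAt.2 fun g => ?_
  have h2 : (adChart (E := E) : G → E →L[ℂ] E) = fun h => adChart g * adChart (g⁻¹ * h) := by
    funext h
    rw [← adChart_mul, mul_inv_cancel_left]
  rw [h2]
  refine continuousAt_const.mul ?_
  have h3 : ContinuousAt (fun h : G => g⁻¹ * h) g := by fun_prop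
  refine ContinuousAt.comp (g := (adChart (E := E) : G → E →L[ℂ] E)) ?_ h3
  simpa using h1

/-- Differentiate `Ad(g x g⁻¹) Ad(g) = Ad(g) Ad(x)` at `x = 1` and use `d(Ad) = ad`. -/
theorem lieAd_lie (g : G) (X Y : GroupLieAlgebra 𝓘(ℂ, E) G) :
    lieAd g ⁅X, Y⁆ = (⁅lieAd g X, lieAd g Y⁆ : GroupLieAlgebra 𝓘(ℂ, E) G) := by
  have := topologicalGroup_of_lieGroup 𝓘(ℂ, E) ω (G := G)
  obtain ⟨D, hD, hDb⟩ := hasStrictFDerivAt_adChart (E := E) (G := G)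
  have h0 : unitChart (E := E) G (g * (unitChart (E := E) G).symm (unitChart G 1) * g⁻¹) =
      unitChart G 1 := by
    rw [unitChart_symm_one, mul_one, mul_inv_cancel]
  have h1 : HasFDerivAt (fun x => adChart ((unitChart (E := E) G).symm
      (unitChart (E := E) G (g * (unitChart (E := E) G).symm x * g⁻¹))))
      (D.comp (adChart g)) (unitChart G 1) := by
    have h2 := hD.hasFDerivAt
    rw [← h0] at h2
    exact HasFDerivAt.comp (f := fun y : E => unitChart (E := E) G
      (g * (unitChart (E := E) G).symm y * g⁻¹)) _ h2 (hasFDerivAt_adChart g)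
  have htc : Tendsto (fun k : G => g * k * g⁻¹) (𝓝 1) (𝓝 1) := by
    have : ContinuousAt (fun k : G => g * k * g⁻¹) 1 := by fun_prop
    simpa [ContinuousAt] using this
  have h3 : HasFDerivAt (fun x => adChart ((unitChart (E := E) G).symm
      (unitChart (E := E) G (g * (unitChart (E := E) G).symm x * g⁻¹))) * adChart g)
      ((ContinuousLinearMap.mul ℂ (E →L[ℂ] E)).flip (adChart g) ∘L (D.comp (adChart g)))
      (unitChart G 1) :=
    ((ContinuousLinearMap.mul ℂ (E →L[ℂ] E)).flip (adChart g)).hasFDerivAt.comp _ h1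
  have h4 : HasFDerivAt (fun x => adChart g * adChart ((unitChart (E := E) G).symm x))
      (ContinuousLinearMap.mul ℂ (E →L[ℂ] E) (adChart g) ∘L D) (unitChart G 1) :=
    (ContinuousLinearMap.mul ℂ (E →L[ℂ] E) (adChart g)).hasFDerivAt.comp _ hD.hasFDerivAt
  have h5 := h4.unique (h3.congr_of_eventuallyEq (by
    filter_upwards [(tendsto_unitChart_symm (E := E) (G := G)).eventually
      (htc.eventually (eventually_chart_symm_chart (E := E) (G := G)))] with x hx
    rw [hx, ← adChart_mul, ← adChart_mul, inv_mul_cancel_right]))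
  have h6 := congrArg (fun T : E →L[ℂ] E →L[ℂ] E => T X Y) h5
  have h7 : adChart g (D X Y) = D (adChart g X) (adChart g Y) := h6
  have h8 : (⁅lieAd g X, lieAd g Y⁆ : GroupLieAlgebra 𝓘(ℂ, E) G) =
      D (adChart g X) (adChart g Y) :=
    (hDb (lieAd g X) (lieAd g Y)).symm.trans
      (congrArg₂ (fun u v : E => D u v) (lieAd_eq_adChart g X) (lieAd_eq_adChart g Y))
  exact (lieAd_eq_adChart g _).trans
    ((congrArg (adChart (E := E) g) (hDb X Y).symm).trans (h7.trans h8.symm))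

end Chart

/-! ### The Killing form and the Hilbert space model of the Lie algebra. -/

section LieAlgebra

variable {𝔤 : Type*} [LieRing 𝔤] [LieAlgebra ℂ 𝔤] [Module.Finite ℂ 𝔤]
  {σ θ : 𝔤 →ₛₗ[starRingEnd ℂ] 𝔤}

/-- In the basis `σ (b i)` the matrix of `T' = σ T σ` is the complex conjugate of the matrix of `T`
in the basis `b`. -/
theorem trace_eq_conj_of_antilinear (hσ : ∀ X, σ (σ X) = X) {T T' : Module.End ℂ 𝔤}
    (h : ∀ X, T' (σ X) = σ (T X)) :
    LinearMap.trace ℂ 𝔤 T' = starRingEnd ℂ (LinearMap.trace ℂ 𝔤 T) := by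
  let b := Module.finBasis ℂ 𝔤
  let ε : 𝔤 ≃ₗ[ℂ] (Fin (Module.finrank ℂ 𝔤) → ℂ) :=
    { toFun := fun X i => starRingEnd ℂ (b.equivFun (σ X) i)
      map_add' := fun X Y => by ext i; simp
      map_smul' := fun c X => by ext i; simp
      invFun := fun v => σ (b.equivFun.symm fun i => starRingEnd ℂ (v i))
      left_inv := fun X => by
        simp only [Complex.conj_conj]
        exact (congrArg σ (b.equivFun.symm_apply_apply (σ X))).trans (hσ X)
      right_inv := fun v => by
        ext i
        simp only [hσ, LinearEquiv.apply_symm_apply, Complex.conj_conj] }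
  let b' : Module.Basis (Fin (Module.finrank ℂ 𝔤)) ℂ 𝔤 := Module.Basis.ofEquivFun ε
  have hb' : ∀ i, b' i = σ (b i) := by
    intro i
    apply ε.injective
    have h1 : ε (b' i) = Pi.single i 1 := by
      simp [b', Module.Basis.coe_ofEquivFun]
    rw [h1]
    ext j
    change _ = starRingEnd ℂ (b.equivFun (σ (σ (b i))) j)
    rw [hσ, Module.Basis.equivFun_self]
    by_cases hij : i = j <;> simp [hij, eq_comm]
  rw [LinearMap.trace_eq_matrix_trace ℂ b', LinearMap.trace_eq_matrix_trace ℂ b]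
  simp only [Matrix.trace, Matrix.diag, LinearMap.toMatrix_apply, map_sum]
  refine Finset.sum_congr rfl fun i _ => ?_
  rw [hb', h]
  change ε (σ (T (b i))) i = _
  change starRingEnd ℂ (b.equivFun (σ (σ (T (b i)))) i) = _
  rw [hσ]
  rfl

theorem IsConjugation.killingForm_apply (hσ : IsConjugation σ) (X Y : 𝔤) :
    killingForm ℂ 𝔤 (σ X) (σ Y) = starRingEnd ℂ (killingForm ℂ 𝔤 X Y) := by
  rw [killingForm_apply_apply, killingForm_apply_apply]
  refine trace_eq_conj_of_antilinear hσ.involutive fun Z => ?_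
  simp only [LinearMap.comp_apply, LieAlgebra.ad_apply, hσ.map_lie]

theorem IsConjugation.killingForm_right (hσ : IsConjugation σ) (X Y : 𝔤) :
    killingForm ℂ 𝔤 X (σ Y) = starRingEnd ℂ (killingForm ℂ 𝔤 (σ X) Y) := by
  rw [← hσ.killingForm_apply, hσ.involutive]

/-- Definiteness of `B(X, θ X)` forces the Killing form to be nondegenerate, which makes every
derivation inner. -/
theorem IsCartanInvolution.isKilling (hθ : IsCartanInvolution θ) :
    LieAlgebra.IsKilling ℂ 𝔤 where
  killingCompl_top_eq_bot := by
    rw [LieSubmodule.eq_bot_iff]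
    intro X hX
    by_contra h
    have h1 := hθ.neg_re_killing X h
    rw [LieIdeal.mem_killingCompl] at hX
    have h2 := hX (θ X) trivial
    rw [LieModule.traceForm_comm] at h2
    rw [h2] at h1
    simp at h1

/-- The inner product `-B(Y, θ X)`, in an orthonormal basis. -/
theorem IsCartanInvolution.exists_coordinates (hθ : IsCartanInvolution θ) :
    ∃ e : 𝔤 ≃ₗ[ℂ] EuclideanSpace ℂ (Fin (Module.finrank ℂ 𝔤)),
      ∀ X Y, inner ℂ (e X) (e Y) = -killingForm ℂ 𝔤 Y (θ X) := by
  let core : InnerProductSpace.Core ℂ 𝔤 :=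
    { inner := fun X Y => -killingForm ℂ 𝔤 Y (θ X)
      conj_inner_symm := fun X Y => by
        change starRingEnd ℂ (-killingForm ℂ 𝔤 X (θ Y)) = -killingForm ℂ 𝔤 Y (θ X)
        rw [map_neg, hθ.killingForm_right, Complex.conj_conj, LieModule.traceForm_comm]
      re_inner_nonneg := fun X => by
        change 0 ≤ (-killingForm ℂ 𝔤 X (θ X)).re
        by_cases h : X = 0
        · simp [h]
        · have := hθ.neg_re_killing X h
          rw [Complex.neg_re]
          linarith
      add_left := fun X Y Z => by
        change -killingForm ℂ 𝔤 Z (θ (X + Y)) = -killingForm ℂ 𝔤 Z (θ X) + -killingForm ℂ 𝔤 Z (θ Y)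
        rw [map_add, map_add]
        ring
      smul_left := fun X Y c => by
        change -killingForm ℂ 𝔤 Y (θ (c • X)) = starRingEnd ℂ c * -killingForm ℂ 𝔤 Y (θ X)
        rw [map_smulₛₗ, map_smul, smul_eq_mul]
        ring
      definite := fun X h => by
        change -killingForm ℂ 𝔤 X (θ X) = 0 at h
        by_contra hX
        have := hθ.neg_re_killing X hX
        rw [neg_eq_zero] at h
        rw [h] at this
        simp at this }
  let : NormedAddCommGroup 𝔤 := core.toNormedAddCommGroup
  let : InnerProductSpace ℂ 𝔤 := InnerProductSpace.ofCore core.toCore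
  refine ⟨(stdOrthonormalBasis ℂ 𝔤).repr.toLinearEquiv, fun X Y => ?_⟩
  exact (stdOrthonormalBasis ℂ 𝔤).repr.inner_map_map X Y

/-- The Lie algebra data, transported to a Hilbert space. -/
structure IsCartanModel {H : Type*} [NormedAddCommGroup H] [InnerProductSpace ℂ H]
    [FiniteDimensional ℂ H] (σ θ : 𝔤 →ₛₗ[starRingEnd ℂ] 𝔤) (e : 𝔤 ≃ₗ[ℂ] H)
    (L : H →ₗ[ℂ] (H →L[ℂ] H)) (σ' θ' : H →ₛₗ[starRingEnd ℂ] H) : Prop where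
  map_lie : ∀ X Y, L (e X) (e Y) = e ⁅X, Y⁆
  map_σ : ∀ X, σ' (e X) = e (σ X)
  map_θ : ∀ X, θ' (e X) = e (θ X)
  cartanData : CartanData L σ' θ'

/-- For the inner product `-B(Y, θ X)`, invariance of `B` under `ad` gives `(ad X)* = -ad (θ X)`,
and invariance under automorphisms gives `a* = θ a⁻¹ θ`. -/
theorem exists_isCartanModel (hσ : IsConjugation σ) (hθ : IsCartanInvolution θ)
    (hσθ : ∀ X, σ (θ X) = θ (σ X)) :
    ∃ (e : 𝔤 ≃ₗ[ℂ] EuclideanSpace ℂ (Fin (Module.finrank ℂ 𝔤))) (L : _) (σ' θ' : _),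
      IsCartanModel σ θ e L σ' θ' := by
  obtain ⟨e, he⟩ := hθ.exists_coordinates
  have := hθ.isKilling
  let H := EuclideanSpace ℂ (Fin (Module.finrank ℂ 𝔤))
  let L : H →ₗ[ℂ] (H →L[ℂ] H) :=
    { toFun := fun X => LinearMap.toContinuousLinearMap
        (e.toLinearMap ∘ₗ (LieAlgebra.ad ℂ 𝔤 (e.symm X)) ∘ₗ e.symm.toLinearMap)
      map_add' := fun X Y => by ext1 Z; simp
      map_smul' := fun c X => by ext1 Z; simp }
  have hL : ∀ X Y, L X Y = e ⁅e.symm X, e.symm Y⁆ := fun X Y => rfl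
  let σ' : H →ₛₗ[starRingEnd ℂ] H := e.toLinearMap.comp (σ.comp e.symm.toLinearMap)
  let θ' : H →ₛₗ[starRingEnd ℂ] H := e.toLinearMap.comp (θ.comp e.symm.toLinearMap)
  have hσ' : ∀ X, σ' X = e (σ (e.symm X)) := fun X => rfl
  have hθ' : ∀ X, θ' X = e (θ (e.symm X)) := fun X => rfl
  have hin : ∀ X Y : H, inner ℂ X Y = -killingForm ℂ 𝔤 (e.symm Y) (θ (e.symm X)) := fun X Y => by
    rw [← he, e.apply_symm_apply, e.apply_symm_apply]
  refine ⟨e, L, σ', θ', fun X Y => by simp [hL], fun X => by simp [hσ'], fun X => by simp [hθ'], ?_⟩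
  constructor
  · intro X Y
    rw [hL, hL, ← lie_skew, map_neg]
  · intro X Y
    ext1 Z
    rw [sub_apply]
    simp only [mul_apply_eq_comp, hL, e.symm_apply_apply, lie_lie, map_sub]
  · intro X Y h
    have h1 : LieAlgebra.ad ℂ 𝔤 (e.symm X) = LieAlgebra.ad ℂ 𝔤 (e.symm Y) := by
      ext Z
      have := congrArg (fun T : H →L[ℂ] H => T (e Z)) h
      simp only [hL, e.symm_apply_apply] at this
      exact e.injective this
    have h2 := sub_eq_zero.2 h1
    rw [← map_sub] at h2
    have h3 : e.symm X - e.symm Y = 0 := by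
      by_contra h4
      have h5 := hθ.neg_re_killing _ h4
      rw [killingForm_apply_apply, h2] at h5
      simp at h5
    exact e.symm.injective (sub_eq_zero.1 h3)
  · intro D hD
    let D' : LieDerivation ℂ 𝔤 𝔤 :=
      { toLinearMap := e.symm.toLinearMap ∘ₗ (D : H →ₗ[ℂ] H) ∘ₗ e.toLinearMap
        leibniz' := fun X Y => by
          have := hD (e X) (e Y)
          simp only [hL, e.symm_apply_apply] at this
          simp only [LinearMap.comp_apply, LinearEquiv.coe_coe, ContinuousLinearMap.coe_coe, this,
            map_add, e.symm_apply_apply]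
          rw [← lie_skew Y]
          abel }
    obtain ⟨X, hX⟩ := LieDerivation.IsKilling.exists_eq_ad D'
    refine ⟨e X, ?_⟩
    ext1 Z
    have h1 := congrArg (fun T : LieDerivation ℂ 𝔤 𝔤 => e (T (e.symm Z))) hX
    simp only [LieDerivation.ad_apply_apply] at h1
    rw [hL, e.symm_apply_apply, h1]
    change e (e.symm (D (e (e.symm Z)))) = _
    rw [e.apply_symm_apply, e.apply_symm_apply]
  · intro X
    simp only [hσ', e.symm_apply_apply, hσ.involutive, e.apply_symm_apply]
  · intro X
    simp only [hθ', e.symm_apply_apply, hθ.involutive, e.apply_symm_apply]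
  · intro X
    simp only [hθ', hσ', e.symm_apply_apply, hσθ]
  · intro X Y
    simp only [hL, hσ', e.symm_apply_apply, hσ.map_lie]
  · intro X Y
    simp only [hL, hθ', e.symm_apply_apply, hθ.map_lie]
  · intro X
    rw [ContinuousLinearMap.star_eq_adjoint, eq_comm, ContinuousLinearMap.eq_adjoint_iff]
    intro Y Z
    rw [neg_apply, inner_neg_left, hin, hin]
    simp only [hL, hθ', e.symm_apply_apply, hθ.map_lie, hθ.involutive]
    rw [← lie_skew (e.symm X) (e.symm Z), map_neg, LinearMap.neg_apply,
      LieModule.traceForm_apply_lie_apply]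
  · intro a b hab hba ha X
    have h1 : ∀ Z, a (b Z) = Z := fun Z => by rw [← mul_apply_eq_comp, hab, one_apply_eq_self]
    have h2 : ∀ Z, b (a Z) = Z := fun Z => by rw [← mul_apply_eq_comp, hba, one_apply_eq_self]
    let α : 𝔤 ≃ₗ⁅ℂ⁆ 𝔤 :=
      { toFun := fun Z => e.symm (a (e Z))
        map_add' := fun Y Z => by simp
        map_smul' := fun c Z => by simp
        map_lie' := fun {Y Z} => by
          have := ha (e Y) (e Z)
          simp only [hL, e.symm_apply_apply] at this
          simp only [this, e.symm_apply_apply]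
        invFun := fun Z => e.symm (b (e Z))
        left_inv := fun Z => by simp [h2]
        right_inv := fun Z => by simp [h1] }
    have hα : ∀ Z, α Z = e.symm (a (e Z)) := fun Z => rfl
    rw [ContinuousLinearMap.star_eq_adjoint]
    refine ext_inner_right ℂ fun Y => ?_
    rw [ContinuousLinearMap.adjoint_inner_left, hin, hin]
    have h3 : e.symm (a Y) = α (e.symm Y) := by rw [hα, e.apply_symm_apply]
    have h4 : θ (e.symm (θ' (b (θ' X)))) = α.symm (θ (e.symm X)) := by
      rw [hθ', hθ', e.symm_apply_apply, hθ.involutive]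
      rfl
    rw [h3, h4, ← LieAlgebra.killingForm_of_equiv_apply α (e.symm Y), α.apply_symm_apply]

end LieAlgebra

/-! ### The polyhedron and the operator norm of `ad`. -/

section Norm

variable {H : Type*} [NormedAddCommGroup H] [InnerProductSpace ℂ H] [FiniteDimensional ℂ H]

/-- The norm of a self-adjoint operator is attained at an eigenvalue. -/
theorem exists_eigenvector_norm_eq {S : H →L[ℂ] H} (hS : IsSelfAdjoint S) (h0 : S ≠ 0) :
    ∃ (r : ℝ) (X : H), X ≠ 0 ∧ S X = (r : ℂ) • X ∧ ‖S‖ = |r| := by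
  obtain ⟨b, μ, hb⟩ := exists_eigenbasis hS
  have hne : Nonempty (Fin (Module.finrank ℂ H)) := by
    by_contra hemp
    rw [not_nonempty_iff] at hemp
    apply h0
    ext1 X
    have hX : X = 0 := by
      rw [← b.sum_repr X]
      exact Finset.sum_of_isEmpty _
    rw [hX, map_zero, zero_apply]
  obtain ⟨i, -, hi⟩ := Finset.exists_max_image Finset.univ (fun j => |μ j|) ⟨hne.some, by simp⟩
  refine ⟨μ i, b i, b.orthonormal.ne_zero i, hb i, le_antisymm ?_ ?_⟩
  · refine ContinuousLinearMap.opNorm_le_bound _ (abs_nonneg _) fun X => ?_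
    refine le_of_sq_le_sq ?_ (by positivity)
    have h1 : ∀ j, inner ℂ (b j) (S X) = (μ j : ℂ) * inner ℂ (b j) X := by
      intro j
      have h2 : inner ℂ (b j) (S X) = inner ℂ (S (b j)) X := by
        rw [← ContinuousLinearMap.adjoint_inner_left, ← ContinuousLinearMap.star_eq_adjoint,
          hS.star_eq]
      rw [h2, hb, inner_smul_left, Complex.conj_ofReal]
    rw [mul_pow, ← b.sum_sq_norm_inner_right (S X), ← b.sum_sq_norm_inner_right X, Finset.mul_sum]
    refine Finset.sum_le_sum fun j _ => ?_
    rw [h1, norm_mul, mul_pow, Complex.norm_real, Real.norm_eq_abs]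
    exact mul_le_mul_of_nonneg_right (pow_le_pow_left₀ (abs_nonneg _) (hi j (Finset.mem_univ j)) 2)
      (sq_nonneg _)
  · have h1 := S.le_opNorm (b i)
    rw [hb, norm_smul, b.orthonormal.norm_eq_one i, mul_one, mul_one, Complex.norm_real,
      Real.norm_eq_abs] at h1
    exact h1

/-- Commuting self-adjoint operators have a joint eigenvector at each eigenvalue of one of
them. -/
theorem exists_joint_eigenvector {ι : Type*} {T : ι → H →L[ℂ] H} (hT : ∀ i, IsSelfAdjoint (T i))
    (hc : ∀ i j, Commute (T i) (T j)) {i : ι} {c : ℂ} {X : H} (hX : X ≠ 0) (hTX : T i X = c • X) :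
    ∃ (χ : ι → ℂ) (Y : H), Y ≠ 0 ∧ χ i = c ∧ ∀ j, T j Y = χ j • Y := by
  have hsym : ∀ j, (T j : H →ₗ[ℂ] H).IsSymmetric := fun j =>
    ContinuousLinearMap.isSelfAdjoint_iff_isSymmetric.mp (hT j)
  have htop := LinearMap.IsSymmetric.iSup_iInf_eq_top_of_commute hsym (fun j k _ => by
    ext Z
    exact congrArg (fun A : H →L[ℂ] H => A Z) (hc j k))
  by_contra hcon
  push Not at hcon
  -- The joint eigenspaces span. If none had eigenvalue `c` at `i`, the other eigenspaces of `T i`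
  -- would span too, contradicting their independence from the one containing `X`.
  have hle : (⊤ : Submodule ℂ H) ≤ ⨆ (ν : ℂ) (_ : ν ≠ c), Module.End.eigenspace (T i : H →ₗ[ℂ] H) ν := by
    rw [← htop]
    refine iSup_le fun χ => ?_
    by_cases h : χ i = c
    · intro Y hY
      by_cases hY0 : Y = 0
      · rw [hY0]; exact Submodule.zero_mem _
      · obtain ⟨j, hj⟩ := hcon χ Y hY0 h
        exact absurd (Module.End.mem_eigenspace_iff.1 ((Submodule.mem_iInf _).1 hY j)) hj
    · exact (iInf_le _ i).trans (le_iSup₂_of_le (χ i) h le_rfl)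
  have hind := (Module.End.eigenspaces_iSupIndep (T i : H →ₗ[ℂ] H)) c
  have h1 : X ∈ Module.End.eigenspace (T i : H →ₗ[ℂ] H) c := Module.End.mem_eigenspace_iff.2 hTX
  exact hX (Submodule.disjoint_def.1 hind X h1 (hle trivial))

variable {𝔤 : Type*} [LieRing 𝔤] [LieAlgebra ℂ 𝔤] {σ θ : 𝔤 →ₛₗ[starRingEnd ℂ] 𝔤}
  {e : 𝔤 ≃ₗ[ℂ] H} {L : H →ₗ[ℂ] (H →L[ℂ] H)} {σ' θ' : H →ₛₗ[starRingEnd ℂ] H}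

/-- The norm of the self-adjoint `ad ξ` is `|r|` for an eigenvalue `r`. Diagonalizing `ad 𝔞₀`
simultaneously extends `r` to a real joint eigenvalue, and a joint eigenvector in the real form
exhibits it as a restricted root. -/
theorem IsCartanModel.norm_lt (hM : IsCartanModel σ θ e L σ' θ') {𝔞₀ : Submodule ℝ 𝔤}
    (h𝔞 : 𝔞₀ ≤ noncompactPart σ θ) (hab : ∀ X ∈ 𝔞₀, ∀ Y ∈ 𝔞₀, ⁅X, Y⁆ = 0) {X : 𝔤}
    (hX : X ∈ polyhedron σ 𝔞₀) : ‖L (e X)‖ < Real.pi / 2 := by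
  obtain ⟨ξ, rfl, hξ⟩ := hX
  have C := hM.cartanData
  by_cases h0 : L (e ξ) = 0
  · rw [h0, norm_zero]; positivity
  have hσ𝔞 : ∀ ζ : 𝔞₀, σ' (e ζ) = e ζ := fun ζ => by
    rw [hM.map_σ]; exact congrArg e (h𝔞 ζ.2).2
  have hθ𝔞 : ∀ ζ : 𝔞₀, θ' (e ζ) = -e ζ := fun ζ => by
    have h1 : -θ (ζ : 𝔤) = ζ := (h𝔞 ζ.2).1
    rw [hM.map_θ, ← map_neg, neg_eq_iff_eq_neg.1 h1]
  have hsa : ∀ ζ : 𝔞₀, IsSelfAdjoint (L (e ζ)) := fun ζ => C.isSelfAdjoint (hθ𝔞 ζ)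
  obtain ⟨r, Z, hZ, hSZ, hnorm⟩ := exists_eigenvector_norm_eq (hsa ξ) h0
  obtain ⟨χ, Y, hY, hχξ, hTY⟩ := exists_joint_eigenvector (T := fun ζ : 𝔞₀ => L (e ζ)) hsa
    (fun ζ ζ' => C.commute_L (by rw [hM.map_lie, hab _ ζ.2 _ ζ'.2, map_zero])) hZ hSZ
  have hχr : ∀ ζ, starRingEnd ℂ (χ ζ) = χ ζ := by
    intro ζ
    have hY2 : inner ℂ Y Y ≠ 0 := inner_self_ne_zero.2 hY
    have h1 : inner ℂ (L (e ζ) Y) Y = inner ℂ Y (L (e ζ) Y) := by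
      conv_lhs => rw [← (hsa ζ).star_eq, ContinuousLinearMap.star_eq_adjoint]
      rw [ContinuousLinearMap.adjoint_inner_left]
    simp only [hTY, inner_smul_left, inner_smul_right] at h1
    exact mul_right_cancel₀ hY2 h1
  have hσY : ∀ ζ : 𝔞₀, L (e ζ) (σ' Y) = χ ζ • σ' Y := by
    intro ζ
    have h1 := C.σ_lie (e ζ) Y
    rw [hσ𝔞] at h1
    rw [← h1, hTY, map_smulₛₗ, hχr]
  -- an eigenvector in the real form
  obtain ⟨W, hW, hσW, hTW⟩ : ∃ W : H, W ≠ 0 ∧ σ' W = W ∧ ∀ ζ : 𝔞₀, L (e ζ) W = χ ζ • W := by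
    by_cases h1 : Y + σ' Y = 0
    · refine ⟨Complex.I • Y, smul_ne_zero Complex.I_ne_zero hY, ?_, fun ζ => ?_⟩
      · rw [map_smulₛₗ, Complex.conj_I, ← neg_eq_iff_add_eq_zero.2 h1, smul_neg, neg_smul, neg_neg]
      · rw [map_smul, hTY, smul_comm]
    · refine ⟨Y + σ' Y, h1, ?_, fun ζ => ?_⟩
      · rw [map_add, C.σ_invol, add_comm]
      · rw [map_add, hTY, hσY, smul_add]
  have hχre : ∀ ζ, χ ζ • W = (χ ζ).re • W := by
    intro ζ
    rw [← Complex.coe_smul, Complex.conj_eq_iff_re.1 (hχr ζ)]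
  let α : Module.Dual ℝ 𝔞₀ :=
    { toFun := fun ζ => (χ ζ).re
      map_add' := fun ζ ζ' => by
        refine smul_left_injective ℝ hW ?_
        simp only [add_smul, ← hχre, ← hTW]
        simp
      map_smul' := fun c ζ => by
        refine smul_left_injective ℝ hW ?_
        simp only [← hχre, ← hTW, RingHom.id_apply, smul_eq_mul, mul_smul]
        rw [Submodule.coe_smul, ← Complex.coe_smul c (ζ : 𝔤), map_smul, map_smul, smul_apply,
          Complex.coe_smul] }
  have hαξ : α ξ = r := by
    change (χ ξ).re = r
    rw [hχξ, Complex.ofReal_re]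
  have hroot : IsRestrictedRoot σ 𝔞₀ α := by
    refine ⟨fun h => ?_, e.symm W, ?_, ?_, fun ζ => ?_⟩
    · rw [h, LinearMap.zero_apply] at hαξ
      rw [← hαξ, abs_zero, norm_eq_zero] at hnorm
      exact h0 hnorm
    · change σ (e.symm W) = e.symm W
      apply e.injective
      rw [← hM.map_σ, e.apply_symm_apply, hσW]
    · simpa using hW
    · apply e.injective
      rw [← hM.map_lie, e.apply_symm_apply, hTW, hχre, ← Complex.coe_smul, ← Complex.coe_smul,
        map_smul, e.apply_symm_apply]
      rfl
  have := hξ α hroot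
  rwa [hαξ, ← hnorm] at this

end Norm

/-! ### The adjoint representation and exponential map of the Lie group on the model. -/

section LieGroupModel

set_option linter.unusedSectionVars false

variable {E : Type*} [NormedAddCommGroup E] [NormedSpace ℂ E] [FiniteDimensional ℂ E]
  [CompleteSpace E]
  {G : Type*} [TopologicalSpace G] [ChartedSpace E G] [Group G] [LieGroup 𝓘(ℂ, E) ω G]
  {σ θ : GroupLieAlgebra 𝓘(ℂ, E) G →ₛₗ[starRingEnd ℂ] GroupLieAlgebra 𝓘(ℂ, E) G}
  {H : Type*} [NormedAddCommGroup H] [InnerProductSpace ℂ H] [FiniteDimensional ℂ H]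
  {e : GroupLieAlgebra 𝓘(ℂ, E) G ≃ₗ[ℂ] H} {L : H →ₗ[ℂ] (H →L[ℂ] H)}
  {σ' θ' : H →ₛₗ[starRingEnd ℂ] H}

/-- Coordinates on the Lie algebra, as a map on the model space. -/
noncomputable def modelEquiv (e : GroupLieAlgebra 𝓘(ℂ, E) G ≃ₗ[ℂ] H) : E ≃L[ℂ] H :=
  LinearEquiv.toContinuousLinearEquiv (E := E) (F := H) e

/-- The adjoint representation of `G` on `H`. -/
noncomputable def modelAd (e : GroupLieAlgebra 𝓘(ℂ, E) G ≃ₗ[ℂ] H) : G →* (H →L[ℂ] H) where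
  toFun g := ((modelEquiv e : E →L[ℂ] H).comp (adChart g)).comp ((modelEquiv e).symm : H →L[ℂ] E)
  map_one' := by
    rw [adChart_one]
    ext1 Y
    exact (modelEquiv e).apply_symm_apply Y
  map_mul' g h := by
    rw [adChart_mul]
    ext1 Y
    simp only [mul_apply_eq_comp, ContinuousLinearMap.comp_apply, ContinuousLinearEquiv.coe_coe,
      ContinuousLinearEquiv.symm_apply_apply]

theorem modelAd_apply (g : G) (Y : H) :
    modelAd e g Y = modelEquiv e (adChart g ((modelEquiv e).symm Y)) := rfl

theorem modelAd_apply_equiv (g : G) (X : GroupLieAlgebra 𝓘(ℂ, E) G) :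
    modelAd e g (e X) = e (lieAd g X) := by
  rw [modelAd_apply, lieAd_eq_adChart]
  exact congrArg (fun Z => modelEquiv e (adChart g Z)) (e.symm_apply_apply X)

theorem continuous_modelAd : Continuous (modelAd e : G →* (H →L[ℂ] H)) := by
  have h := continuous_adChart (E := E) (G := G)
  exact (continuous_const.clm_comp h).clm_comp continuous_const

theorem IsCartanModel.isBracketHom_modelAd (hM : IsCartanModel σ θ e L σ' θ') (g : G) :
    IsBracketHom L (modelAd e g) := by
  intro X Y
  obtain ⟨X, rfl⟩ := e.surjective X
  obtain ⟨Y, rfl⟩ := e.surjective Y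
  rw [hM.map_lie, modelAd_apply_equiv, modelAd_apply_equiv, modelAd_apply_equiv, hM.map_lie,
    lieAd_lie]

theorem IsCartanModel.hasStrictFDerivAt_modelAd (hM : IsCartanModel σ θ e L σ' θ') :
    HasStrictFDerivAt (fun x : E => modelAd e ((unitChart (E := E) G).symm x))
      ((LinearMap.toContinuousLinearMap L).comp (modelEquiv e : E →L[ℂ] H))
      (unitChart (E := E) G 1) := by
  obtain ⟨D, hD, hDb⟩ := hasStrictFDerivAt_adChart (E := E) (G := G)
  let T : (E →L[ℂ] E) →L[ℂ] (H →L[ℂ] H) :=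
    ((ContinuousLinearMap.compL ℂ H E H).flip ((modelEquiv e).symm : H →L[ℂ] E)).comp
      (ContinuousLinearMap.compL ℂ E E H (modelEquiv e : E →L[ℂ] H))
  have h1 := T.hasStrictFDerivAt.comp (unitChart (E := E) G 1) hD
  refine h1.congr_fderiv ?_
  ext1 u
  ext1 Y
  have h2 := congrArg (modelEquiv e) (hDb u (e.symm Y))
  have h3 := (hM.map_lie u (e.symm Y)).symm
  rw [e.apply_symm_apply] at h3
  exact h2.trans h3

/-- The exponential map of `G`, in the coordinates `e` on its Lie algebra. -/
theorem IsCartanModel.isExpMap_lieExp (hM : IsCartanModel σ θ e L σ' θ') :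
    IsExpMap L (modelAd e) (fun Y : H => (lieExp (e.symm Y) : G)) := by
  have htg := topologicalGroup_of_lieGroup 𝓘(ℂ, E) ω (G := G)
  have C := hM.cartanData
  set φ := unitChart (E := E) G with hφ
  set p₀ := φ 1 with hp₀
  have hΦ := hM.hasStrictFDerivAt_modelAd
  obtain ⟨Ψ, D, hΨ1, hΨD, hDL, hleft, hright, hcont⟩ := C.exists_local_inverse (modelEquiv e) hΦ
    (by rw [unitChart_symm_one, map_one])
    (Filter.Eventually.of_forall fun p => hM.isBracketHom_modelAd _)
  have hφc : ContinuousAt φ 1 := continuousAt_extChartAt (I := 𝓘(ℂ, E)) (1 : G)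
  have hρc := continuous_modelAd (e := e)
  have hs : IsLocalSection L (modelAd e) (fun a => φ.symm (Ψ a)) := by
    refine ⟨?_, ?_, hright, ?_⟩
    · rw [hΨ1]; exact unitChart_symm_one
    · filter_upwards [eventually_chart_symm_chart (E := E) (G := G), hφc.eventually hleft]
        with g hg hl
      rw [hg] at hl
      rw [hl, hg]
    · have h1 : ∀ᶠ x in 𝓝 p₀, ContinuousAt φ.symm x := by
        filter_upwards [extChartAt_target_mem_nhds (I := 𝓘(ℂ, E)) (1 : G)] with x hx
        exact continuousAt_extChartAt_symm'' hx
      have h2 := hΨD.continuousAt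
      rw [ContinuousAt, hΨ1] at h2
      filter_upwards [hcont, h2.eventually h1] with a ha hb
      exact hb.comp ha
  obtain ⟨F, hF, hFs⟩ := exists_isExpMap C hρc hM.isBracketHom_modelAd hs
  have key : ∀ Y : H, (lieExp (e.symm Y) : G) = F Y := by
    intro Y
    -- Under `Ad` a one-parameter subgroup with velocity `Y` becomes `exp (t L Y)`, so the
    -- uniqueness clause for `F` determines its value at `1`, whichever subgroup `lieExp` chose.
    have huniq : ∀ γ : ℂ → G, IsOneParameter γ (e.symm Y) → γ 1 = F Y := by
      intro γ hγ
      have hγ0 : γ 0 = 1 := by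
        have := hγ.map_add 0 0
        rw [add_zero] at this
        exact left_eq_mul.1 this
      have hγc : ContinuousAt γ 0 := hγ.hasMFDerivAt.1
      have hγd : HasFDerivAt (fun t => φ (γ t))
          (ContinuousLinearMap.toSpanSingleton ℂ ((modelEquiv e).symm Y)) 0 := by
        have h1 := hγ.hasMFDerivAt.2
        simp only [writtenInExtChartAt, hγ0, ModelWithCorners.range_eq_univ] at h1
        exact h1.hasFDerivAt_of_univ
      refine hF.unique γ Y hγ.map_add hγc fun t => ?_
      refine eq_exp_of_map_add (f := fun t => modelAd e (γ t)) (fun s t => ?_) ?_ ?_ t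
      · rw [hγ.map_add, map_mul]
      · rw [hγ0, map_one]
      · have h2 : HasFDerivAt (fun x : E => modelAd e (φ.symm x))
            ((LinearMap.toContinuousLinearMap L).comp (modelEquiv e : E →L[ℂ] H)) (φ (γ 0)) := by
          rw [hγ0]; exact hΦ.hasFDerivAt
        have h3 := (HasFDerivAt.comp (f := fun t => φ (γ t)) (0 : ℂ) h2 hγd).hasDerivAt
        have h4 : (fun t => modelAd e (γ t)) =ᶠ[𝓝 0] fun t => modelAd e (φ.symm (φ (γ t))) := by
          rw [ContinuousAt, hγ0] at hγc
          filter_upwards [hγc.eventually (eventually_chart_symm_chart (E := E) (G := G))] with t ht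
          rw [ht]
        refine (h3.congr_of_eventuallyEq h4).congr_deriv ?_
        simp
    have hex : IsOneParameter (fun t : ℂ => F (t • Y)) (e.symm Y) := by
      have hF0 : F 0 = 1 := by
        have := hF.add 0 0 (by simp)
        rw [add_zero] at this
        exact left_eq_mul.1 this
      refine ⟨fun s t => ?_, ?_⟩
      · rw [add_smul, hF.add]
        rw [map_smul, map_smul, smul_apply, C.L_self, smul_zero, smul_zero]
      · have hline : Tendsto (fun t : ℂ => t • Y) (𝓝 0) (𝓝 0) := by
          have : Continuous fun t : ℂ => t • Y := by fun_prop
          simpa using this.tendsto 0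
        -- Near `0` the curve in the chart is `Ψ (exp (t L Y))`, and the derivative of `Ψ` at `1`
        -- inverts `L`.
        have hd : HasFDerivAt (fun t : ℂ => φ (F (t • Y)))
            (ContinuousLinearMap.toSpanSingleton ℂ ((modelEquiv e).symm Y)) 0 := by
          have h1 : HasDerivAt (fun t : ℂ => exp (t • L Y)) (L Y) 0 := by
            simpa using hasDerivAt_exp_smul_const (L Y) (0 : ℂ)
          have h2 : HasFDerivAt Ψ D (exp ((0 : ℂ) • L Y)) := by
            rw [zero_smul, exp_zero]; exact hΨD
          have h3 := (h2.comp_hasDerivAt (0 : ℂ) h1).hasFDerivAt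
          have h4 : (fun t : ℂ => φ (F (t • Y))) =ᶠ[𝓝 0] fun t : ℂ => Ψ (exp (t • L Y)) := by
            have h5 : Tendsto (fun t : ℂ => Ψ (exp (t • L Y))) (𝓝 0) (𝓝 p₀) := by
              have := (h2.comp_hasDerivAt (0 : ℂ) h1).continuousAt
              rw [ContinuousAt, Function.comp_apply, zero_smul, exp_zero, hΨ1] at this
              exact this
            filter_upwards [hline.eventually hFs,
              h5.eventually (eventually_chart_chart_symm (E := E) (G := G))] with t ht ht'
            rw [ht, map_smul, ht']
          refine (h3.congr_of_eventuallyEq h4).congr_fderiv ?_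
          rw [hDL]
        refine ⟨(hF.continuous.comp (by fun_prop)).continuousAt, ?_⟩
        have h0 : F ((0 : ℂ) • Y) = 1 := by rw [zero_smul, hF0]
        simp only [writtenInExtChartAt, h0, ModelWithCorners.range_eq_univ]
        exact hd.hasFDerivWithinAt
    have hex' : ∃ γ : ℂ → G, IsOneParameter γ (e.symm Y) := ⟨_, hex⟩
    rw [lieExp, dif_pos hex']
    exact huniq _ hex'.choose_spec
  rw [show (fun Y : H => (lieExp (e.symm Y) : G)) = F from funext key]
  exact hF

end LieGroupModel

/-! ### The Cartan decomposition at the level of the group. -/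

section PolarGroup

set_option linter.unusedSectionVars false

variable {H : Type*} [NormedAddCommGroup H] [InnerProductSpace ℂ H] [FiniteDimensional ℂ H]
  {L : H →ₗ[ℂ] (H →L[ℂ] H)} {σ θ : H →ₛₗ[starRingEnd ℂ] H}
  {G : Type*} [Group G] [TopologicalSpace G] [IsTopologicalGroup G]
  {ρ : G →* (H →L[ℂ] H)} {E : H → G}

/-- The elements of `G` whose adjoint action commutes with `τ`. -/
def adCommutant (ρ : G →* (H →L[ℂ] H)) (τ : H →ₛₗ[starRingEnd ℂ] H) : Subgroup G where
  carrier := {g | ∀ X, ρ g (τ X) = τ (ρ g X)}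
  one_mem' X := by rw [map_one]; rfl
  mul_mem' {g h} hg hh X := by
    rw [map_mul, mul_apply_eq_comp, mul_apply_eq_comp, hh, hg]
  inv_mem' {g} hg X := by
    have h1 : ∀ Y, ρ g⁻¹ (ρ g Y) = Y := fun Y => by
      rw [← mul_apply_eq_comp, ← map_mul, inv_mul_cancel, map_one]; rfl
    have h2 : ∀ Y, ρ g (ρ g⁻¹ Y) = Y := fun Y => by
      rw [← mul_apply_eq_comp, ← map_mul, mul_inv_cancel, map_one]; rfl
    have h3 := hg (ρ g⁻¹ X)
    rw [h2] at h3
    rw [← h3, h1]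

/-- The connected subgroup for the real form `σ`. -/
def realGroup (E : H → G) (σ : H →ₛₗ[starRingEnd ℂ] H) : Subgroup G :=
  Subgroup.closure (E '' {X | σ X = X})

/-- The connected subgroup for the intersection of the real forms of `σ` and `θ`. -/
def compactGroup (E : H → G) (σ θ : H →ₛₗ[starRingEnd ℂ] H) : Subgroup G :=
  Subgroup.closure (E '' {X | θ X = X ∧ σ X = X})

theorem IsExpMap.map_zero (hE : IsExpMap L ρ E) : E 0 = 1 := by
  have := hE.add 0 0 (by simp)
  rw [add_zero] at this
  exact left_eq_mul.1 this

theorem IsExpMap.map_neg (hE : IsExpMap L ρ E) (C : CartanData L σ θ) (X : H) :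
    E (-X) = (E X)⁻¹ := by
  rw [eq_inv_iff_mul_eq_one, ← hE.add, neg_add_cancel, hE.map_zero]
  rw [_root_.map_neg, neg_apply, C.L_self, neg_zero]

theorem IsExpMap.realGroup_le (hE : IsExpMap L ρ E) (C : CartanData L σ θ) :
    realGroup E σ ≤ adCommutant ρ σ := by
  refine (Subgroup.closure_le _).2 ?_
  rintro _ ⟨X, hX, rfl⟩ Y
  rw [hE.map_E, C.σ_exp hX]

theorem IsExpMap.compactGroup_le (hE : IsExpMap L ρ E) (C : CartanData L σ θ) :
    compactGroup E σ θ ≤ adCommutant ρ σ ⊓ adCommutant ρ θ := by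
  refine (Subgroup.closure_le _).2 ?_
  rintro _ ⟨X, hX, rfl⟩
  refine ⟨fun Y => ?_, fun Y => ?_⟩
  · rw [hE.map_E, C.σ_exp hX.2]
  · rw [hE.map_E, C.θ_exp hX.1]

/-- `compactGroup` is open in the group of all elements commuting with `σ` and `θ`. -/
theorem IsExpMap.eventually_mem_compactGroup (hE : IsExpMap L ρ E) (C : CartanData L σ θ) :
    ∀ᶠ k in 𝓝 (1 : G), k ∈ adCommutant ρ σ ⊓ adCommutant ρ θ → k ∈ compactGroup E σ θ := by
  have hLc : Continuous L := L.continuous_of_finiteDimensional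
  obtain ⟨V, hV, hinj⟩ : ∃ V ∈ 𝓝 (0 : H →L[ℂ] H), Set.InjOn exp V := by
    have h1 : HasStrictFDerivAt (exp : (H →L[ℂ] H) → (H →L[ℂ] H))
        ((ContinuousLinearEquiv.refl ℂ (H →L[ℂ] H) : (H →L[ℂ] H) ≃L[ℂ] (H →L[ℂ] H)) :
          (H →L[ℂ] H) →L[ℂ] (H →L[ℂ] H)) 0 :=
      hasStrictFDerivAt_exp_zero (𝕂 := ℂ)
    exact ⟨_, (h1.toOpenPartialHomeomorph exp).open_source.mem_nhds
      h1.mem_toOpenPartialHomeomorph_source, (h1.toOpenPartialHomeomorph exp).injOn⟩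
  have hnear : ∀ τ : H →ₛₗ[starRingEnd ℂ] H, ∀ᶠ X in 𝓝 (0 : H), L (τ X) ∈ V := fun τ => by
    have h1 := (hLc.comp (continuous_antilinear τ)).tendsto 0
    rw [Function.comp_apply, _root_.map_zero, _root_.map_zero] at h1
    exact h1.eventually hV
  have hnear' : ∀ᶠ X in 𝓝 (0 : H), L X ∈ V := by
    have h1 := hLc.tendsto 0
    rw [_root_.map_zero] at h1
    exact h1.eventually hV
  -- If `exp (L X)` commutes with `τ` then `exp (L (τ X)) = exp (L X)`; both arguments lie where
  -- `exp` is injective, so `τ X = X`.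
  have hfix : ∀ τ : H →ₛₗ[starRingEnd ℂ] H, (∀ X, τ (τ X) = X) →
      (∀ X Y, τ (L X Y) = L (τ X) (τ Y)) → ∀ X, L X ∈ V → L (τ X) ∈ V →
      (∀ Y, exp (L X) (τ Y) = τ (exp (L X) Y)) → τ X = X := by
    intro τ hτ hτL X h1 h2 h3
    refine C.injective (hinj h2 h1 ?_)
    ext1 Y
    rw [← hτ Y, h3, antilinear_exp τ (hτL X)]
  filter_upwards [hE.eventually _ ((hnear σ).and ((hnear θ).and hnear'))] with k hk hk'
  obtain ⟨X, ⟨h1, h2, h3⟩, rfl⟩ := hk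
  refine Subgroup.subset_closure ⟨X, ⟨?_, ?_⟩, rfl⟩
  · refine hfix θ C.θ_invol C.θ_lie X h3 h2 fun Y => ?_
    rw [← hE.map_E]; exact hk'.2 Y
  · refine hfix σ C.σ_invol C.σ_lie X h3 h1 fun Y => ?_
    rw [← hE.map_E]; exact hk'.1 Y

/-- From `a* = θ a⁻¹ θ`: an element commuting with `θ` acts unitarily. -/
theorem CartanData.star_mul_self (C : CartanData L σ θ) (hρL : ∀ g, IsBracketHom L (ρ g)) {k : G}
    (hk : k ∈ adCommutant ρ θ) : star (ρ k) = ρ k⁻¹ := by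
  have h1 : ρ k * ρ k⁻¹ = 1 := by rw [← map_mul, mul_inv_cancel, map_one]
  have h2 : ρ k⁻¹ * ρ k = 1 := by rw [← map_mul, inv_mul_cancel, map_one]
  ext1 X
  rw [C.star_aut _ _ h1 h2 (hρL k), ((adCommutant ρ θ).inv_mem hk) X, C.θ_invol]

theorem isUnit_map (g : G) : IsUnit (ρ g) := (Group.isUnit g).map ρ

theorem continuous_polarLog_map (hρ : Continuous ρ) (Λ : (H →L[ℂ] H) →L[ℂ] H) :
    Continuous fun g => polarLog Λ (ρ g) :=
  continuous_iff_continuousAt.2 fun g =>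
    tendsto_polarLog Λ (isUnit_map g) (fun h => isUnit_map h) (hρ.tendsto g)

variable {Λ : (H →L[ℂ] H) →L[ℂ] H}

theorem IsExpMap.polarLog_map (hE : IsExpMap L ρ E) (C : CartanData L σ θ) (hΛ : ∀ X, Λ (L X) = X)
    (hρL : ∀ g, IsBracketHom L (ρ g)) {X : H} (hX : θ X = -X) {k : G}
    (hk : k ∈ compactGroup E σ θ) : polarLog Λ (ρ (E X * k)) = X := by
  rw [map_mul, hE.map_E]
  refine polarLog_exp_mul hΛ C hX ?_
  rw [C.star_mul_self hρL (hE.compactGroup_le C hk).2, ← map_mul, mul_inv_cancel, map_one]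

theorem CartanData.polar_map (C : CartanData L σ θ) (hΛ : ∀ X, Λ (L X) = X)
    (hρL : ∀ g, IsBracketHom L (ρ g)) (hE : IsExpMap L ρ E) {g : G} (hg : g ∈ adCommutant ρ σ) :
    σ (polarLog Λ (ρ g)) = polarLog Λ (ρ g) ∧ θ (polarLog Λ (ρ g)) = -polarLog Λ (ρ g) ∧
      E (-polarLog Λ (ρ g)) * g ∈ adCommutant ρ σ ⊓ adCommutant ρ θ := by
  have h1 : ρ g * ρ g⁻¹ = 1 := by rw [← map_mul, mul_inv_cancel, map_one]
  have h2 : ρ g⁻¹ * ρ g = 1 := by rw [← map_mul, inv_mul_cancel, map_one]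
  obtain ⟨h3, h4, -, -, h5, h6⟩ := C.polar hΛ h1 h2 (hρL g) hg
  have h7 : ρ (E (-polarLog Λ (ρ g)) * g) = exp (-L (polarLog Λ (ρ g))) * ρ g := by
    rw [map_mul, hE.map_E, _root_.map_neg]
  refine ⟨h3, h4, fun X => ?_, fun X => ?_⟩
  · rw [h7, h5]
  · rw [h7, h6]

/-- The Cartan decomposition `G₀ = exp(𝔰₀) K₀`. -/
theorem CartanData.mem_compactGroup (C : CartanData L σ θ) (hΛ : ∀ X, Λ (L X) = X)
    (hρ : Continuous ρ) (hρL : ∀ g, IsBracketHom L (ρ g)) (hE : IsExpMap L ρ E) {g : G}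
    (hg : g ∈ realGroup E σ) : E (-polarLog Λ (ρ g)) * g ∈ compactGroup E σ θ := by
  set κ : G → G := fun g => E (-polarLog Λ (ρ g)) * g with hκ
  have hκc : Continuous κ :=
    (hE.continuous.comp (continuous_polarLog_map hρ Λ).neg).mul continuous_id
  -- The factor `κ` takes values in the commutant of `σ` and `θ`, where `compactGroup` is open.
  -- Membership is thus locally constant along the path `t ↦ g * E (t X)`, and passes from `t = 0`
  -- to `t = 1`.
  have hstep : ∀ g ∈ realGroup E σ, ∀ X, σ X = X → κ g ∈ compactGroup E σ θ →
      κ (g * E X) ∈ compactGroup E σ θ := by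
    intro g hg X hX hκg
    have hσt : ∀ t : ℝ, σ ((t : ℂ) • X) = (t : ℂ) • X := fun t => by
      rw [map_smulₛₗ, Complex.conj_ofReal, hX]
    have hγ : Continuous fun t : ℝ => κ (g * E ((t : ℂ) • X)) :=
      hκc.comp (continuous_const.mul (hE.continuous.comp (by fun_prop)))
    have hmem : ∀ t : ℝ, κ (g * E ((t : ℂ) • X)) ∈ adCommutant ρ σ ⊓ adCommutant ρ θ := fun t =>
      (C.polar_map hΛ hρL hE (hE.realGroup_le C ((realGroup E σ).mul_mem hg
        (Subgroup.subset_closure ⟨_, hσt t, rfl⟩)))).2.2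
    have hlc : IsLocallyConstant fun t : ℝ => κ (g * E ((t : ℂ) • X)) ∈ compactGroup E σ θ := by
      rw [IsLocallyConstant.iff_eventually_eq]
      intro t
      have h1 : ContinuousAt (fun s : ℝ => (κ (g * E ((t : ℂ) • X)))⁻¹ * κ (g * E ((s : ℂ) • X)))
          t := (continuous_const.mul hγ).continuousAt
      rw [ContinuousAt, inv_mul_cancel] at h1
      filter_upwards [h1.eventually (hE.eventually_mem_compactGroup C)] with s hs
      have h2 := hs (Subgroup.mul_mem _ (Subgroup.inv_mem _ (hmem t)) (hmem s))
      refine propext ⟨fun h => ?_, fun h => ?_⟩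
      · have h3 := (compactGroup E σ θ).mul_mem h ((compactGroup E σ θ).inv_mem h2)
        simpa using h3
      · simpa using (compactGroup E σ θ).mul_mem h h2
    have h4 := hlc.apply_eq_of_isPreconnected isPreconnected_univ (Set.mem_univ (0 : ℝ))
      (Set.mem_univ 1)
    simp only [Complex.ofReal_zero, zero_smul, hE.map_zero, mul_one, Complex.ofReal_one,
      one_smul] at h4
    exact h4 ▸ hκg
  induction hg using Subgroup.closure_induction_right with
  | one =>
    have h1 := hE.polarLog_map C hΛ hρL (X := 0) (by simp) (compactGroup E σ θ).one_mem
    rw [hE.map_zero, mul_one] at h1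
    rw [h1, neg_zero, hE.map_zero, mul_one]
    exact (compactGroup E σ θ).one_mem
  | mul_right x hx y hy ih =>
    obtain ⟨X, hX, rfl⟩ := hy
    exact hstep x hx X hX ih
  | mul_inv_cancel x hx y hy ih =>
    obtain ⟨X, hX, rfl⟩ := hy
    rw [← hE.map_neg C]
    exact hstep x hx (-X) (by rw [_root_.map_neg, show σ X = X from hX]) ih

end PolarGroup

/-! ### A continuous operator-valued invariant on `G / K`. -/

section ComplexQuotient

set_option linter.unusedSectionVars false

variable {H : Type*} [NormedAddCommGroup H] [InnerProductSpace ℂ H] [FiniteDimensional ℂ H]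
  {L : H →ₗ[ℂ] (H →L[ℂ] H)} {σ θ : H →ₛₗ[starRingEnd ℂ] H}
  {G : Type*} [Group G] [TopologicalSpace G] [IsTopologicalGroup G]
  {ρ : G →* (H →L[ℂ] H)} {E : H → G}

/-- The complex linear involution `σ ∘ θ`. -/
noncomputable def complexInvolution (σ θ : H →ₛₗ[starRingEnd ℂ] H) : H →L[ℂ] H :=
  LinearMap.toContinuousLinearMap (σ.comp θ : H →ₗ[ℂ] H)

theorem complexInvolution_apply (X : H) : complexInvolution σ θ X = σ (θ X) := rfl

/-- The connected subgroup for the complexification of the intersection of two real forms. -/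
def complexGroup (E : H → G) (σ θ : H →ₛₗ[starRingEnd ℂ] H) : Subgroup G :=
  Subgroup.closure (E '' (Submodule.span ℂ {X | θ X = X ∧ σ X = X} : Submodule ℂ H))

theorem compactGroup_le_complexGroup : compactGroup E σ θ ≤ complexGroup E σ θ :=
  Subgroup.closure_mono (Set.image_mono Submodule.subset_span)

theorem CartanData.complexInvolution_mul_self (C : CartanData L σ θ) :
    complexInvolution σ θ * complexInvolution σ θ = 1 := by
  ext1 X
  simp only [mul_apply_eq_comp, complexInvolution_apply, ← C.σ_θ, C.σ_invol, C.θ_invol,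
    one_apply_eq_self]

theorem CartanData.complexInvolution_mul_exp (C : CartanData L σ θ) (X : H) :
    complexInvolution σ θ * exp (L X) = exp (L (complexInvolution σ θ X)) *
      complexInvolution σ θ := by
  ext1 Y
  simp only [mul_apply_eq_comp, complexInvolution_apply]
  rw [antilinear_exp θ (C.θ_lie X), antilinear_exp σ (C.σ_lie (θ X))]

/-- Complex linearity of `σ ∘ θ` is essential: it fixes the whole complex span of `𝔨₀`, hence
commutes with the exponentials generating `K`. -/
theorem IsExpMap.commute_complexInvolution (hE : IsExpMap L ρ E) (C : CartanData L σ θ) {k : G}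
    (hk : k ∈ complexGroup E σ θ) : Commute (ρ k) (complexInvolution σ θ) := by
  induction hk using Subgroup.closure_induction with
  | mem x hx =>
    obtain ⟨X, hX, rfl⟩ := hx
    have h1 : complexInvolution σ θ X = X := by
      induction hX using Submodule.span_induction with
      | mem Y hY => rw [complexInvolution_apply, hY.1, hY.2]
      | zero => rw [_root_.map_zero]
      | add Y Z _ _ hY hZ => rw [map_add, hY, hZ]
      | smul c Y _ hY => rw [map_smul, hY]
    have h2 := C.complexInvolution_mul_exp X
    rw [h1] at h2
    rw [hE.map_E]
    exact h2.symm
  | one => rw [map_one]; exact Commute.one_left _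
  | mul x y _ _ hx hy => rw [map_mul]; exact hx.mul_left hy
  | inv x _ hx =>
    have h1 : ρ x * ρ x⁻¹ = 1 := by rw [← map_mul, mul_inv_cancel, map_one]
    have h2 : ρ x⁻¹ * ρ x = 1 := by rw [← map_mul, inv_mul_cancel, map_one]
    calc ρ x⁻¹ * complexInvolution σ θ
        = ρ x⁻¹ * (complexInvolution σ θ * ρ x) * ρ x⁻¹ := by
          rw [mul_assoc, mul_assoc, h1, mul_one]
      _ = (ρ x⁻¹ * ρ x) * complexInvolution σ θ * ρ x⁻¹ := by rw [← hx.eq]; noncomm_ring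
      _ = complexInvolution σ θ * ρ x⁻¹ := by rw [h2, one_mul]

/-- The map `g K ↦ g τ g⁻¹ τ`, where `τ` is the complex involution fixing `K`. -/
noncomputable def cartanImmersion (ρ : G →* (H →L[ℂ] H)) (σ θ : H →ₛₗ[starRingEnd ℂ] H) (g : G) :
    H →L[ℂ] H :=
  ρ g * complexInvolution σ θ * ρ g⁻¹ * complexInvolution σ θ

theorem continuous_cartanImmersion (hρ : Continuous ρ) : Continuous (cartanImmersion ρ σ θ) :=
  ((hρ.mul continuous_const).mul (hρ.comp continuous_inv)).mul continuous_const

theorem IsExpMap.cartanImmersion_mul (hE : IsExpMap L ρ E) (C : CartanData L σ θ) (g : G) {k : G}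
    (hk : k ∈ complexGroup E σ θ) : cartanImmersion ρ σ θ (g * k) = cartanImmersion ρ σ θ g := by
  have h1 : ρ k * ρ k⁻¹ = 1 := by rw [← map_mul, mul_inv_cancel, map_one]
  simp only [cartanImmersion, mul_inv_rev, map_mul]
  calc _ = ρ g * (ρ k * complexInvolution σ θ) * ρ k⁻¹ * ρ g⁻¹ * complexInvolution σ θ := by
        noncomm_ring
    _ = ρ g * complexInvolution σ θ * (ρ k * ρ k⁻¹) * ρ g⁻¹ * complexInvolution σ θ := by
        rw [(hE.commute_complexInvolution C hk).eq]; noncomm_ring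
    _ = _ := by rw [h1, mul_one]

/-- The involution `τ` is `-1` on `X` and on `i Y`, so conjugation by it turns the inverses of the
two exponentials back into the exponentials, and the inner one is squared. -/
theorem IsExpMap.cartanImmersion_exp_mul_exp (hE : IsExpMap L ρ E) (C : CartanData L σ θ)
    {X Y : H} (hXσ : σ X = X) (hXθ : θ X = -X) (hYσ : σ Y = Y) (hYθ : θ Y = -Y) :
    cartanImmersion ρ σ θ (E X * E (Complex.I • Y)) =
      exp (L X) * exp (L ((2 * Complex.I) • Y)) * exp (L X) := by
  set τ := complexInvolution σ θ with hτ
  have hτX : τ X = -X := by rw [hτ, complexInvolution_apply, hXθ, _root_.map_neg, hXσ]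
  have hτY : τ (Complex.I • Y) = -(Complex.I • Y) := by
    rw [map_smul, hτ, complexInvolution_apply, hYθ, _root_.map_neg, hYσ, smul_neg]
  have h1 : τ * exp (L (-X)) = exp (L X) * τ := by
    have := C.complexInvolution_mul_exp (-X)
    rwa [← hτ, _root_.map_neg τ, hτX, neg_neg] at this
  have h2 : τ * exp (L (-(Complex.I • Y))) = exp (L (Complex.I • Y)) * τ := by
    have := C.complexInvolution_mul_exp (-(Complex.I • Y))
    rwa [← hτ, _root_.map_neg τ, hτY, neg_neg] at this
  have h3 : τ * τ = 1 := C.complexInvolution_mul_self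
  have h4 : exp (L (Complex.I • Y)) * exp (L (Complex.I • Y)) =
      exp (L ((2 * Complex.I) • Y)) := by
    rw [exp_mul_self, ← map_add, ← two_smul ℂ, smul_smul]
  rw [cartanImmersion, mul_inv_rev, ← hE.map_neg C, ← hE.map_neg C, map_mul, map_mul, hE.map_E,
    hE.map_E, hE.map_E, hE.map_E, ← hτ, ← h4]
  calc _ = exp (L X) * exp (L (Complex.I • Y)) * (τ * exp (L (-(Complex.I • Y)))) *
        exp (L (-X)) * τ := by noncomm_ring
    _ = exp (L X) * exp (L (Complex.I • Y)) * exp (L (Complex.I • Y)) *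
        (τ * exp (L (-X))) * τ := by rw [h2]; noncomm_ring
    _ = exp (L X) * (exp (L (Complex.I • Y)) * exp (L (Complex.I • Y))) * exp (L X) *
        (τ * τ) := by rw [h1]; noncomm_ring
    _ = _ := by rw [h3, mul_one]

theorem CartanData.norm_L_apply_compact (C : CartanData L σ θ) (hE : IsExpMap L ρ E)
    (hρL : ∀ g, IsBracketHom L (ρ g)) {k : G} (hk : k ∈ compactGroup E σ θ) (X : H) :
    ‖L (ρ k X)‖ = ‖L X‖ := by
  have h1 : ρ k * ρ k⁻¹ = 1 := by rw [← map_mul, mul_inv_cancel, map_one]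
  have h2 : ∀ k ∈ compactGroup E σ θ, ρ k ∈ unitary (H →L[ℂ] H) := fun k hk => by
    rw [Unitary.mem_iff, C.star_mul_self hρL (hE.compactGroup_le C hk).2, ← map_mul, ← map_mul,
      inv_mul_cancel, mul_inv_cancel, map_one]
    exact ⟨rfl, rfl⟩
  rw [← (hρL k).conj_L h1, CStarRing.norm_mul_mem_unitary _ (h2 _ (Subgroup.inv_mem _ hk)),
    CStarRing.norm_mem_unitary_mul _ (h2 _ hk)]

end ComplexQuotient

/-! ### Trivialization of the tangent bundle and contractibility of the symmetric space. -/

section Tangent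

set_option linter.unusedSectionVars false

variable {E : Type*} [NormedAddCommGroup E] [NormedSpace ℂ E] [FiniteDimensional ℂ E]
  [CompleteSpace E]
  {G : Type*} [TopologicalSpace G] [ChartedSpace E G] [Group G] [LieGroup 𝓘(ℂ, E) ω G]
  [IsTopologicalGroup G]
  {σ θ : GroupLieAlgebra 𝓘(ℂ, E) G →ₛₗ[starRingEnd ℂ] GroupLieAlgebra 𝓘(ℂ, E) G}
  {H : Type*} [NormedAddCommGroup H] [InnerProductSpace ℂ H] [FiniteDimensional ℂ H]
  {e : GroupLieAlgebra 𝓘(ℂ, E) G ≃ₗ[ℂ] H} {L : H →ₗ[ℂ] (H →L[ℂ] H)}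
  {σ' θ' : H →ₛₗ[starRingEnd ℂ] H} {Λ : (H →L[ℂ] H) →L[ℂ] H}

/-- The exponential map of `G` in the coordinates `e` on its Lie algebra. -/
noncomputable def modelExp (e : GroupLieAlgebra 𝓘(ℂ, E) G ≃ₗ[ℂ] H) (Y : H) : G :=
  lieExp (e.symm Y)

theorem IsCartanModel.isExpMap (hM : IsCartanModel σ θ e L σ' θ') :
    IsExpMap L (modelAd e) (modelExp e) := hM.isExpMap_lieExp

theorem lieExp_eq (X : GroupLieAlgebra 𝓘(ℂ, E) G) : lieExp X = modelExp e (e X) := by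
  rw [modelExp, e.symm_apply_apply]

theorem analyticSubgroup_eq (W : Set (GroupLieAlgebra 𝓘(ℂ, E) G)) :
    analyticSubgroup W = Subgroup.closure (modelExp e '' (e '' W)) := by
  rw [analyticSubgroup, Set.image_image]
  refine congrArg Subgroup.closure (Set.image_congr fun X _ => lieExp_eq X)

theorem IsCartanModel.G₀_eq (hM : IsCartanModel σ θ e L σ' θ') :
    G₀ σ = realGroup (modelExp e) σ' := by
  refine (analyticSubgroup_eq (e := e) _).trans ?_
  rw [realGroup]
  congr 2
  ext Y
  constructor
  · rintro ⟨X, hX, rfl⟩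
    exact (hM.map_σ X).trans (congrArg e hX)
  · intro hY
    refine ⟨e.symm Y, ?_, e.apply_symm_apply Y⟩
    apply e.injective
    rw [← hM.map_σ, e.apply_symm_apply]
    exact hY

theorem IsCartanModel.image_compactPart (hM : IsCartanModel σ θ e L σ' θ') :
    e '' (compactPart σ θ : Set (GroupLieAlgebra 𝓘(ℂ, E) G)) = {X | θ' X = X ∧ σ' X = X} := by
  ext Y
  constructor
  · rintro ⟨X, hX, rfl⟩
    exact ⟨(hM.map_θ X).trans (congrArg e hX.1), (hM.map_σ X).trans (congrArg e hX.2)⟩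
  · intro hY
    refine ⟨e.symm Y, ⟨?_, ?_⟩, e.apply_symm_apply Y⟩
    · apply e.injective
      rw [← hM.map_θ, e.apply_symm_apply]
      exact hY.1
    · apply e.injective
      rw [← hM.map_σ, e.apply_symm_apply]
      exact hY.2

theorem IsCartanModel.K₀_eq (hM : IsCartanModel σ θ e L σ' θ') :
    K₀ σ θ = compactGroup (modelExp e) σ' θ' := by
  refine (analyticSubgroup_eq (e := e) _).trans ?_
  rw [compactGroup, hM.image_compactPart]

theorem IsCartanModel.K_eq (hM : IsCartanModel σ θ e L σ' θ') :
    K σ θ = complexGroup (modelExp e) σ' θ' := by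
  refine (analyticSubgroup_eq (e := e) _).trans ?_
  rw [complexGroup, ← hM.image_compactPart]
  congr 2
  exact (Submodule.map_coe e.toLinearMap _).symm.trans
    (congrArg _ (Submodule.map_span e.toLinearMap _))

theorem K₀_le_K : K₀ σ θ ≤ K σ θ :=
  Subgroup.closure_mono (Set.image_mono Submodule.subset_span)

theorem K₀_le_G₀ : K₀ σ θ ≤ G₀ σ :=
  Subgroup.closure_mono (Set.image_mono fun _ h => h.2)

/-- The image of `𝔰₀` in the model. -/
def symmetricSet (σ' θ' : H →ₛₗ[starRingEnd ℂ] H) : Set H := {X | σ' X = X ∧ θ' X = -X}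

theorem starConvex_symmetricSet : StarConvex ℝ 0 (symmetricSet σ' θ') := by
  rw [starConvex_zero_iff]
  rintro X ⟨h1, h2⟩ a - -
  refine ⟨?_, ?_⟩
  · rw [← Complex.coe_smul, map_smulₛₗ, Complex.conj_ofReal, h1]
  · rw [← Complex.coe_smul, map_smulₛₗ, Complex.conj_ofReal, h2, smul_neg]

theorem zero_mem_symmetricSet : (0 : H) ∈ symmetricSet σ' θ' := by
  simp [symmetricSet]

theorem IsCartanModel.mem_symmetricSet (hM : IsCartanModel σ θ e L σ' θ')
    (ξ : noncompactPart σ θ) : e ξ ∈ symmetricSet σ' θ' := by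
  have h1 : -θ (ξ : GroupLieAlgebra 𝓘(ℂ, E) G) = ξ := ξ.2.1
  refine ⟨(hM.map_σ _).trans (congrArg e ξ.2.2), ?_⟩
  rw [hM.map_θ, ← map_neg, neg_eq_iff_eq_neg.1 h1]

theorem IsCartanModel.symm_mem (hM : IsCartanModel σ θ e L σ' θ') {Y : H}
    (hY : Y ∈ symmetricSet σ' θ') : e.symm Y ∈ noncompactPart σ θ := by
  refine ⟨?_, ?_⟩
  · change -θ (e.symm Y) = e.symm Y
    apply e.injective
    rw [map_neg, ← hM.map_θ, e.apply_symm_apply, hY.2, neg_neg]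
  · change σ (e.symm Y) = e.symm Y
    apply e.injective
    rw [← hM.map_σ, e.apply_symm_apply, hY.1]

theorem IsCartanModel.modelExp_mem (hM : IsCartanModel σ θ e L σ' θ') {Y : H}
    (hY : Y ∈ symmetricSet σ' θ') : modelExp e Y ∈ G₀ σ := by
  rw [hM.G₀_eq]
  exact Subgroup.subset_closure ⟨Y, hY.1, rfl⟩

theorem IsCartanModel.modelAd_mem_symmetricSet (hM : IsCartanModel σ θ e L σ' θ') {Y : H}
    (hY : Y ∈ symmetricSet σ' θ') {k : G} (hk : k ∈ K₀ σ θ) :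
    modelAd e k Y ∈ symmetricSet σ' θ' := by
  rw [hM.K₀_eq] at hk
  have h1 := hM.isExpMap.compactGroup_le hM.cartanData hk
  refine ⟨?_, ?_⟩
  · rw [← h1.1 Y, hY.1]
  · rw [← h1.2 Y, hY.2, map_neg]

/-- The noncompact factor of the Cartan decomposition of `g`. -/
noncomputable def cartanLog (e : GroupLieAlgebra 𝓘(ℂ, E) G ≃ₗ[ℂ] H) (Λ : (H →L[ℂ] H) →L[ℂ] H)
    (g : G) : H := polarLog Λ (modelAd e g)

/-- The compact factor of the Cartan decomposition of `g`. -/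
noncomputable def cartanCompact (e : GroupLieAlgebra 𝓘(ℂ, E) G ≃ₗ[ℂ] H)
    (Λ : (H →L[ℂ] H) →L[ℂ] H) (g : G) : G := modelExp e (-cartanLog e Λ g) * g

theorem continuous_cartanLog : Continuous (cartanLog (G := G) e Λ) :=
  continuous_polarLog_map continuous_modelAd Λ

theorem IsCartanModel.continuous_cartanCompact (hM : IsCartanModel σ θ e L σ' θ') :
    Continuous (cartanCompact (G := G) e Λ) := by
  exact (hM.isExpMap.continuous.comp continuous_cartanLog.neg).mul continuous_id

theorem IsCartanModel.cartanLog_mem (hM : IsCartanModel σ θ e L σ' θ') (hΛ : ∀ X, Λ (L X) = X)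
    {g : G} (hg : g ∈ G₀ σ) : cartanLog e Λ g ∈ symmetricSet σ' θ' := by
  rw [hM.G₀_eq] at hg
  have h1 := hM.cartanData.polar_map hΛ hM.isBracketHom_modelAd hM.isExpMap
    (hM.isExpMap.realGroup_le hM.cartanData hg)
  exact ⟨h1.1, h1.2.1⟩

theorem IsCartanModel.cartanCompact_mem (hM : IsCartanModel σ θ e L σ' θ')
    (hΛ : ∀ X, Λ (L X) = X) {g : G} (hg : g ∈ G₀ σ) : cartanCompact e Λ g ∈ K₀ σ θ := by
  rw [hM.G₀_eq] at hg
  rw [hM.K₀_eq]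
  exact hM.cartanData.mem_compactGroup hΛ continuous_modelAd hM.isBracketHom_modelAd hM.isExpMap hg

theorem IsCartanModel.exp_mul_cartanCompact (hM : IsCartanModel σ θ e L σ' θ') (g : G) :
    modelExp e (cartanLog e Λ g) * cartanCompact e Λ g = g := by
  rw [cartanCompact, hM.isExpMap.map_neg hM.cartanData, mul_inv_cancel_left]

theorem IsCartanModel.cartanLog_exp_mul (hM : IsCartanModel σ θ e L σ' θ')
    (hΛ : ∀ X, Λ (L X) = X) {Y : H} (hY : Y ∈ symmetricSet σ' θ') {k : G} (hk : k ∈ K₀ σ θ) :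
    cartanLog e Λ (modelExp e Y * k) = Y := by
  rw [hM.K₀_eq] at hk
  exact hM.isExpMap.polarLog_map hM.cartanData hΛ hM.isBracketHom_modelAd hY.2 hk

theorem IsCartanModel.cartanCompact_exp_mul (hM : IsCartanModel σ θ e L σ' θ')
    (hΛ : ∀ X, Λ (L X) = X) {Y : H} (hY : Y ∈ symmetricSet σ' θ') {k : G} (hk : k ∈ K₀ σ θ) :
    cartanCompact e Λ (modelExp e Y * k) = k := by
  rw [cartanCompact, hM.cartanLog_exp_mul hΛ hY hk, hM.isExpMap.map_neg hM.cartanData,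
    inv_mul_cancel_left]

theorem IsCartanModel.cartanLog_mul (hM : IsCartanModel σ θ e L σ' θ')
    (hΛ : ∀ X, Λ (L X) = X) {g k : G} (hg : g ∈ G₀ σ) (hk : k ∈ K₀ σ θ) :
    cartanLog e Λ (g * k) = cartanLog e Λ g := by
  conv_lhs => rw [← hM.exp_mul_cartanCompact (Λ := Λ) g, mul_assoc]
  exact hM.cartanLog_exp_mul hΛ (hM.cartanLog_mem hΛ hg)
    ((K₀ σ θ).mul_mem (hM.cartanCompact_mem hΛ hg) hk)

theorem IsCartanModel.cartanCompact_mul (hM : IsCartanModel σ θ e L σ' θ')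
    (hΛ : ∀ X, Λ (L X) = X) {g k : G} (hg : g ∈ G₀ σ) (hk : k ∈ K₀ σ θ) :
    cartanCompact e Λ (g * k) = cartanCompact e Λ g * k := by
  rw [cartanCompact, hM.cartanLog_mul hΛ hg hk, cartanCompact, mul_assoc]

theorem tangentMk_mul (g : G₀ σ) {k : G} (hk : k ∈ K₀ σ θ) (ξ ζ : noncompactPart σ θ)
    (h : (ξ : GroupLieAlgebra 𝓘(ℂ, E) G) = lieAd k (ζ : GroupLieAlgebra 𝓘(ℂ, E) G)) :
    tangentMk g ξ = tangentMk (g * ⟨k, K₀_le_G₀ hk⟩) ζ :=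
  Quot.sound ⟨k, hk, rfl, h⟩

theorem continuous_modelEquiv :
    Continuous fun X : GroupLieAlgebra 𝓘(ℂ, E) G => e X := (modelEquiv e).continuous

theorem continuous_modelEquiv_symm :
    Continuous fun X : H => (e.symm X : GroupLieAlgebra 𝓘(ℂ, E) G) := (modelEquiv e).symm.continuous

/-- The Cartan decomposition trivializes the tangent bundle of `G₀ / K₀`. -/
theorem IsCartanModel.exists_tangent_homeomorph (hM : IsCartanModel σ θ e L σ' θ')
    (hΛ : ∀ X, Λ (L X) = X) :
    ∃ Θ : TangentM σ θ ≃ₜ (symmetricSet σ' θ' ×ˢ symmetricSet σ' θ' : Set (H × H)),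
      ∀ g ξ, (Θ (tangentMk g ξ) : H × H) =
        (cartanLog e Λ (g : G), modelAd e (cartanCompact e Λ (g : G)) (e ξ)) := by
  let f : G₀ σ × noncompactPart σ θ → (symmetricSet σ' θ' ×ˢ symmetricSet σ' θ' : Set (H × H)) :=
    fun p => ⟨(cartanLog e Λ (p.1 : G), modelAd e (cartanCompact e Λ (p.1 : G)) (e p.2)),
      hM.cartanLog_mem hΛ p.1.2, hM.modelAd_mem_symmetricSet (hM.mem_symmetricSet p.2)
        (hM.cartanCompact_mem hΛ p.1.2)⟩
  have hf : Continuous f := by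
    refine Continuous.subtype_mk (Continuous.prodMk ?_ ?_) _
    · exact continuous_cartanLog.comp (continuous_subtype_val.comp continuous_fst)
    · exact ((continuous_modelAd.comp hM.continuous_cartanCompact).comp
        (continuous_subtype_val.comp continuous_fst)).clm_apply
        (continuous_modelEquiv.comp (continuous_subtype_val.comp continuous_snd))
  have hfr : ∀ p q, tangentRel σ θ p q → f p = f q := by
    rintro p q ⟨k, hk, h1, h2⟩
    refine Subtype.ext (Prod.ext ?_ ?_)
    · change cartanLog e Λ (p.1 : G) = cartanLog e Λ (q.1 : G)
      rw [h1, hM.cartanLog_mul hΛ p.1.2 hk]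
    · change modelAd e (cartanCompact e Λ (p.1 : G)) (e p.2) =
        modelAd e (cartanCompact e Λ (q.1 : G)) (e q.2)
      rw [h1, hM.cartanCompact_mul hΛ p.1.2 hk, map_mul, mul_apply_eq_comp, h2,
        modelAd_apply_equiv k]
  -- The inverse is `(η, ζ) ↦ [exp η, ζ]`: moving the compact factor of `g = exp(η) k` across the
  -- quotient replaces `ξ` by `Ad(k) ξ`.
  let i : (symmetricSet σ' θ' ×ˢ symmetricSet σ' θ' : Set (H × H)) → TangentM σ θ := fun p =>
    tangentMk ⟨modelExp e p.1.1, hM.modelExp_mem p.2.1⟩ ⟨e.symm p.1.2, hM.symm_mem p.2.2⟩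
  have hi : Continuous i := by
    refine continuous_quot_mk.comp (Continuous.prodMk ?_ ?_)
    · exact (hM.isExpMap.continuous.comp
        (continuous_fst.comp continuous_subtype_val)).subtype_mk _
    · exact (continuous_modelEquiv_symm.comp
        (continuous_snd.comp continuous_subtype_val)).subtype_mk _
  refine ⟨⟨⟨Quot.lift f hfr, i, ?_, ?_⟩, continuous_quot_lift hfr hf, hi⟩, fun g ξ => rfl⟩
  · rintro ⟨g, ξ⟩
    refine (tangentMk_mul _ (hM.cartanCompact_mem hΛ g.2) _ ξ ?_).trans ?_
    · apply e.injective
      exact (e.apply_symm_apply _).trans (modelAd_apply_equiv _ _)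
    · refine congrArg (fun h => tangentMk h ξ) (Subtype.ext ?_)
      exact hM.exp_mul_cartanCompact (Λ := Λ) (g : G)
  · rintro ⟨⟨η, ζ⟩, hη, hζ⟩
    have h1 : cartanLog e Λ (modelExp e η : G) = η := by
      simpa using hM.cartanLog_exp_mul hΛ hη (K₀ σ θ).one_mem
    have h2 : cartanCompact e Λ (modelExp e η : G) = 1 := by
      simpa using hM.cartanCompact_exp_mul hΛ hη (K₀ σ θ).one_mem
    refine Subtype.ext (Prod.ext h1 ?_)
    change modelAd e (cartanCompact e Λ (modelExp e η)) (e (e.symm ζ)) = ζ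
    rw [h2, map_one, e.apply_symm_apply]
    rfl

/-- The Cartan decomposition identifies `G₀ / K₀` with `𝔰₀`. -/
theorem IsCartanModel.contractibleSpace_symmetricSpace (hM : IsCartanModel σ θ e L σ' θ')
    (hΛ : ∀ X, Λ (L X) = X) : ContractibleSpace (SymmetricSpace σ θ) := by
  have hS : ContractibleSpace (symmetricSet σ' θ') :=
    starConvex_symmetricSet.contractibleSpace ⟨0, zero_mem_symmetricSet⟩
  let f : G₀ σ → symmetricSet σ' θ' := fun g => ⟨cartanLog e Λ (g : G), hM.cartanLog_mem hΛ g.2⟩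
  have hf : Continuous f :=
    (continuous_cartanLog.comp continuous_subtype_val).subtype_mk _
  have hfr : ∀ g h : G₀ σ, QuotientGroup.leftRel ((K₀ σ θ).subgroupOf (G₀ σ)) g h → f g = f h := by
    intro g h hgh
    rw [QuotientGroup.leftRel_apply, Subgroup.mem_subgroupOf] at hgh
    refine Subtype.ext ?_
    change cartanLog e Λ (g : G) = cartanLog e Λ (h : G)
    rw [← hM.cartanLog_mul hΛ g.2 hgh]
    simp
  let i : symmetricSet σ' θ' → SymmetricSpace σ θ := fun Y =>
    QuotientGroup.mk ⟨modelExp e Y.1, hM.modelExp_mem Y.2⟩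
  have hi : Continuous i := QuotientGroup.continuous_mk.comp
    ((hM.isExpMap.continuous.comp continuous_subtype_val).subtype_mk _)
  let Φ : SymmetricSpace σ θ ≃ₜ symmetricSet σ' θ' :=
    { toFun := Quotient.lift f hfr
      invFun := i
      left_inv := by
        rintro ⟨g⟩
        refine QuotientGroup.eq.2 ?_
        rw [Subgroup.mem_subgroupOf]
        change (modelExp e (cartanLog e Λ (g : G)))⁻¹ * (g : G) ∈ K₀ σ θ
        rw [← hM.isExpMap.map_neg hM.cartanData]
        exact hM.cartanCompact_mem hΛ g.2
      right_inv := fun Y => by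
        refine Subtype.ext ?_
        change cartanLog e Λ (modelExp e Y.1 : G) = Y.1
        simpa using hM.cartanLog_exp_mul hΛ Y.2 (K₀ σ θ).one_mem
      continuous_toFun := hf.quotient_lift hfr
      continuous_invFun := hi }
  exact Φ.contractibleSpace

end Tangent

/-! ### The polar map, the tube and the retraction. -/

section Domain

set_option linter.unusedSectionVars false

variable {E : Type*} [NormedAddCommGroup E] [NormedSpace ℂ E] [FiniteDimensional ℂ E]
  [CompleteSpace E]
  {G : Type*} [TopologicalSpace G] [ChartedSpace E G] [Group G] [LieGroup 𝓘(ℂ, E) ω G]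
  [IsTopologicalGroup G]
  {σ θ : GroupLieAlgebra 𝓘(ℂ, E) G →ₛₗ[starRingEnd ℂ] GroupLieAlgebra 𝓘(ℂ, E) G}
  {H : Type*} [NormedAddCommGroup H] [InnerProductSpace ℂ H] [FiniteDimensional ℂ H]
  {e : GroupLieAlgebra 𝓘(ℂ, E) G ≃ₗ[ℂ] H} {L : H →ₗ[ℂ] (H →L[ℂ] H)}
  {σ' θ' : H →ₛₗ[starRingEnd ℂ] H} {Λ : (H →L[ℂ] H) →L[ℂ] H}
  {𝔞₀ : Submodule ℝ (GroupLieAlgebra 𝓘(ℂ, E) G)}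

theorem polarPoint_eq (g : G) (ξ : GroupLieAlgebra 𝓘(ℂ, E) G) :
    polarPoint σ θ g ξ = QuotientGroup.mk (g * modelExp e (Complex.I • e ξ)) := by
  rw [polarPoint, lieExp_eq (e := e), map_smul]

/-- Replacing `(g, Ad(k) ξ)` by `(g k, ξ)` changes `g exp(i Ad(k) ξ) = g k exp(i ξ) k⁻¹` only by
right multiplication by `k ∈ K`. -/
theorem IsCartanModel.exists_polarMap (hM : IsCartanModel σ θ e L σ' θ') :
    ∃ polar : C(TangentM σ θ, G ⧸ K σ θ), ∀ (g : G₀ σ) (ξ : noncompactPart σ θ),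
      polar (tangentMk g ξ) = polarPoint σ θ g ξ := by
  let f : G₀ σ × noncompactPart σ θ → G ⧸ K σ θ := fun p => polarPoint σ θ p.1 p.2
  have hfr : ∀ p q, tangentRel σ θ p q → f p = f q := by
    rintro p q ⟨k, hk, h1, h2⟩
    change polarPoint σ θ p.1 p.2 = polarPoint σ θ q.1 q.2
    rw [polarPoint_eq (e := e), polarPoint_eq (e := e), h1, h2, ← modelAd_apply_equiv, ← map_smul,
      ← hM.isExpMap.conj, eq_comm, QuotientGroup.eq]
    have h3 := (K σ θ).inv_mem (K₀_le_K hk)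
    convert h3 using 1
    group
  have hf : Continuous f := by
    have h1 : Continuous fun p : G₀ σ × noncompactPart σ θ =>
        (p.1 : G) * modelExp e (Complex.I • e (p.2 : GroupLieAlgebra 𝓘(ℂ, E) G)) :=
      (continuous_subtype_val.comp continuous_fst).mul (hM.isExpMap.continuous.comp
        ((continuous_modelEquiv.comp (continuous_subtype_val.comp continuous_snd)).const_smul
          Complex.I))
    refine (QuotientGroup.continuous_mk.comp h1).congr fun p => ?_
    exact (polarPoint_eq (e := e) _ _).symm
  exact ⟨⟨Quot.lift f hfr, continuous_quot_lift hfr hf⟩, fun g ξ => rfl⟩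

theorem polyhedron_subset (h𝔞 : 𝔞₀ ≤ noncompactPart σ θ) {X : GroupLieAlgebra 𝓘(ℂ, E) G}
    (hX : X ∈ polyhedron σ 𝔞₀) : X ∈ noncompactPart σ θ := by
  obtain ⟨ξ, rfl, -⟩ := hX
  exact h𝔞 ξ.2

theorem smul_mem_polyhedron {X : GroupLieAlgebra 𝓘(ℂ, E) G} (hX : X ∈ polyhedron σ 𝔞₀) {t : ℝ}
    (h0 : 0 ≤ t) (h1 : t ≤ 1) : t • X ∈ polyhedron σ 𝔞₀ := by
  obtain ⟨ξ, rfl, hξ⟩ := hX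
  refine ⟨t • ξ, rfl, fun α hα => ?_⟩
  rw [map_smul, smul_eq_mul, abs_mul, abs_of_nonneg h0]
  exact (mul_le_of_le_one_left (abs_nonneg _) h1).trans_lt (hξ α hα)

theorem zero_mem_polyhedron : (0 : GroupLieAlgebra 𝓘(ℂ, E) G) ∈ polyhedron σ 𝔞₀ :=
  ⟨0, rfl, fun α _ => by rw [map_zero, abs_zero]; positivity⟩

theorem zeroSection_subset_tube : zeroSection σ θ ⊆ tube σ θ 𝔞₀ := by
  rintro _ ⟨g, rfl⟩
  exact ⟨g, 0, zero_mem_polyhedron, rfl⟩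

/-- Polar coordinates identify the tube with the universal domain. -/
theorem IsCartanModel.exists_tube_homeomorph (hM : IsCartanModel σ θ e L σ' θ')
    (h𝔞 : 𝔞₀ ≤ noncompactPart σ θ) (hab : ∀ X ∈ 𝔞₀, ∀ Y ∈ 𝔞₀, ⁅X, Y⁆ = 0)
    (polar : C(TangentM σ θ, G ⧸ K σ θ))
    (hpolar : ∀ (g : G₀ σ) (ξ : noncompactPart σ θ),
      polar (tangentMk g ξ) = polarPoint σ θ g ξ) :
    ∃ f : tube σ θ 𝔞₀ ≃ₜ universalDomain σ θ 𝔞₀, ∀ v, (f v : G ⧸ K σ θ) = polar v := by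
  have C := hM.cartanData
  have hE := hM.isExpMap
  obtain ⟨Λ, hΛ⟩ := exists_continuous_leftInverse C.injective
  obtain ⟨Θ, hΘ⟩ := hM.exists_tangent_homeomorph hΛ
  have hmaps : ∀ v : tube σ θ 𝔞₀, polar v ∈ universalDomain σ θ 𝔞₀ := by
    rintro ⟨_, g, ξ, hξ, rfl⟩
    exact ⟨g, g.2, ξ, hξ, hpolar g ξ⟩
  let f : tube σ θ 𝔞₀ → universalDomain σ θ 𝔞₀ := fun v => ⟨polar v, hmaps v⟩
  have hf : Continuous f := (polar.continuous.comp continuous_subtype_val).subtype_mk _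
  let q : G ⧸ K σ θ → (H →L[ℂ] H) := Quotient.lift (cartanImmersion (modelAd e) σ' θ') (by
    intro g h hgh
    have h1 : g⁻¹ * h ∈ complexGroup (modelExp e) σ' θ' := by
      rw [← hM.K_eq]; exact QuotientGroup.leftRel_apply.1 hgh
    rw [← hE.cartanImmersion_mul C g h1, mul_inv_cancel_left])
  have hq : Continuous q := (continuous_cartanImmersion continuous_modelAd).quotient_lift _
  have hqf : ∀ v, q (polar v) = exp (L (Θ v : H × H).1) *
      exp (L ((2 * Complex.I) • (Θ v : H × H).2)) * exp (L (Θ v : H × H).1) := by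
    rintro ⟨g, ξ⟩
    change q (polar (tangentMk g ξ)) = exp (L (Θ (tangentMk g ξ) : H × H).1) *
      exp (L ((2 * Complex.I) • (Θ (tangentMk g ξ) : H × H).2)) *
        exp (L (Θ (tangentMk g ξ) : H × H).1)
    have hm := (Θ (tangentMk g ξ)).2
    rw [hΘ] at hm ⊢
    have hk := hM.cartanCompact_mem hΛ g.2
    rw [← hE.cartanImmersion_exp_mul_exp C hm.1.1 hm.1.2 hm.2.1 hm.2.2, hpolar,
      polarPoint_eq (e := e)]
    change cartanImmersion (modelAd e) σ' θ' _ = _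
    rw [hM.K₀_eq] at hk
    rw [← hE.cartanImmersion_mul C (modelExp e (cartanLog e Λ (g : G)) * _)
      (compactGroup_le_complexGroup hk)]
    congr 1
    have h1 : Complex.I • modelAd e (cartanCompact e Λ (g : G)) (e ξ) =
        modelAd e (cartanCompact e Λ (g : G)) (Complex.I • e ξ) := (map_smul _ _ _).symm
    simp only [h1]
    rw [← hE.conj]
    conv_lhs => rw [← hM.exp_mul_cartanCompact (Λ := Λ) (g : G)]
    group
  have hnorm : ∀ v : tube σ θ 𝔞₀, ‖L (Θ v : H × H).2‖ < Real.pi / 2 := by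
    rintro ⟨_, g, ξ, hξ, rfl⟩
    have hk := hM.cartanCompact_mem hΛ g.2
    rw [hM.K₀_eq] at hk
    rw [hΘ, C.norm_L_apply_compact hE hM.isBracketHom_modelAd hk]
    exact hM.norm_lt h𝔞 hab hξ
  -- This one convergence statement yields both remaining facts: injectivity, from a constant family
  -- along `pure v`, and the inducing property, from the filter pulled back along `q ∘ polar`.
  have htend : ∀ (l : Filter (tube σ θ 𝔞₀)) (w : tube σ θ 𝔞₀ → tube σ θ 𝔞₀) (v : tube σ θ 𝔞₀),
      Tendsto (fun i => q (polar (w i))) l (𝓝 (q (polar v))) → Tendsto w l (𝓝 v) := by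
    intro l w v h
    simp only [hqf] at h
    obtain ⟨h1, h2⟩ := tendsto_of_tendsto_polar C (fun i => (Θ (w i)).2.1.1)
      (fun i => (Θ (w i)).2.1.2) (fun i => (Θ (w i)).2.2.2) (fun i => hnorm (w i))
      (Θ v).2.1.1 (Θ v).2.1.2 (Θ v).2.2.2 (hnorm v) h
    have h3 : Tendsto (fun i => (Θ (w i) : H × H)) l (𝓝 (Θ v)) := h1.prodMk_nhds h2
    rw [tendsto_subtype_rng]
    have h4 : Tendsto (fun i => Θ (w i)) l (𝓝 (Θ v)) := tendsto_subtype_rng.2 h3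
    have h5 := (Θ.symm.continuous.tendsto _).comp h4
    simpa [Function.comp_def] using h5
  have hinj : Function.Injective f := by
    intro v w h
    have h1 : polar v = polar w := congrArg Subtype.val h
    have h2 := htend (pure v) (fun _ => v) w (by rw [h1]; exact tendsto_const_nhds)
    have h3 := htend (pure v) (fun _ => v) v tendsto_const_nhds
    have : T2Space (tube σ θ 𝔞₀) := by
      have : T2Space (TangentM σ θ) := Θ.symm.t2Space
      infer_instance
    exact tendsto_nhds_unique h3 h2
  have hsurj : Function.Surjective f := by
    rintro ⟨_, g, hg, ξ, hξ, rfl⟩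
    exact ⟨⟨tangentMk ⟨g, hg⟩ ⟨ξ, polyhedron_subset h𝔞 hξ⟩, _, _, hξ, rfl⟩,
      Subtype.ext (hpolar _ _)⟩
  have hind : IsInducing (fun v : tube σ θ 𝔞₀ => q (polar v)) := by
    refine isInducing_iff_nhds.2 fun v => le_antisymm ?_ ?_
    · exact ((hq.comp (polar.continuous.comp continuous_subtype_val)).tendsto v).le_comap
    · exact htend (Filter.comap (fun v : tube σ θ 𝔞₀ => q (polar v)) (𝓝 (q (polar v)))) id v
        tendsto_comap
  -- A continuous `f` is inducing as soon as its composite with a continuous map is.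
  have hfi : IsInducing f := IsInducing.of_comp hf (hq.comp continuous_subtype_val) hind
  exact ⟨(Equiv.ofBijective f ⟨hinj, hsurj⟩).toHomeomorphOfIsInducing hfi, fun v => rfl⟩

/-- Here base and fibre are scaled together: `[exp(tη) k, t ξ]` has coordinates `(tη, t Ad(k) ξ)`,
so the image of the tube is star-shaped about the origin. -/
theorem IsCartanModel.contractibleSpace_tube (hM : IsCartanModel σ θ e L σ' θ') :
    ContractibleSpace (tube σ θ 𝔞₀) := by
  obtain ⟨Λ, hΛ⟩ := exists_continuous_leftInverse hM.cartanData.injective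
  obtain ⟨Θ, hΘ⟩ := hM.exists_tangent_homeomorph hΛ
  have hemb : IsEmbedding fun v => (Θ v : H × H) := IsEmbedding.subtypeVal.comp Θ.isEmbedding
  have hstar : StarConvex ℝ 0 ((fun v => (Θ v : H × H)) '' tube σ θ 𝔞₀) := by
    rw [starConvex_zero_iff]
    rintro _ ⟨_, ⟨g, ξ, hξ, rfl⟩, rfl⟩ t ht0 ht1
    have hη := hM.cartanLog_mem hΛ g.2
    have hk := hM.cartanCompact_mem hΛ g.2
    have htη : t • cartanLog e Λ (g : G) ∈ symmetricSet σ' θ' :=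
      starConvex_zero_iff.1 starConvex_symmetricSet hη ht0 ht1
    refine ⟨tangentMk ⟨modelExp e (t • cartanLog e Λ (g : G)) * cartanCompact e Λ (g : G),
      (G₀ σ).mul_mem (hM.modelExp_mem htη) (K₀_le_G₀ hk)⟩ (t • ξ),
      ⟨_, _, smul_mem_polyhedron hξ ht0 ht1, rfl⟩, ?_⟩
    simp only [hΘ, hM.cartanLog_exp_mul hΛ htη hk, hM.cartanCompact_exp_mul hΛ htη hk]
    refine Prod.ext rfl ?_
    change modelAd e _ (e (t • (ξ : GroupLieAlgebra 𝓘(ℂ, E) G))) = t • modelAd e _ (e ξ)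
    rw [← Complex.coe_smul, ← Complex.coe_smul, map_smul, map_smul]
  have : ContractibleSpace ((fun v => (Θ v : H × H)) '' tube σ θ 𝔞₀) :=
    hstar.contractibleSpace ⟨_, Set.mem_image_of_mem _ (zeroSection_subset_tube ⟨1, rfl⟩)⟩
  exact (hemb.homeomorphImage (tube σ θ 𝔞₀)).contractibleSpace

theorem lieAd_real_smul (k : G) (t : ℝ) (X : GroupLieAlgebra 𝓘(ℂ, E) G) :
    lieAd k (t • X) = t • lieAd k X := by
  rw [← Complex.coe_smul, ← Complex.coe_smul]
  exact map_smul (mfderiv 𝓘(ℂ, E) 𝓘(ℂ, E) (fun h : G => k * h * k⁻¹) 1) (t : ℂ) X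

/-- The scaling of the fibres of the tangent bundle. -/
noncomputable def tangentScale (t : ℝ) : TangentM σ θ → TangentM σ θ :=
  Quot.map (fun p => (p.1, t • p.2)) (by
    rintro p q ⟨k, hk, h1, h2⟩
    refine ⟨k, hk, h1, ?_⟩
    exact (congrArg (fun X => t • X) h2).trans (lieAd_real_smul k t _).symm)

theorem tangentScale_mk (t : ℝ) (g : G₀ σ) (ξ : noncompactPart σ θ) :
    tangentScale t (tangentMk g ξ) = tangentMk g (t • ξ) := rfl

theorem tangentScale_mem_tube {t : ℝ} (h0 : 0 ≤ t) (h1 : t ≤ 1) {v : TangentM σ θ}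
    (hv : v ∈ tube σ θ 𝔞₀) : tangentScale t v ∈ tube σ θ 𝔞₀ := by
  obtain ⟨g, ξ, hξ, rfl⟩ := hv
  exact ⟨g, t • ξ, smul_mem_polyhedron hξ h0 h1, rfl⟩

/-- Joint continuity is checked in the trivialization, where scaling is `(η, ζ) ↦ (η, tζ)`; this
avoids asking whether the product with `ℝ` is still a quotient. -/
theorem IsCartanModel.continuous_tangentScale (hM : IsCartanModel σ θ e L σ' θ') :
    Continuous fun p : ℝ × TangentM σ θ => tangentScale p.1 p.2 := by
  obtain ⟨Λ, hΛ⟩ := exists_continuous_leftInverse hM.cartanData.injective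
  obtain ⟨Θ, hΘ⟩ := hM.exists_tangent_homeomorph hΛ
  rw [← Θ.comp_continuous_iff, IsInducing.subtypeVal.continuous_iff]
  have h1 : Continuous fun p : ℝ × TangentM σ θ =>
      (((Θ p.2 : H × H).1, p.1 • (Θ p.2 : H × H).2) : H × H) := by fun_prop
  refine h1.congr ?_
  rintro ⟨t, ⟨g, ξ⟩⟩
  change (((Θ (tangentMk g ξ) : H × H).1, t • (Θ (tangentMk g ξ) : H × H).2) : H × H) =
    Θ (tangentMk g (t • ξ))
  rw [hΘ, hΘ]
  refine Prod.ext rfl ?_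
  change t • modelAd e _ (e ξ) = modelAd e _ (e (t • (ξ : GroupLieAlgebra 𝓘(ℂ, E) G)))
  rw [← Complex.coe_smul, ← Complex.coe_smul, map_smul, map_smul]

theorem IsCartanModel.exists_deformationRetraction (hM : IsCartanModel σ θ e L σ' θ') :
    ∃ φ : unitInterval × tube σ θ 𝔞₀ → tube σ θ 𝔞₀,
      (∀ (t : unitInterval) (v : tube σ θ 𝔞₀) (g : G₀ σ) (ξ : noncompactPart σ θ),
        (v : TangentM σ θ) = tangentMk g ξ →
        (φ (t, v) : TangentM σ θ) = tangentMk g ((t : ℝ) • ξ)) ∧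
      IsStrongDeformationRetraction
        {v : tube σ θ 𝔞₀ | (v : TangentM σ θ) ∈ zeroSection σ θ} φ := by
  refine ⟨fun p => ⟨tangentScale (p.1 : ℝ) p.2, tangentScale_mem_tube p.1.2.1 p.1.2.2 p.2.2⟩,
    fun t v g ξ h => ?_, ?_, ?_, ?_, ?_⟩
  · change tangentScale (t : ℝ) (v : TangentM σ θ) = _
    rw [h, tangentScale_mk]
  · refine Continuous.subtype_mk ?_ _
    exact hM.continuous_tangentScale.comp ((continuous_subtype_val.comp continuous_fst).prodMk
      (continuous_subtype_val.comp continuous_snd))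
  · rintro ⟨_, g, ξ, hξ, rfl⟩
    refine Subtype.ext ?_
    change tangentScale 1 (tangentMk g ξ) = tangentMk g ξ
    rw [tangentScale_mk, one_smul]
  · rintro ⟨_, g, ξ, hξ, rfl⟩
    refine ⟨g, ?_⟩
    change tangentScale 0 (tangentMk g ξ) = tangentMk g 0
    rw [tangentScale_mk, zero_smul]
  · rintro t ⟨v, hv⟩ ⟨g, hg⟩
    refine Subtype.ext ?_
    change tangentScale (t : ℝ) v = v
    change v = _ at hg
    rw [hg, tangentScale_mk, smul_zero]

theorem lieAd_zero (k : G) : lieAd k (0 : GroupLieAlgebra 𝓘(ℂ, E) G) = 0 :=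
  map_zero (mfderiv 𝓘(ℂ, E) 𝓘(ℂ, E) (fun h : G => k * h * k⁻¹) 1)

/-- The inverse is the restriction of the bundle projection `[g, ξ] ↦ g K₀`. -/
theorem exists_zeroSection_homeomorph :
    ∃ z : SymmetricSpace σ θ ≃ₜ zeroSection σ θ, ∀ g : G₀ σ,
      (z (QuotientGroup.mk g) : TangentM σ θ) = tangentMk g 0 := by
  let f : G₀ σ → zeroSection σ θ := fun g => ⟨tangentMk g 0, g, rfl⟩
  have hf : Continuous f :=
    (continuous_quot_mk.comp (Continuous.prodMk continuous_id continuous_const)).subtype_mk _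
  have hfr : ∀ g h : G₀ σ, QuotientGroup.leftRel ((K₀ σ θ).subgroupOf (G₀ σ)) g h →
      f g = f h := by
    intro g h hgh
    rw [QuotientGroup.leftRel_apply, Subgroup.mem_subgroupOf] at hgh
    refine Subtype.ext (Quot.sound ⟨_, hgh, ?_, ?_⟩)
    · simp
    · exact (lieAd_zero _).symm
  let π₀ : G₀ σ × noncompactPart σ θ → SymmetricSpace σ θ := fun p => QuotientGroup.mk p.1
  have hπ₀ : Continuous π₀ := QuotientGroup.continuous_mk.comp continuous_fst
  have hπr : ∀ p q, tangentRel σ θ p q → π₀ p = π₀ q := by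
    rintro p q ⟨k, hk, h1, -⟩
    refine QuotientGroup.eq.2 ?_
    rw [Subgroup.mem_subgroupOf]
    simpa [h1] using hk
  refine ⟨⟨⟨Quotient.lift f hfr, fun v => Quot.lift π₀ hπr v.1, ?_, ?_⟩, hf.quotient_lift hfr,
    (continuous_quot_lift hπr hπ₀).comp continuous_subtype_val⟩, fun g => rfl⟩
  · rintro ⟨g⟩
    rfl
  · rintro ⟨_, g, rfl⟩
    rfl

end Domain

end UniversalDomain

theorem mainTheorem9
    {E : Type*} [NormedAddCommGroup E] [NormedSpace ℂ E] [FiniteDimensional ℂ E] [CompleteSpace E]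
    {G : Type*} [TopologicalSpace G] [ChartedSpace E G] [Group G] [LieGroup 𝓘(ℂ, E) ω G]
    [LieAlgebra.IsSemisimple ℂ (GroupLieAlgebra 𝓘(ℂ, E) G)]
    (σ θ : GroupLieAlgebra 𝓘(ℂ, E) G →ₛₗ[starRingEnd ℂ] GroupLieAlgebra 𝓘(ℂ, E) G)
    (hσ : UniversalDomain.IsConjugation σ)
    (hθ : UniversalDomain.IsCartanInvolution θ)
    (hσθ : ∀ X, σ (θ X) = θ (σ X))
    (𝔞₀ : Submodule ℝ (GroupLieAlgebra 𝓘(ℂ, E) G))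
    (h𝔞₀ : UniversalDomain.IsMaximalAbelian σ θ 𝔞₀) :
    -- the universal domain is contractible
    ContractibleSpace (UniversalDomain.universalDomain σ θ 𝔞₀) ∧
    -- polar coordinates are well defined on `TM` and identify the tube over `V` with the domain
    (∃ polar : C(UniversalDomain.TangentM σ θ, G ⧸ UniversalDomain.K σ θ),
      (∀ (g : UniversalDomain.G₀ σ) (ξ : UniversalDomain.noncompactPart σ θ),
        polar (UniversalDomain.tangentMk g ξ) = UniversalDomain.polarPoint σ θ g ξ) ∧
      ∃ e : UniversalDomain.tube σ θ 𝔞₀ ≃ₜ UniversalDomain.universalDomain σ θ 𝔞₀,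
        ∀ v, (e v : G ⧸ UniversalDomain.K σ θ) = polar v) ∧
    -- scaling of the fibres is a strong deformation retraction of the tube onto the zero section
    (UniversalDomain.zeroSection σ θ ⊆ UniversalDomain.tube σ θ 𝔞₀ ∧
      ∃ φ : unitInterval × UniversalDomain.tube σ θ 𝔞₀ → UniversalDomain.tube σ θ 𝔞₀,
        (∀ (t : unitInterval) (v : UniversalDomain.tube σ θ 𝔞₀) (g : UniversalDomain.G₀ σ)
          (ξ : UniversalDomain.noncompactPart σ θ),
          (v : UniversalDomain.TangentM σ θ) = UniversalDomain.tangentMk g ξ →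
          (φ (t, v) : UniversalDomain.TangentM σ θ) =
            UniversalDomain.tangentMk g ((t : ℝ) • ξ)) ∧
        UniversalDomain.IsStrongDeformationRetraction
          {v : UniversalDomain.tube σ θ 𝔞₀ | (v : UniversalDomain.TangentM σ θ) ∈
            UniversalDomain.zeroSection σ θ} φ) ∧
    -- the zero section is a copy of `M = G₀ / K₀`, and `M` is contractible
    (∃ z : UniversalDomain.SymmetricSpace σ θ ≃ₜ UniversalDomain.zeroSection σ θ,
      ∀ g : UniversalDomain.G₀ σ,
        (z (QuotientGroup.mk g) : UniversalDomain.TangentM σ θ) =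
          UniversalDomain.tangentMk g 0) ∧
    ContractibleSpace (UniversalDomain.SymmetricSpace σ θ) := by
  have := topologicalGroup_of_lieGroup 𝓘(ℂ, E) ω (G := G)
  have : Module.Finite ℂ (GroupLieAlgebra 𝓘(ℂ, E) G) := inferInstanceAs (Module.Finite ℂ E)
  obtain ⟨e, L, σ', θ', hM⟩ := UniversalDomain.exists_isCartanModel hσ hθ hσθ
  obtain ⟨Λ, hΛ⟩ := UniversalDomain.exists_continuous_leftInverse hM.cartanData.injective
  obtain ⟨polar, hpolar⟩ := hM.exists_polarMap
  obtain ⟨f, hf⟩ := hM.exists_tube_homeomorph h𝔞₀.prop.1 h𝔞₀.prop.2 polar hpolar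
  have := hM.contractibleSpace_tube (𝔞₀ := 𝔞₀)
  exact ⟨f.symm.contractibleSpace, ⟨polar, hpolar, f, hf⟩,
    ⟨UniversalDomain.zeroSection_subset_tube, hM.exists_deformationRetraction⟩,
    UniversalDomain.exists_zeroSection_homeomorph, hM.contractibleSpace_symmetricSpace hΛ⟩
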